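/- Let $0<\alpha\le 2$, $d\ge 1$, and let $\xi=(\xi_1,\dots,\xi_d)$ be a symmetric $\alpha$-stable ($S\alpha S$) random vector in $\mathbb R^d$ that is not almost surely zero: $\xi$ and $-\xi$ have the same law and, for all $a,b>0$ and independent copies $\xi',\xi''$ of $\xi$, $a^{1/\alpha}\xi'+b^{1/\alpha}\xi''$ has the law of $(a+b)^{1/\alpha}\xi$. Let $F$ be its associated star body, i.e. the origin-symmetric closed star body (unbounded if $\xi$ is not full-dimensional), with continuous Minkowski functional $\|u\|_F=\inf\{s>0: u\in sF\}$, such that $\mathbb E e^{i\langle\xi,u\rangle}=e^{-\|u\|_F^\alpha}$ for all $u\in\mathbb R^d$. Write $t^{\langle p\rangle}=|t|^p\,\mathrm{sign}(t)$, $\mathrm{sign}(0)=0$, and let $B$ be the closed unit Euclidean ball. For a function $g$ that is singular on the coordinate hyperplanes, the principal value of $\int_F g(u)\,du$ is the limit, as $\varepsilon\downarrow0$, of the integral over $F\setminus\varepsilon B$, the latter being itself the principal value $$\lim_{\delta\downarrow0}\int_{\{u\in F\setminus\varepsilon B:\ |u_i|>\delta\|u\|\ \text{for all } i\}}g(u)\,du$$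 along the coordinate hyperplanes (all the truncated integrals converge absolutely). Let $\lambda_1,\dots,\lambda_d\ge0$ be such that $\lambda_i\neq1$ for all $i$ and $\lambda=\sum_i\lambda_i<\alpha$. Then $\xi_1^{\langle\lambda_1\rangle}\cdots\xi_d^{\langle\lambda_d\rangle}$ is integrable, and: 1. If $d$ is even, then $$\mathbb E\bigl(\xi_1^{\langle\lambda_1\rangle}\cdots\xi_d^{\langle\lambda_d\rangle}\bigr)=\frac{2^\lambda i^d}{\pi^{d/2}}\,\Gamma\Bigl(1-\frac\lambda\alpha\Bigr)\prod_{j=1}^d\frac{\Gamma\bigl(1+\frac{\lambda_j}2\bigr)}{\Gamma\bigl(\frac12-\frac{\lambda_j}2\bigr)}\int_F u_1^{\langle-\lambda_1-1\rangle}\cdots u_d^{\langle-\lambda_d-1\rangle}\,du .$$ If all $\lambda_j<1$, the integral is the principal value, which exists. If some $\lambda_j>1$ (at most one), it is the corresponding Hadamard finite part, which exists: for each small $\varepsilon$ one discards from the integral over the set truncated by $\varepsilon,\delta$ a divergent term $c\,\delta^{1-\lambda_j}$, with $c$ independent of $\delta$ (it may depend on $\varepsilon$), before letting $\delta\downarrow0$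 and then $\varepsilon\downarrow0$. 2. If $d$ is odd, then $\mathbb E\bigl(\xi_1^{\langle\lambda_1\rangle}\cdots\xi_d^{\langle\lambda_d\rangle}\bigr)=0$. Moreover, if $d$ is even, the principal value $\mathcal I(F)$ of $\int_F\frac{du}{u_1\cdots u_d}$ exists and $$\mathbb E\,\mathrm{sign}(\xi_1\cdots\xi_d)=\frac{i^d}{\pi^d}\,\mathcal I(F).$$ -/

import Mathlib

open MeasureTheory Filter Topology

noncomputable section

/-- The signed power `t^⟨p⟩ = |t|^p sign t` of a real number. -/
def signedPow (t p : ℝ) : ℝ := |t| ^ p * Real.sign t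

/-- The random vector `ξ` is symmetric `α`-stable: `ξ` and `-ξ` have the same law, and for all
`a, b > 0` and independent copies `ξ₁, ξ₂` of `ξ`, the vectors `a^{1/α} ξ₁ + b^{1/α} ξ₂` and
`(a + b)^{1/α} ξ` have the same law. -/
def IsSymmetricStable {Ω : Type*} [MeasurableSpace Ω] {d : ℕ} (α : ℝ)
    (ξ : Ω → EuclideanSpace ℝ (Fin d)) (P : Measure Ω) : Prop :=
  (P.map ξ).map (fun x => -x) = P.map ξ ∧
  ∀ a b : ℝ, 0 < a → 0 < b →
    ((P.map ξ).prod (P.map ξ)).map (fun p => a ^ (1 / α) • p.1 + b ^ (1 / α) • p.2) =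
      (P.map ξ).map (fun x => (a + b) ^ (1 / α) • x)

/-- A centred star body with the origin in its interior. Boundedness is not required, since the
star body of a stable law that is not full-dimensional is unbounded. -/
structure IsCentredStarBody {d : ℕ} (F : Set (EuclideanSpace ℝ (Fin d))) : Prop where
  isClosed : IsClosed F
  zero_mem_interior : (0 : EuclideanSpace ℝ (Fin d)) ∈ interior F
  smul_mem_interior : ∀ u ∈ F, ∀ t : ℝ, 0 ≤ t → t < 1 → t • u ∈ interior F
  neg_mem : ∀ u ∈ F, -u ∈ F
  continuous_gauge : Continuous (gauge F)

/-- `F` is the star body associated with the symmetric `α`-stable vector `ξ`: the characteristic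
function of `ξ` is `u ↦ exp (-‖u‖_F ^ α)`, where `‖·‖_F` is the Minkowski functional of `F`. -/
structure IsAssociatedStarBody {Ω : Type*} [MeasurableSpace Ω] {d : ℕ} (α : ℝ)
    (ξ : Ω → EuclideanSpace ℝ (Fin d)) (P : Measure Ω)
    (F : Set (EuclideanSpace ℝ (Fin d))) : Prop where
  isCentredStarBody : IsCentredStarBody F
  charFun_eq : ∀ u, charFun (P.map ξ) u = ((Real.exp (-(gauge F u ^ α)) : ℝ) : ℂ)

/-- The set `F ∖ εB`, from which moreover the conical neighbourhoods `|uᵢ| ≤ δ‖u‖` of the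
coordinate hyperplanes are removed. In polar coordinates `u = r v` the latter removes the
neighbourhoods `|vᵢ| ≤ δ` of the great subspheres `vᵢ = 0` of the unit sphere. -/
def truncatedBody {d : ℕ} (F : Set (EuclideanSpace ℝ (Fin d))) (ε δ : ℝ) :
    Set (EuclideanSpace ℝ (Fin d)) :=
  {u | u ∈ F ∧ u ∉ Metric.closedBall 0 ε ∧ ∀ i, δ * ‖u‖ < |u i|}

/-- `L` is the principal value of `∫_F g(u) du`, for `g` singular on the coordinate hyperplanes:
the limit, as `ε → 0`, of the integral over `F ∖ εB`, itself understood as its principal value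
`lim_{δ → 0} ∫_{u ∈ F ∖ εB, |uᵢ| > δ‖u‖ ∀ i} g(u) du` along the coordinate hyperplanes. -/
def HasPrincipalValue {d : ℕ} (F : Set (EuclideanSpace ℝ (Fin d)))
    (g : EuclideanSpace ℝ (Fin d) → ℝ) (L : ℝ) : Prop :=
  (∀ ε δ : ℝ, 0 < ε → 0 < δ → IntegrableOn g (truncatedBody F ε δ)) ∧
  ∃ J : ℝ → ℝ,
    (∀ᶠ ε in 𝓝[>] (0 : ℝ),
      Tendsto (fun δ : ℝ => ∫ u in truncatedBody F ε δ, g u) (𝓝[>] 0) (𝓝 (J ε))) ∧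
    Tendsto J (𝓝[>] 0) (𝓝 L)

/-- `L` is the regularized (Hadamard finite part) value of `∫_F ∏ uᵢ^⟨-lamᵢ-1⟩ du`: as
`HasPrincipalValue`, except that for every `i` with `lamᵢ > 1` a divergent term, a multiple of the
negative power `δ^{1-lamᵢ}`, is discarded. If no `lamᵢ` exceeds `1`, nothing is discarded and this
is the principal value. -/
def HasRegularizedIntegral {d : ℕ} (F : Set (EuclideanSpace ℝ (Fin d))) (lam : Fin d → ℝ)
    (L : ℝ) : Prop :=
  (∀ ε δ : ℝ, 0 < ε → 0 < δ →
    IntegrableOn (fun u : EuclideanSpace ℝ (Fin d) => ∏ i, signedPow (u i) (-lam i - 1))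
      (truncatedBody F ε δ)) ∧
  ∃ (J : ℝ → ℝ) (c : ℝ → Fin d → ℝ),
    (∀ᶠ ε in 𝓝[>] (0 : ℝ),
      Tendsto (fun δ : ℝ =>
          (∫ u in truncatedBody F ε δ, ∏ i, signedPow (u i) (-lam i - 1)) -
            ∑ i with 1 < lam i, c ε i * δ ^ (1 - lam i))
        (𝓝[>] 0) (𝓝 (J ε))) ∧
    Tendsto J (𝓝[>] 0) (𝓝 L)

end

/-! Write k(u) = ∏ u_i^⟨-λ_i-1⟩ and N for the gauge of F, and let z be a standard Gaussian variable
independent of ξ. The integral over the whole space of k(u) E ∏ sin(z u_i ξ_i), regularized where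
necessary, is evaluated in two ways.

Moment side. Put H(y) = E ∏ sin(z y_i). The coordinatewise substitution y = uξ extracts ∏ ξ_i^⟨λ_i⟩,
so the integral is the wanted moment times ∫ k H (`integral_prodSignedPow_mul_average`). That
constant is E|z|^λ times a product of one-dimensional sine integrals
(`integral_prodSignedPow_mul_sinAverage`), whose values are Gamma quotients (`sinConst_eq`). The
Gaussian variable is there for absolute convergence: for λ_i = 0 the Dirichlet integral converges
only conditionally, whereas H is a combination of Gaussians in the signed sums ∑ ±y_i, and k H is
absolutely integrable (`integrable_prod_rpow_mul_gaussFourier`).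

Body side. Up to the factor i^d, the ξ-average of the sines is the signed average of the
characteristic function exp(-N(zu)^α) over all coordinate reflections of u. Since k picks up the
same signs, the sines may be replaced by that exponential (`IsStableLaw.integral_mul_average_eq`).
The exponential is a mixture of indicators of dilates of F, and homogeneity of k turns its integral
into Γ(1-λ/α) times the integral of k over F (`IsStableLaw.tendsto_expIntegral`); the scaling by z
gives E|z|^λ, which cancels. The origin is harmless: k is odd under a single reflection, so its
integral over every annulus vanishes and the integral over F ∖ εB is constant for small ε. Since F
may be unbounded, integrability at infinity comes from bounding N below by a single linear form
(`IsStableLaw.exists_lower_bound`, `IsStableLaw.exists_majorant`).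

The body side is carried out with the cones |u_i| ≤ δ‖u‖ removed, and δ → 0 is taken on the moment
side. If all λ_i < 1 this is dominated convergence. Otherwise a single λ_j exceeds 1, because λ < α
≤ 2. In that coordinate sin t is replaced by sin t - t, and the linear term contributes a function
of the other coordinates times |u_j|^(-λ_j), whose integral off the cones is c δ^(1-λ_j) + o(1)
(`tendsto_integral_prodConeRegion`). For odd d the moment vanishes by symmetry, and the statement on
signs is the case λ = 0. -/

noncomputable section

namespace StableMoment

/-! ### Gaussian Fourier transforms of products of sine kernels -/

section

/-- The standard Gaussian law on the line. -/
abbrev stdGauss : Measure ℝ := ProbabilityTheory.gaussianReal 0 1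

/-- The sine, from which its linear part is subtracted when the exponent exceeds one. -/
def sinKernel (l t : ℝ) : ℝ := if 1 < l then Real.sin t - t else Real.sin t

/-- The size of `sinKernel l` near zero and near infinity. -/
def sinWeight (l t : ℝ) : ℝ := if 1 < l then min (t ^ 2) |t| else min 1 |t|

/-- The Fourier transform of `z ^ k * m z` with respect to the Gaussian law. -/
def gaussFourier (m : ℝ → ℝ) (k : ℕ) (s : ℝ) : ℂ :=
  ∫ z, (z : ℂ) ^ k * Complex.exp (s * z * Complex.I) * m z ∂stdGauss

/-- All polynomial moments of `m` with respect to the Gaussian law are finite. -/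
def HasAllMoments (m : ℝ → ℝ) : Prop :=
  AEStronglyMeasurable m stdGauss ∧ ∀ k : ℕ, Integrable (fun z => |z| ^ k * |m z|) stdGauss

theorem continuous_sinKernel (l : ℝ) : Continuous (sinKernel l) := by
  unfold sinKernel; split_ifs <;> fun_prop

theorem abs_sinKernel_le (l t : ℝ) : |sinKernel l t| ≤ 2 * |t| := by
  have h : |Real.sin t| ≤ |t| := Real.abs_sin_le_abs
  unfold sinKernel; split_ifs
  · calc |Real.sin t - t| ≤ |Real.sin t| + |t| := abs_sub _ _
      _ ≤ _ := by linarith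
  · linarith [abs_nonneg t]

theorem hasAllMoments_one : HasAllMoments (fun _ => 1) := by
  refine ⟨aestronglyMeasurable_const, fun k => ?_⟩
  have h := (ProbabilityTheory.memLp_id_gaussianReal' (μ := 0) (v := 1) (k : ENNReal)
    (by simp)).integrable_norm_pow' 
  simpa using h

theorem HasAllMoments.mul_sinKernel {m : ℝ → ℝ} (hm : HasAllMoments m) (l y : ℝ) :
    HasAllMoments (fun z => sinKernel l (y * z) * m z) := by
  have hc : Continuous fun z => sinKernel l (y * z) :=
    (continuous_sinKernel l).comp (continuous_const.mul continuous_id)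
  refine ⟨hc.aestronglyMeasurable.mul hm.1, fun k => ?_⟩
  refine ((hm.2 (k + 1)).const_mul (2 * |y|)).mono' ?_ (ae_of_all _ fun z => ?_)
  · exact ((continuous_abs.pow k).aestronglyMeasurable).mul
      (hc.aestronglyMeasurable.mul hm.1).norm
  · have h := abs_sinKernel_le l (y * z)
    rw [abs_mul] at h
    simp only [Real.norm_eq_abs, abs_mul, abs_pow, abs_abs, pow_succ]
    calc |z| ^ k * (|sinKernel l (y * z)| * |m z|) ≤ |z| ^ k * ((2 * (|y| * |z|)) * |m z|) := by
          gcongr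
      _ = _ := by ring

theorem HasAllMoments.integrable {m : ℝ → ℝ} (hm : HasAllMoments m) (k : ℕ) (s : ℝ) :
    Integrable (fun z : ℝ => (z : ℂ) ^ k * Complex.exp (s * z * Complex.I) * m z) stdGauss := by
  refine (hm.2 k).mono' ?_ (ae_of_all _ fun z => ?_)
  · have : Continuous fun z : ℝ => (z : ℂ) ^ k * Complex.exp (s * z * Complex.I) := by fun_prop
    exact this.aestronglyMeasurable.mul (Complex.continuous_ofReal.comp_aestronglyMeasurable hm.1)
  · rw [norm_mul, norm_mul, ← Complex.ofReal_mul, Complex.norm_exp_ofReal_mul_I]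
    simp

/-- Differentiation in s brings down a factor z. This is why bounds are carried for all k at once:
smoothness in s at order k is paid for by size at order k + 1. -/
theorem hasDerivAt_gaussFourier {m : ℝ → ℝ} (hm : HasAllMoments m) (k : ℕ) (s : ℝ) :
    HasDerivAt (gaussFourier m k) (Complex.I * gaussFourier m (k + 1) s) s := by
  have h := hasDerivAt_integral_of_dominated_loc_of_deriv_le (μ := stdGauss)
    (F := fun (s z : ℝ) => (z : ℂ) ^ k * Complex.exp (s * z * Complex.I) * m z)
    (F' := fun (s z : ℝ) =>
      Complex.I * ((z : ℂ) ^ (k + 1) * Complex.exp (s * z * Complex.I) * m z))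
    (x₀ := s) (s := Set.univ) (bound := fun z => |z| ^ (k + 1) * |m z|) univ_mem
    (Eventually.of_forall fun x => (hm.integrable k x).1) (hm.integrable k s)
    ((hm.integrable (k + 1) s).const_mul _).1
    (ae_of_all _ fun z x _ => by
      rw [norm_mul, norm_mul, norm_mul, ← Complex.ofReal_mul, Complex.norm_exp_ofReal_mul_I]
      simp) (hm.2 (k + 1))
    (ae_of_all _ fun z x _ => by
      have h1 : HasDerivAt (fun x : ℝ => (x : ℂ) * z * Complex.I) ((1 : ℂ) * z * Complex.I) x :=
        ((Complex.ofRealCLM.hasDerivAt (x := x)).mul_const _).mul_const _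
      have h2 := ((h1.cexp).const_mul ((z : ℂ) ^ k)).mul_const (m z : ℂ)
      refine h2.congr_deriv ?_
      ring)
  have h2 := h.2
  rw [integral_const_mul] at h2
  exact h2

/-- Multiplication by sin(yz) becomes a difference of the two translates by ±y on the Fourier side;
the subtracted linear part becomes an untranslated derivative. -/
theorem gaussFourier_mul_sinKernel {m : ℝ → ℝ} (hm : HasAllMoments m) (l y : ℝ) (k : ℕ) (s : ℝ) :
    gaussFourier (fun z => sinKernel l (y * z) * m z) k s =
      (gaussFourier m k (s + y) - gaussFourier m k (s - y)) / (2 * Complex.I) -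
        if 1 < l then y * gaussFourier m (k + 1) s else 0 := by
  have h0 : (fun z : ℝ => (z : ℂ) ^ k * Complex.exp (s * z * Complex.I) *
      ((sinKernel l (y * z) * m z : ℝ) : ℂ)) = fun z : ℝ =>
      (((z : ℂ) ^ k * Complex.exp ((s + y : ℝ) * z * Complex.I) * m z) -
        ((z : ℂ) ^ k * Complex.exp ((s - y : ℝ) * z * Complex.I) * m z)) / (2 * Complex.I) -
      if 1 < l then (y : ℂ) * ((z : ℂ) ^ (k + 1) * Complex.exp (s * z * Complex.I) * m z)
        else 0 := by
    ext z
    have hs : Complex.exp ((s + y : ℝ) * z * Complex.I) - Complex.exp ((s - y : ℝ) * z * Complex.I)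
        = Complex.exp (s * z * Complex.I) * (2 * Complex.I * Complex.sin (y * z)) := by
      have e1 : ((s + y : ℝ) : ℂ) * z * Complex.I = s * z * Complex.I + y * z * Complex.I := by
        push_cast; ring
      have e2 : ((s - y : ℝ) : ℂ) * z * Complex.I = s * z * Complex.I + -(y * z) * Complex.I := by
        push_cast; ring
      rw [e1, e2, Complex.exp_add, Complex.exp_add, Complex.sin]
      linear_combination (Complex.exp (s * z * Complex.I) * (Complex.exp (y * z * Complex.I)
        - Complex.exp (-(y * z) * Complex.I))) * Complex.I_sq
    have hs2 : ((z : ℂ) ^ k * Complex.exp ((s + y : ℝ) * z * Complex.I) * m z -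
        ((z : ℂ) ^ k * Complex.exp ((s - y : ℝ) * z * Complex.I) * m z)) / (2 * Complex.I) =
        (z : ℂ) ^ k * Complex.exp (s * z * Complex.I) * (Complex.sin (y * z) * m z) := by
      rw [div_eq_iff (by simp)]
      linear_combination ((z : ℂ) ^ k * m z) * hs
    rw [hs2]
    unfold sinKernel
    split_ifs <;> push_cast <;> ring
  unfold gaussFourier
  rw [h0, integral_sub, integral_div, integral_sub (hm.integrable k _) (hm.integrable k _)]
  · split_ifs
    · rw [integral_const_mul]
    · simp
  · exact ((hm.integrable k _).sub (hm.integrable k _)).div_const _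
  · split_ifs
    · exact (hm.integrable (k + 1) s).const_mul _
    · simp

/-- A nonnegative function that varies by a bounded factor over unit distances. -/
def SlowlyVarying (β : ℝ → ℝ) : Prop :=
  (∀ s, 0 ≤ β s) ∧ ∀ s t, |t| ≤ 1 → β (s + t) ≤ 3 * β s

theorem norm_gaussFourier_sub_le {m : ℝ → ℝ} (hm : HasAllMoments m) {β : ℝ → ℝ}
    (hβ : SlowlyVarying β) {C : ℕ → ℝ} (hC : ∀ k s, ‖gaussFourier m k s‖ ≤ C k * β s)
    (hC0 : ∀ k, 0 ≤ C k) (k : ℕ) (s t : ℝ) (ht : |t| ≤ 1) :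
    ‖gaussFourier m k (s + t) - gaussFourier m k s‖ ≤ 3 * C (k + 1) * β s * |t| := by
  have h := (convex_uIcc s (s + t)).norm_image_sub_le_of_norm_hasDerivWithin_le
    (f := gaussFourier m k) (f' := fun s => Complex.I * gaussFourier m (k + 1) s)
    (C := 3 * C (k + 1) * β s) (x := s) (y := s + t)
    (fun x _ => (hasDerivAt_gaussFourier hm k x).hasDerivWithinAt)
    (fun x hx => by
      rw [norm_mul, Complex.norm_I, one_mul]
      have hx' : |x - s| ≤ 1 := by
        have := Set.abs_sub_left_of_mem_uIcc hx
        simp only [add_sub_cancel_left] at this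
        linarith
      have := hβ.2 s (x - s) hx'
      rw [add_sub_cancel] at this
      calc _ ≤ C (k + 1) * β x := hC _ _
        _ ≤ C (k + 1) * (3 * β s) := by gcongr; exact hC0 _
        _ = _ := by ring) Set.left_mem_uIcc Set.right_mem_uIcc
  simpa [Real.norm_eq_abs] using h

/-- The induction step for products. For large y the translates are estimated separately; for small
y their difference gains a factor |y|, or y² once the linear part is removed, at the cost of one or
two orders in k. The untranslated β s occurs only for l > 1, and its absence otherwise is what later
yields decay in the direction of y. -/
theorem norm_gaussFourier_mul_sinKernel_le {m : ℝ → ℝ} (hm : HasAllMoments m) {β : ℝ → ℝ}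
    (hβ : SlowlyVarying β) {C : ℕ → ℝ} (hC : ∀ k s, ‖gaussFourier m k s‖ ≤ C k * β s)
    (hC0 : ∀ k, 0 ≤ C k) (l y : ℝ) (k : ℕ) (s : ℝ) :
    ‖gaussFourier (fun z => sinKernel l (y * z) * m z) k s‖ ≤
      9 * (C k + C (k + 1) + C (k + 2)) * (sinWeight l y *
        (β (s + y) + β (s - y) + if 1 < l then β s else 0)) := by
  have b1 := hβ.1 (s + y)
  have b2 := hβ.1 (s - y)
  have b3 := hβ.1 s
  have c0 := hC0 k
  have c1 := hC0 (k + 1)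
  have c2 := hC0 (k + 2)
  have y0 := abs_nonneg y
  rw [gaussFourier_mul_sinKernel hm]
  rcases le_or_gt |y| 1 with hy | hy
  · have hy' : |-y| ≤ 1 := by rwa [abs_neg]
    by_cases hl : 1 < l
    · simp only [sinWeight, hl, if_true]
      have hmin : min (y ^ 2) |y| = y ^ 2 := by
        apply min_eq_left; rw [← sq_abs]; nlinarith
      rw [hmin]
      -- As a function of the shift t, `D` vanishes at 0 and its derivative is half a symmetric
      -- second difference at order k + 1, hence of size |t|. The mean value inequality then gives
      -- y².
      set D : ℝ → ℂ := fun t => (gaussFourier m k (s + t) - gaussFourier m k (s - t)) /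
        (2 * Complex.I) - t * gaussFourier m (k + 1) s with hD
      have hD0 : D 0 = 0 := by simp [hD]
      have hder : ∀ t, HasDerivAt D ((gaussFourier m (k + 1) (s + t) +
          gaussFourier m (k + 1) (s - t)) / 2 - gaussFourier m (k + 1) s) t := fun t => by
        have h1 := (hasDerivAt_gaussFourier hm k (s + t)).scomp t ((hasDerivAt_id t).const_add s)
        have h2 := (hasDerivAt_gaussFourier hm k (s - t)).scomp t ((hasDerivAt_id t).const_sub s)
        have h3 := ((h1.sub h2).div_const (2 * Complex.I)).sub
          ((Complex.ofRealCLM.hasDerivAt (x := t)).mul_const (gaussFourier m (k + 1) s))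
        refine h3.congr_deriv ?_
        simp only [Complex.ofRealCLM_apply, Complex.ofReal_one, one_smul, neg_smul, one_mul]
        field_simp
        ring
      have h := (convex_uIcc 0 y).norm_image_sub_le_of_norm_hasDerivWithin_le
        (f := D) (C := 3 * C (k + 2) * β s * |y|) (x := 0) (y := y)
        (fun x _ => (hder x).hasDerivWithinAt)
        (fun t htm => by
          have ht : |t| ≤ |y| := by
            have := Set.abs_sub_left_of_mem_uIcc htm
            simpa using this
          have e : (gaussFourier m (k + 1) (s + t) + gaussFourier m (k + 1) (s - t)) / 2 -
              gaussFourier m (k + 1) s =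
              ((gaussFourier m (k + 1) (s + t) - gaussFourier m (k + 1) s) +
              (gaussFourier m (k + 1) (s + -t) - gaussFourier m (k + 1) s)) / 2 := by
            rw [← sub_eq_add_neg s t]; ring
          have h1 := norm_gaussFourier_sub_le hm hβ hC hC0 (k + 1) s t (ht.trans hy)
          have h2 := norm_gaussFourier_sub_le hm hβ hC hC0 (k + 1) s (-t)
            (by rw [abs_neg]; exact ht.trans hy)
          rw [abs_neg] at h2
          rw [e, norm_div, Complex.norm_ofNat]
          have h3 : 3 * C (k + 2) * β s * |t| ≤ 3 * C (k + 2) * β s * |y| := by gcongr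
          have h4 := norm_add_le (gaussFourier m (k + 1) (s + t) - gaussFourier m (k + 1) s)
            (gaussFourier m (k + 1) (s + -t) - gaussFourier m (k + 1) s)
          have e2 : k + 1 + 1 = k + 2 := rfl
          rw [e2] at h1 h2
          linarith) Set.left_mem_uIcc Set.right_mem_uIcc
      rw [hD0, sub_zero, sub_zero, Real.norm_eq_abs, mul_assoc, ← sq, sq_abs] at h
      calc _ ≤ 3 * C (k + 2) * β s * y ^ 2 := h
        _ ≤ 9 * (C k + C (k + 1) + C (k + 2)) * (y ^ 2 * (0 + 0 + β s)) := by
            have : 0 ≤ C (k + 2) * β s * y ^ 2 := by positivity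
            have : 0 ≤ (C k + C (k + 1)) * β s * y ^ 2 := by positivity
            linarith
        _ ≤ _ := by gcongr
    · simp only [sinWeight, hl, if_false, sub_zero, add_zero]
      rw [min_eq_right hy, norm_div, norm_mul, Complex.norm_I, Complex.norm_ofNat]
      have h1 := norm_gaussFourier_sub_le hm hβ hC hC0 k s y hy
      have h2 := norm_gaussFourier_sub_le hm hβ hC hC0 k s (-y) hy'
      rw [abs_neg, ← sub_eq_add_neg] at h2
      have h3 := norm_sub_le (gaussFourier m k (s + y) - gaussFourier m k s)
        (gaussFourier m k (s - y) - gaussFourier m k s)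
      rw [sub_sub_sub_cancel_right] at h3
      have h4 := hβ.2 (s + y) (-y) hy'
      rw [add_neg_cancel_right] at h4
      have h5 : C (k + 1) * |y| * β s ≤ C (k + 1) * |y| * (3 * β (s + y)) := by gcongr
      have p1 : 0 ≤ C (k + 1) * |y| * β (s - y) := by positivity
      have p2 : 0 ≤ (C k + C (k + 2)) * |y| * (β (s + y) + β (s - y)) := by positivity
      linarith
  -- For |y| > 1 no cancellation is needed and the triangle inequality suffices.
  · have hmul : C k * (β (s + y) + β (s - y)) ≤ 2 * (C k * (β (s + y) + β (s - y))) := by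
      have : 0 ≤ C k * (β (s + y) + β (s - y)) := by positivity
      linarith
    have h1 : ‖(gaussFourier m k (s + y) - gaussFourier m k (s - y)) / (2 * Complex.I)‖ ≤
        C k * (β (s + y) + β (s - y)) := by
      rw [norm_div, norm_mul, Complex.norm_I, Complex.norm_ofNat]
      have := norm_sub_le (gaussFourier m k (s + y)) (gaussFourier m k (s - y))
      have := hC k (s + y)
      have := hC k (s - y)
      linarith
    by_cases hl : 1 < l
    · simp only [sinWeight, hl, if_true]
      have hmin : min (y ^ 2) |y| = |y| := by
        apply min_eq_right; rw [← sq_abs]; nlinarith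
      rw [hmin]
      have h2 : ‖(y : ℂ) * gaussFourier m (k + 1) s‖ ≤ |y| * (C (k + 1) * β s) := by
        rw [norm_mul, Complex.norm_real, Real.norm_eq_abs]
        gcongr
        exact hC _ _
      have h3 : C k * (β (s + y) + β (s - y)) ≤ |y| * (C k * (β (s + y) + β (s - y))) :=
        le_mul_of_one_le_left (by positivity) hy.le
      have h4 := norm_sub_le ((gaussFourier m k (s + y) - gaussFourier m k (s - y)) /
        (2 * Complex.I)) (y * gaussFourier m (k + 1) s)
      have p1 : 0 ≤ |y| * (C k * (β (s + y) + β (s - y))) := by positivity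
      have p2 : 0 ≤ |y| * (C (k + 1) * (β (s + y) + β (s - y))) := by positivity
      have p3 : 0 ≤ |y| * (C (k + 2) * (β (s + y) + β (s - y))) := by positivity
      have p4 : 0 ≤ |y| * (C (k + 1) * β s) := by positivity
      have p5 : 0 ≤ |y| * (C k * β s) := by positivity
      have p6 : 0 ≤ |y| * (C (k + 2) * β s) := by positivity
      linarith
    · simp only [sinWeight, hl, if_false, sub_zero, add_zero]
      rw [min_eq_left hy.le]
      have p1 : 0 ≤ C k * (β (s + y) + β (s - y)) := by positivity
      have p2 : 0 ≤ C (k + 1) * (β (s + y) + β (s - y)) := by positivity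
      have p3 : 0 ≤ C (k + 2) * (β (s + y) + β (s - y)) := by positivity
      linarith

/-! ### The Gaussian itself -/

theorem gaussFourier_one_zero (s : ℝ) :
    gaussFourier (fun _ => 1) 0 s = Complex.exp (-(s : ℂ) ^ 2 / 2) := by
  have h := ProbabilityTheory.charFun_gaussianReal (μ := 0) (v := 1) s
  rw [charFun_apply_real] at h
  unfold gaussFourier
  simp only [pow_zero, one_mul, Complex.ofReal_one, mul_one]
  rw [h]
  congr 1
  simp
  ring

theorem exists_polynomial_gaussFourier_one (k : ℕ) :
    ∃ p : Polynomial ℂ, ∀ s : ℝ,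
      gaussFourier (fun _ => 1) k s = p.eval (s : ℂ) * Complex.exp (-(s : ℂ) ^ 2 / 2) := by
  induction k with
  | zero => exact ⟨1, fun s => by simp [gaussFourier_one_zero]⟩
  | succ k ih =>
    obtain ⟨p, hp⟩ := ih
    -- The derivative of p(s) exp(-s²/2) is (p' - s p) exp(-s²/2), and it equals I times the next
    -- transform.
    refine ⟨Polynomial.C (-Complex.I) * (p.derivative - Polynomial.X * p), fun s => ?_⟩
    have h1 := hasDerivAt_gaussFourier hasAllMoments_one k s
    have h2 : HasDerivAt (fun z : ℂ => p.eval z * Complex.exp (-z ^ 2 / 2))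
        (p.derivative.eval (s : ℂ) * Complex.exp (-(s : ℂ) ^ 2 / 2) +
          p.eval (s : ℂ) * (Complex.exp (-(s : ℂ) ^ 2 / 2) * (-(s : ℂ)))) (s : ℂ) := by
      refine (p.hasDerivAt _).mul (HasDerivAt.cexp ?_)
      have := (((hasDerivAt_id (s : ℂ)).pow 2).neg).div_const 2
      refine this.congr_deriv ?_
      simp
      ring
    have h3 := h2.comp_ofReal
    rw [show gaussFourier (fun _ => 1) k = fun s : ℝ =>
      p.eval (s : ℂ) * Complex.exp (-(s : ℂ) ^ 2 / 2) from funext hp] at h1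
    have h4 := h1.unique h3
    have h5 : gaussFourier (fun _ => 1) (k + 1) s =
        -Complex.I * (Complex.I * gaussFourier (fun _ => 1) (k + 1) s) := by
      rw [← mul_assoc, neg_mul, Complex.I_mul_I, neg_neg, one_mul]
    rw [h5, h4]
    simp
    ring

theorem exists_norm_polynomial_mul_exp_le (p : Polynomial ℂ) :
    ∃ C : ℝ, ∀ s : ℝ, ‖p.eval (s : ℂ) * Complex.exp (-(s : ℂ) ^ 2 / 2)‖ ≤ C := by
  induction p using Polynomial.induction_on' with
  | add p q hp hq =>
    obtain ⟨C, hC⟩ := hp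
    obtain ⟨D, hD⟩ := hq
    refine ⟨C + D, fun s => ?_⟩
    rw [Polynomial.eval_add, add_mul]
    exact (norm_add_le _ _).trans (add_le_add (hC s) (hD s))
  | monomial n a =>
    -- From |s|^n ≤ n! exp |s| and |s| - s²/2 ≤ 1.
    refine ⟨‖a‖ * (n.factorial * Real.exp 1), fun s => ?_⟩
    have e : Complex.exp (-(s : ℂ) ^ 2 / 2) = ((Real.exp (-s ^ 2 / 2) : ℝ) : ℂ) := by push_cast; rfl
    rw [Polynomial.eval_monomial, e, norm_mul, norm_mul, norm_pow, Complex.norm_real,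
      Complex.norm_real, Real.norm_eq_abs, Real.norm_eq_abs, Real.abs_exp, mul_assoc]
    refine mul_le_mul_of_nonneg_left ?_ (norm_nonneg a)
    have h1 := Real.pow_div_factorial_le_exp |s| (abs_nonneg s) n
    have h2 : |s| ^ n ≤ n.factorial * Real.exp |s| := by
      rw [div_le_iff₀ (by positivity)] at h1
      linarith
    calc |s| ^ n * Real.exp (-s ^ 2 / 2) ≤ n.factorial * Real.exp |s| * Real.exp (-s ^ 2 / 2) := by
          gcongr
      _ = n.factorial * Real.exp (|s| + -s ^ 2 / 2) := by rw [mul_assoc, Real.exp_add]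
      _ ≤ n.factorial * Real.exp 1 := by
          refine mul_le_mul_of_nonneg_left (Real.exp_le_exp.2 ?_) (by positivity)
          rw [← sq_abs]
          nlinarith [sq_nonneg (|s| - 1)]

theorem exists_norm_gaussFourier_one_le (k : ℕ) :
    ∃ C : ℝ, 0 ≤ C ∧ ∀ s : ℝ, ‖gaussFourier (fun _ => 1) k s‖ ≤ C * (1 / (1 + s ^ 2)) := by
  obtain ⟨p, hp⟩ := exists_polynomial_gaussFourier_one k
  -- The extra factor 1 + X² converts boundedness into the decay 1 / (1 + s²).
  obtain ⟨C, hC⟩ := exists_norm_polynomial_mul_exp_le ((1 + Polynomial.X ^ 2) * p)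
  refine ⟨C, (norm_nonneg _).trans (hC 0), fun s => ?_⟩
  rw [mul_one_div, le_div_iff₀ (by positivity), hp]
  have h := hC s
  have e : ‖(1 : ℂ) + (s : ℂ) ^ 2‖ = 1 + s ^ 2 := by
    have : (1 : ℂ) + (s : ℂ) ^ 2 = ((1 + s ^ 2 : ℝ) : ℂ) := by push_cast; rfl
    rw [this, Complex.norm_real, Real.norm_eq_abs, abs_of_pos (by positivity)]
  rw [Polynomial.eval_mul, mul_assoc, norm_mul] at h
  simp only [Polynomial.eval_add, Polynomial.eval_one, Polynomial.eval_pow,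
    Polynomial.eval_X] at h
  rw [e] at h
  linarith

end

section

/-! ### Integrability of powers on the line -/

theorem integrable_comp_abs {f : ℝ → ℝ} (hf : IntegrableOn f (Set.Ioi 0)) :
    Integrable (fun t => f |t|) := by
  have h1 : IntegrableOn (fun t => f |t|) (Set.Ioi 0) :=
    hf.congr_fun (fun t ht => by rw [abs_of_pos ht]) measurableSet_Ioi
  have h2 : IntegrableOn (fun t => f |t|) (Set.Iio 0) := by
    have := h1
    rw [← neg_zero] at this
    simpa using this.comp_neg_Iio
  rw [← integrableOn_univ, ← Set.Iic_union_Ioi (a := (0 : ℝ))]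
  exact ((integrableOn_Iic_iff_integrableOn_Iio (by simp)).2 h2).union h1

theorem integrableOn_Ioc_rpow {a : ℝ} (ha : -1 < a) (R : ℝ) :
    IntegrableOn (fun t : ℝ => t ^ a) (Set.Ioc 0 R) := by
  rcases le_or_gt 0 R with h | h
  · exact (intervalIntegrable_iff_integrableOn_Ioc_of_le h).1
      (intervalIntegral.intervalIntegrable_rpow' ha)
  · simp [Set.Ioc_eq_empty (not_lt.2 h.le)]

theorem integrableOn_Ioi_of_abs_le_rpow {f : ℝ → ℝ}
    (hm : AEStronglyMeasurable f (volume.restrict (Set.Ioi 0))) {a b C : ℝ} (ha : -1 < a)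
    (hb : b < -1) (h1 : ∀ t, 0 < t → t ≤ 1 → |f t| ≤ C * t ^ a)
    (h2 : ∀ t, 1 < t → |f t| ≤ C * t ^ b) : IntegrableOn f (Set.Ioi 0) := by
  rw [← Set.Ioc_union_Ioi_eq_Ioi zero_le_one] at hm ⊢
  refine IntegrableOn.union ?_ ?_
  · exact ((integrableOn_Ioc_rpow ha 1).const_mul C).mono'
      (hm.mono_measure (Measure.restrict_mono Set.subset_union_left le_rfl))
      ((ae_restrict_iff' measurableSet_Ioc).2 (ae_of_all _ fun t ht => h1 t ht.1 ht.2))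
  · exact ((integrableOn_Ioi_rpow_of_lt hb one_pos).const_mul C).mono'
      (hm.mono_measure (Measure.restrict_mono Set.subset_union_right le_rfl))
      ((ae_restrict_iff' measurableSet_Ioi).2 (ae_of_all _ fun t ht => h2 t ht))

/-! ### Decay of the Gaussian average of a product of sine kernels -/

/-- The product of the sine kernels at the scales `y i`. -/
def prodSin {n : ℕ} (lam y : Fin n → ℝ) (z : ℝ) : ℝ := ∏ i, sinKernel (lam i) (y i * z)

/-- The sum of the translates of `1 / (1 + s ^ 2)` by all signed sums of the `y i`. -/
def signedDecay {n : ℕ} (y : Fin n → ℝ) (s : ℝ) : ℝ :=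
  ∑ ε : Fin n → SignType, 1 / (1 + (s + ∑ i, (ε i : ℝ) * y i) ^ 2)

/-- The signs 1, -1 and 0 of the first coordinate give exactly the three terms produced by
multiplication with one more sine kernel. -/
theorem signedDecay_succ {n : ℕ} (y : Fin (n + 1) → ℝ) (s : ℝ) :
    signedDecay y s = signedDecay (Fin.tail y) (s + y 0) + signedDecay (Fin.tail y) (s - y 0) +
      signedDecay (Fin.tail y) s := by
  unfold signedDecay
  rw [← (Fin.consEquiv (fun _ => SignType)).sum_comp, Fintype.sum_prod_type, SignType.univ_eq]
  simp only [Fin.consEquiv_apply, Fin.sum_univ_succ, Fin.cons_zero, Fin.cons_succ, Fin.tail]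
  rw [Finset.sum_insert (by decide), Finset.sum_insert (by decide), Finset.sum_singleton]
  simp only [SignType.coe_zero, SignType.coe_neg_one, SignType.coe_one, zero_mul, one_mul,
    zero_add, neg_mul, ← add_assoc, ← sub_eq_add_neg]
  ring

theorem slowlyVarying_one_div : SlowlyVarying fun s => 1 / (1 + s ^ 2) := by
  refine ⟨fun s => by positivity, fun s t ht => ?_⟩
  rw [mul_one_div, div_le_div_iff₀ (by positivity) (by positivity)]
  have : t ^ 2 ≤ 1 := by rw [← sq_abs]; nlinarith [abs_nonneg t]
  nlinarith [sq_nonneg (s + 2 * t), sq_nonneg s]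

theorem slowlyVarying_signedDecay {n : ℕ} (y : Fin n → ℝ) : SlowlyVarying (signedDecay y) := by
  refine ⟨fun s => Finset.sum_nonneg fun ε _ => slowlyVarying_one_div.1 _, fun s t ht => ?_⟩
  unfold signedDecay
  rw [Finset.mul_sum]
  refine Finset.sum_le_sum fun ε _ => ?_
  have := slowlyVarying_one_div.2 (s + ∑ i, (ε i : ℝ) * y i) t ht
  rwa [add_right_comm] at this

theorem SlowlyVarying.const_mul {β : ℝ → ℝ} (hβ : SlowlyVarying β) {c : ℝ} (hc : 0 ≤ c) :
    SlowlyVarying fun s => c * β s :=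
  ⟨fun s => mul_nonneg hc (hβ.1 s), fun s t ht => by
    have := mul_le_mul_of_nonneg_left (hβ.2 s t ht) hc
    linarith⟩

theorem sinWeight_nonneg (l t : ℝ) : 0 ≤ sinWeight l t := by
  unfold sinWeight; split_ifs <;> positivity

theorem hasAllMoments_prodSin {n : ℕ} (lam y : Fin n → ℝ) : HasAllMoments (prodSin lam y) := by
  induction n with
  | zero =>
    have e : prodSin lam y = fun _ => 1 := by ext; simp [prodSin]
    rw [e]
    exact hasAllMoments_one
  | succ n ih =>
    have := (ih (Fin.tail lam) (Fin.tail y)).mul_sinKernel (lam 0) (y 0)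
    convert this using 2 with z
    simp [prodSin, Fin.prod_univ_succ, Fin.tail]

theorem exists_norm_gaussFourier_prodSin_le {n : ℕ} (lam : Fin n → ℝ) :
    ∃ C : ℕ → ℝ, (∀ k, 0 ≤ C k) ∧ ∀ (y : Fin n → ℝ) k s,
      ‖gaussFourier (prodSin lam y) k s‖ ≤
        C k * ((∏ i, sinWeight (lam i) (y i)) * signedDecay y s) := by
  induction n with
  | zero =>
    choose C hC0 hC using exists_norm_gaussFourier_one_le
    refine ⟨C, hC0, fun y k s => ?_⟩
    have e : prodSin lam y = fun _ => 1 := by ext; simp [prodSin]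
    rw [e]
    simpa [signedDecay] using hC k s
  | succ n ih =>
    obtain ⟨C, hC0, hC⟩ := ih (Fin.tail lam)
    refine ⟨fun k => 9 * (C k + C (k + 1) + C (k + 2)), fun k => ?_, fun y k s => ?_⟩
    · have := hC0 k; have := hC0 (k + 1); have := hC0 (k + 2); positivity
    · have hP : 0 ≤ ∏ i, sinWeight (Fin.tail lam i) (Fin.tail y i) :=
        Finset.prod_nonneg fun i _ => sinWeight_nonneg _ _
      have h := norm_gaussFourier_mul_sinKernel_le
        (hasAllMoments_prodSin (Fin.tail lam) (Fin.tail y))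
        ((slowlyVarying_signedDecay (Fin.tail y)).const_mul hP) (hC (Fin.tail y)) hC0
        (lam 0) (y 0) k s
      have e : prodSin lam y = fun z => sinKernel (lam 0) (y 0 * z) *
          prodSin (Fin.tail lam) (Fin.tail y) z := by
        ext z; simp [prodSin, Fin.prod_univ_succ, Fin.tail]
      rw [e, signedDecay_succ, Fin.prod_univ_succ]
      refine h.trans (mul_le_mul_of_nonneg_left ?_ ?_)
      · have hd := (slowlyVarying_signedDecay (Fin.tail y)).1 s
        have hw := sinWeight_nonneg (lam 0) (y 0)
        change _ ≤ sinWeight (lam 0) (y 0) *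
          (∏ i, sinWeight (Fin.tail lam i) (Fin.tail y i)) * _
        rw [mul_assoc]
        refine mul_le_mul_of_nonneg_left ?_ hw
        split_ifs
        · exact le_of_eq (by ring)
        · have := mul_nonneg hP hd
          linarith
      · have := hC0 k; have := hC0 (k + 1); have := hC0 (k + 2); positivity

/-- Treating coordinate i last, without a linear part, leaves only the translates by ±y_i. The bound
therefore decays in y_i for fixed remaining coordinates, which replaces the missing integrability of
the weight when the exponent is 0. -/
theorem exists_norm_gaussFourier_prodSin_zero_le {n : ℕ} (lam : Fin (n + 1) → ℝ)
    (i : Fin (n + 1)) (hi : ¬ 1 < lam i) (k : ℕ) :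
    ∃ C : ℝ, 0 ≤ C ∧ ∀ y : Fin (n + 1) → ℝ,
      ‖gaussFourier (prodSin lam y) k 0‖ ≤ C * ((∏ i, sinWeight (lam i) (y i)) *
        (signedDecay (i.removeNth y) (y i) + signedDecay (i.removeNth y) (-(y i)))) := by
  obtain ⟨C, hC0, hC⟩ := exists_norm_gaussFourier_prodSin_le (i.removeNth lam)
  refine ⟨9 * (C k + C (k + 1) + C (k + 2)), ?_, fun y => ?_⟩
  · have := hC0 k; have := hC0 (k + 1); have := hC0 (k + 2); positivity
  · have hP : 0 ≤ ∏ j, sinWeight (i.removeNth lam j) (i.removeNth y j) :=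
      Finset.prod_nonneg fun i _ => sinWeight_nonneg _ _
    have h := norm_gaussFourier_mul_sinKernel_le
      (hasAllMoments_prodSin (i.removeNth lam) (i.removeNth y))
      ((slowlyVarying_signedDecay (i.removeNth y)).const_mul hP) (hC (i.removeNth y)) hC0
      (lam i) (y i) k 0
    have e : prodSin lam y = fun z => sinKernel (lam i) (y i * z) *
        prodSin (i.removeNth lam) (i.removeNth y) z := by
      ext z; simp [prodSin, Fin.prod_univ_succAbove _ i, Fin.removeNth]
    rw [e, Fin.prod_univ_succAbove _ i]
    refine h.trans (le_of_eq ?_)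
    simp only [hi, if_false, zero_add, zero_sub, add_zero, Fin.removeNth]
    ring

theorem signedDecay_le {n : ℕ} (y : Fin n → ℝ) (s : ℝ) : signedDecay y s ≤ 3 ^ n := by
  calc signedDecay y s ≤ ∑ ε : Fin n → SignType, (1 : ℝ) := by
        refine Finset.sum_le_sum fun ε _ => ?_
        rw [div_le_one (by positivity)]
        nlinarith [sq_nonneg (s + ∑ i, (ε i : ℝ) * y i)]
    _ = 3 ^ n := by
        have : Fintype.card SignType = 3 := rfl
        simp [this]

/-! ### Absolute integrability -/

/-- An admissible exponent: in `[0, 2)` and different from `1`. -/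
def ValidExp (l : ℝ) : Prop := (0 ≤ l ∧ l < 1) ∨ (1 < l ∧ l < 2)

/-- The weight `|t| ^ (-l - 1) * sinWeight l t`. -/
def singularWeight (l t : ℝ) : ℝ := |t| ^ (-l - 1) * sinWeight l t

theorem singularWeight_nonneg (l t : ℝ) : 0 ≤ singularWeight l t :=
  mul_nonneg (by positivity) (sinWeight_nonneg l t)

theorem measurable_sinWeight (l : ℝ) : Measurable (sinWeight l) := by
  unfold sinWeight
  split_ifs
  · exact (by fun_prop : Continuous fun t : ℝ => min (t ^ 2) |t|).measurable
  · exact (by fun_prop : Continuous fun t : ℝ => min 1 |t|).measurable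

theorem measurable_singularWeight (l : ℝ) : Measurable (singularWeight l) :=
  (measurable_norm.pow_const _).mul (measurable_sinWeight l)

theorem sinWeight_abs (l t : ℝ) : sinWeight l |t| = sinWeight l t := by
  simp [sinWeight]

theorem singularWeight_abs (l t : ℝ) : singularWeight l |t| = singularWeight l t := by
  simp [singularWeight, sinWeight_abs]

theorem singularWeight_of_one_le {l t : ℝ} (hl : ¬ 1 < l) (ht : 1 ≤ t) :
    singularWeight l t = t ^ (-l - 1) := by
  simp [singularWeight, sinWeight, hl, abs_of_pos (one_pos.trans_le ht), min_eq_left ht]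

theorem singularWeight_of_le_one {l t : ℝ} (hl : ¬ 1 < l) (h0 : 0 < t) (ht : t ≤ 1) :
    singularWeight l t = t ^ (-l) := by
  simp only [singularWeight, sinWeight, hl, if_false, abs_of_pos h0, min_eq_right ht]
  conv_lhs => rw [← Real.rpow_one t, ← Real.rpow_mul h0.le, ← Real.rpow_add h0]
  congr 1; ring

theorem integrable_singularWeight {l : ℝ} (hl : ValidExp l) (h0 : l ≠ 0) :
    Integrable (singularWeight l) := by
  have : Integrable (fun t => singularWeight l |t|) := by
    refine integrable_comp_abs ?_
    rcases hl with ⟨h1, h2⟩ | ⟨h1, h2⟩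
    · have hn : ¬ 1 < l := not_lt.2 h2.le
      refine integrableOn_Ioi_of_abs_le_rpow (measurable_singularWeight l).aestronglyMeasurable
        (a := -l) (b := -l - 1) (C := 1) (by linarith)
        (by have := lt_of_le_of_ne h1 (Ne.symm h0); linarith) (fun t ht ht1 => ?_) fun t ht => ?_
      · rw [singularWeight_of_le_one hn ht ht1, one_mul, abs_of_nonneg (by positivity)]
      · rw [singularWeight_of_one_le hn ht.le, one_mul, abs_of_nonneg (by positivity)]
    · refine integrableOn_Ioi_of_abs_le_rpow (measurable_singularWeight l).aestronglyMeasurable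
        (a := 1 - l) (b := -l) (C := 1) (by linarith) (by linarith) (fun t ht ht1 => ?_)
        fun t ht => ?_
      · rw [abs_of_nonneg (singularWeight_nonneg _ _), one_mul]
        simp only [singularWeight, sinWeight, h1, if_true, abs_of_pos ht]
        calc t ^ (-l - 1) * min (t ^ 2) t ≤ t ^ (-l - 1) * t ^ (2 : ℝ) := by
              gcongr
              rw [Real.rpow_two]
              exact min_le_left _ _
          _ = t ^ (1 - l) := by rw [← Real.rpow_add ht]; congr 1; ring
      · have ht0 : 0 < t := one_pos.trans ht
        rw [abs_of_nonneg (singularWeight_nonneg _ _), one_mul]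
        simp only [singularWeight, sinWeight, h1, if_true, abs_of_pos ht0]
        calc t ^ (-l - 1) * min (t ^ 2) t ≤ t ^ (-l - 1) * t ^ (1 : ℝ) := by
              gcongr
              rw [Real.rpow_one]
              exact min_le_right _ _
          _ = t ^ (-l) := by rw [← Real.rpow_add ht0]; congr 1; ring
  simpa only [singularWeight_abs] using this

theorem singularWeight_zero_le_one (t : ℝ) : singularWeight 0 t ≤ 1 := by
  rw [← singularWeight_abs]
  have h : ¬ (1 : ℝ) < 0 := by norm_num
  rcases le_or_gt |t| 1 with ht | ht
  · rcases (abs_nonneg t).eq_or_lt with h0 | h0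
    · rw [← h0]; simp [singularWeight, sinWeight, h]
    · rw [singularWeight_of_le_one h h0 ht]; simp
  · rw [singularWeight_of_one_le h ht.le]
    exact Real.rpow_le_one_of_one_le_of_nonpos ht.le (by norm_num)

/-- For l = 0 the weight decays only like 1/|t| and just fails to be integrable, so any exponent
above 1 repairs it. -/
theorem integrable_singularWeight_zero_rpow {p : ℝ} (hp : 1 < p) :
    Integrable fun t => singularWeight 0 t ^ p := by
  have h : ¬ (1 : ℝ) < 0 := by norm_num
  have : Integrable (fun t => singularWeight 0 |t| ^ p) := by
    refine integrable_comp_abs (f := fun t => singularWeight 0 t ^ p) ?_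
    refine integrableOn_Ioi_of_abs_le_rpow
      ((measurable_singularWeight 0).pow_const p).aestronglyMeasurable
      (a := 0) (b := -p) (C := 1) (by norm_num) (by linarith) (fun t ht ht1 => ?_) fun t ht => ?_
    · rw [singularWeight_of_le_one h ht ht1]; simp
    · rw [singularWeight_of_one_le h ht.le, abs_of_nonneg (by positivity), one_mul,
        ← Real.rpow_mul (by linarith)]
      apply le_of_eq; congr 1; ring
  simpa only [singularWeight_abs] using this

/-- The integrable replacement for `singularWeight`, a slightly higher power of it when `l = 0`. -/
def raisedWeight (n : ℕ) (l t : ℝ) : ℝ :=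
  if l = 0 then singularWeight l t ^ (1 + 1 / ((n : ℝ) + 1)) else singularWeight l t

theorem raisedWeight_nonneg (n : ℕ) (l t : ℝ) : 0 ≤ raisedWeight n l t := by
  have := singularWeight_nonneg l t
  unfold raisedWeight; split_ifs <;> positivity

theorem integrable_raisedWeight (n : ℕ) {l : ℝ} (hl : ValidExp l) :
    Integrable (raisedWeight n l) := by
  unfold raisedWeight
  split_ifs with h
  · rw [h]
    have : (0 : ℝ) < 1 / ((n : ℝ) + 1) := by positivity
    exact integrable_singularWeight_zero_rpow (by linarith)
  · exact integrable_singularWeight hl h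

/-- Take i with the smallest weight w among the coordinates of exponent 0. As w ≤ 1, it is at most a
product of n factors w^(1/(n+1)), one handed to each other coordinate. Where the exponent is 0 such
a factor is absorbed by minimality and raises the power of the weight above 1; elsewhere it is
bounded by 1. -/
theorem prod_singularWeight_le_sum {n : ℕ} (lam : Fin (n + 1) → ℝ) (h0 : ∃ i, lam i = 0)
    (y : Fin (n + 1) → ℝ) :
    ∃ i, lam i = 0 ∧ ∏ k, singularWeight (lam k) (y k) ≤
      ∏ k, raisedWeight n (i.removeNth lam k) (i.removeNth y k) := by
  classical
  obtain ⟨i, hi, hmin⟩ := (Finset.univ.filter fun i => lam i = 0).exists_min_image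
    (fun k => singularWeight (lam k) (y k)) (by
      obtain ⟨i, hi⟩ := h0
      exact ⟨i, by simp [hi]⟩)
  simp only [Finset.mem_filter, Finset.mem_univ, true_and] at hi hmin
  refine ⟨i, hi, ?_⟩
  set a : ℝ := 1 / ((n : ℝ) + 1) with ha
  have ha0 : 0 < a := by positivity
  set w := singularWeight (lam i) (y i) with hw
  have hw0 : 0 ≤ w := singularWeight_nonneg _ _
  have hw1 : w ≤ 1 := by rw [hw, hi]; exact singularWeight_zero_le_one _
  have h1 : w ≤ ∏ _k : Fin n, w ^ a := by
    rw [Finset.prod_const, Finset.card_univ, Fintype.card_fin, ← Real.rpow_natCast,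
      ← Real.rpow_mul hw0]
    conv_lhs => rw [← Real.rpow_one w]
    rcases hw0.eq_or_lt with h | h
    · rw [← h, Real.zero_rpow one_ne_zero]; positivity
    · refine Real.rpow_le_rpow_of_exponent_ge h hw1 ?_
      rw [ha, one_div_mul_eq_div, div_le_one (by positivity)]
      linarith
  rw [Fin.prod_univ_succAbove _ i]
  calc _ ≤ (∏ _k : Fin n, w ^ a) * ∏ k, singularWeight (lam (i.succAbove k))
        (y (i.succAbove k)) :=
        mul_le_mul_of_nonneg_right h1 (Finset.prod_nonneg fun k _ => singularWeight_nonneg _ _)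
    _ = ∏ k, (w ^ a * singularWeight (lam (i.succAbove k)) (y (i.succAbove k))) :=
        Finset.prod_mul_distrib.symm
    _ ≤ _ := by
        refine Finset.prod_le_prod (fun k _ => ?_) fun k _ => ?_
        · have := singularWeight_nonneg (lam (i.succAbove k)) (y (i.succAbove k))
          positivity
        · have hs := singularWeight_nonneg (lam (i.succAbove k)) (y (i.succAbove k))
          unfold raisedWeight Fin.removeNth
          split_ifs with hk
          · have hle := hmin _ hk
            rcases hs.eq_or_lt with h | h
            · rw [← h]; simp; positivity
            · rw [← ha, Real.rpow_add h, Real.rpow_one, mul_comm]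
              gcongr
          · exact mul_le_of_le_one_left hs (Real.rpow_le_one hw0 hw1 ha0.le)

/-- Tonelli with the line variable first: the integral of |h| after an affine change of variable
does not depend on the shift, however wild ℓ may be. -/
theorem integrable_mul_comp_affine {n : ℕ} {W : (Fin n → ℝ) → ℝ} (hW : Integrable W)
    {h : ℝ → ℝ} (hm : Measurable h) (hh : Integrable h) {ℓ : (Fin n → ℝ) → ℝ} (hℓ : Measurable ℓ)
    {c : ℝ} (hc : c ≠ 0) :
    Integrable fun p : ℝ × (Fin n → ℝ) => W p.2 * h (c * p.1 + ℓ p.2) := by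
  have hmeas : AEStronglyMeasurable (fun p : ℝ × (Fin n → ℝ) => W p.2 * h (c * p.1 + ℓ p.2))
      ((volume : Measure ℝ).prod (volume : Measure (Fin n → ℝ))) := by
    refine hW.1.comp_snd.mul (Measurable.aestronglyMeasurable (hm.comp ?_))
    fun_prop
  rw [Measure.volume_eq_prod, integrable_prod_iff' hmeas]
  refine ⟨ae_of_all _ fun y =>
    ((hh.comp_add_right (ℓ y)).comp_mul_left' hc).const_mul (W y), ?_⟩
  have e : ∀ y : Fin n → ℝ, ∫ t : ℝ, ‖W y * h (c * t + ℓ y)‖ =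
      ‖W y‖ * (|c⁻¹| * ∫ t, ‖h t‖) := by
    intro y
    simp_rw [norm_mul]
    rw [integral_const_mul, Measure.integral_comp_mul_left (fun t => ‖h (t + ℓ y)‖) c,
      integral_add_right_eq_self (fun t => ‖h t‖), smul_eq_mul]
  simp_rw [e]
  exact hW.norm.mul_const _

theorem integrable_prod_mul_decay {n : ℕ} {W : (Fin n → ℝ) → ℝ} (hW : Integrable W)
    {ℓ : (Fin n → ℝ) → ℝ} (hℓ : Measurable ℓ) :
    Integrable fun p : ℝ × (Fin n → ℝ) => W p.2 * (1 / (1 + (p.1 + ℓ p.2) ^ 2)) := by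
  have h := integrable_mul_comp_affine hW (h := fun s => (1 + s ^ 2)⁻¹) (by fun_prop)
    integrable_inv_one_add_sq hℓ one_ne_zero
  simpa only [one_mul, one_div] using h

theorem integrable_removeNth_mul_signedDecay {n : ℕ} (i : Fin (n + 1)) {W : (Fin n → ℝ) → ℝ}
    (hW : Integrable W) : Integrable fun y : Fin (n + 1) → ℝ => W (i.removeNth y) *
      (signedDecay (i.removeNth y) (y i) + signedDecay (i.removeNth y) (-(y i))) := by
  have hmp := volume_preserving_piFinSuccAbove (fun _ : Fin (n + 1) => ℝ) i
  have key : Integrable fun p : ℝ × (Fin n → ℝ) =>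
      W p.2 * (signedDecay p.2 p.1 + signedDecay p.2 (-p.1)) := by
    have hterm : ∀ ε : Fin n → SignType, Integrable fun p : ℝ × (Fin n → ℝ) =>
        W p.2 * (1 / (1 + (p.1 + ∑ i, (ε i : ℝ) * p.2 i) ^ 2)) +
        W p.2 * (1 / (1 + (-p.1 + ∑ i, (ε i : ℝ) * p.2 i) ^ 2)) := fun ε => by
      have hm : Measurable fun y : Fin n → ℝ => ∑ i, (ε i : ℝ) * y i := by fun_prop
      have h1 := integrable_prod_mul_decay hW hm
      have h2 := integrable_prod_mul_decay hW hm.neg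
      have h3 : (fun p : ℝ × (Fin n → ℝ) =>
          W p.2 * (1 / (1 + (p.1 + (-fun y : Fin n → ℝ => ∑ i, (ε i : ℝ) * y i) p.2) ^ 2))) =
          fun p : ℝ × (Fin n → ℝ) =>
            W p.2 * (1 / (1 + (-p.1 + ∑ i, (ε i : ℝ) * p.2 i) ^ 2)) := by
        ext p
        rw [Pi.neg_apply, ← neg_sq (-p.1 + _)]
        congr 4
        ring
      rw [h3] at h2
      exact h1.add h2
    refine (integrable_finsetSum Finset.univ fun ε _ => hterm ε).congr (ae_of_all _ fun p => ?_)
    simp only [signedDecay, Finset.sum_add_distrib, Finset.mul_sum, mul_add]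
  exact hmp.integrable_comp_of_integrable key

theorem measurable_gaussFourier_prodSin {n : ℕ} (lam : Fin n → ℝ) (k : ℕ) (s : ℝ) :
    Measurable fun y : Fin n → ℝ => gaussFourier (prodSin lam y) k s := by
  have hc : Continuous fun p : (Fin n → ℝ) × ℝ =>
      (p.2 : ℂ) ^ k * Complex.exp (s * p.2 * Complex.I) * (prodSin lam p.1 p.2 : ℝ) := by
    have h1 : Continuous fun p : (Fin n → ℝ) × ℝ => prodSin lam p.1 p.2 :=
      continuous_finsetProd _ fun i _ => (continuous_sinKernel _).comp (by fun_prop)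
    fun_prop
  exact (hc.stronglyMeasurable.integral_prod_right').measurable

/-- If no exponent is 0 the product of weights is itself integrable and the decay factor is merely
bounded. Otherwise the coordinate i of `prod_singularWeight_le_sum` is integrated by means of the
decay and the others by their raised weights. Since i depends on y, the majorant is the sum over all
i. -/
theorem integrable_prod_rpow_mul_gaussFourier {n : ℕ} {lam : Fin n → ℝ}
    (hlam : ∀ i, ValidExp (lam i)) (k : ℕ) :
    Integrable fun y : Fin n → ℝ =>
      (∏ i, |y i| ^ (-lam i - 1)) * ‖gaussFourier (prodSin lam y) k 0‖ := by
  have hmeas : AEStronglyMeasurable (fun y : Fin n → ℝ =>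
      (∏ i, |y i| ^ (-lam i - 1)) * ‖gaussFourier (prodSin lam y) k 0‖) volume := by
    refine (Measurable.mul ?_ (measurable_gaussFourier_prodSin lam k 0).norm).aestronglyMeasurable
    exact Finset.measurable_prod _ fun i _ => ((measurable_pi_apply i).norm).pow_const _
  have hpos : ∀ y : Fin n → ℝ, 0 ≤ ∏ i, |y i| ^ (-lam i - 1) := fun y =>
    Finset.prod_nonneg fun i _ => by positivity
  have hsplit : ∀ y : Fin n → ℝ, (∏ i, |y i| ^ (-lam i - 1)) * ∏ i, sinWeight (lam i) (y i) =
      ∏ i, singularWeight (lam i) (y i) := fun y => by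
    rw [← Finset.prod_mul_distrib]; rfl
  by_cases h0 : ∃ i, lam i = 0
  · obtain _ | n := n
    · obtain ⟨i, _⟩ := h0; exact i.elim0
    have hn : ∀ i, lam i = 0 → ¬ 1 < lam i := fun i hi => by rw [hi]; norm_num
    choose! C hC0 hC using fun i (hi : lam i = 0) =>
      exists_norm_gaussFourier_prodSin_zero_le lam i (hn i hi) k
    have hW : ∀ i : Fin (n + 1), Integrable fun y : Fin n → ℝ =>
        ∏ k, raisedWeight n (i.removeNth lam k) (y k) := fun i =>
      Integrable.fintype_prod (f := fun k => raisedWeight n (i.removeNth lam k)) fun k =>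
        integrable_raisedWeight n (hlam _)
    have hdom : Integrable fun y : Fin (n + 1) → ℝ => ∑ i, |C i| *
        ((∏ k, raisedWeight n (i.removeNth lam k) (i.removeNth y k)) *
        (signedDecay (i.removeNth y) (y i) + signedDecay (i.removeNth y) (-(y i)))) :=
      integrable_finsetSum _ fun i _ =>
        (integrable_removeNth_mul_signedDecay i (hW i)).const_mul _
    refine hdom.mono' hmeas (ae_of_all _ fun y => ?_)
    obtain ⟨i, hi, hle⟩ := prod_singularWeight_le_sum lam h0 y
    rw [Real.norm_of_nonneg (mul_nonneg (hpos y) (norm_nonneg _))]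
    have hdec : ∀ i : Fin (n + 1), 0 ≤ signedDecay (i.removeNth y) (y i) +
        signedDecay (i.removeNth y) (-(y i)) := fun i =>
      add_nonneg ((slowlyVarying_signedDecay _).1 _) ((slowlyVarying_signedDecay _).1 _)
    calc _ ≤ (∏ i, |y i| ^ (-lam i - 1)) * (C i * ((∏ i, sinWeight (lam i) (y i)) *
          (signedDecay (i.removeNth y) (y i) + signedDecay (i.removeNth y) (-(y i))))) :=
          mul_le_mul_of_nonneg_left (hC i hi y) (hpos y)
      _ = C i * ((∏ i, singularWeight (lam i) (y i)) *
          (signedDecay (i.removeNth y) (y i) + signedDecay (i.removeNth y) (-(y i)))) := by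
          rw [← hsplit y]; ring
      _ ≤ |C i| * ((∏ k, raisedWeight n (i.removeNth lam k) (i.removeNth y k)) *
          (signedDecay (i.removeNth y) (y i) + signedDecay (i.removeNth y) (-(y i)))) := by
          refine mul_le_mul (le_abs_self _) (mul_le_mul_of_nonneg_right hle (hdec i))
            (mul_nonneg (Finset.prod_nonneg fun k _ => singularWeight_nonneg _ _) (hdec i))
            (abs_nonneg _)
      _ ≤ _ := Finset.single_le_sum (f := fun i => |C i| *
          ((∏ k, raisedWeight n (i.removeNth lam k) (i.removeNth y k)) *
          (signedDecay (i.removeNth y) (y i) + signedDecay (i.removeNth y) (-(y i)))))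
          (fun i _ => mul_nonneg (abs_nonneg _) (mul_nonneg
            (Finset.prod_nonneg fun k _ => raisedWeight_nonneg _ _ _) (hdec i)))
          (Finset.mem_univ i)
  · push Not at h0
    obtain ⟨C, hC0, hC⟩ := exists_norm_gaussFourier_prodSin_le lam
    have hW : Integrable fun y : Fin n → ℝ => ∏ k, singularWeight (lam k) (y k) :=
      Integrable.fintype_prod (f := fun k => singularWeight (lam k)) fun k =>
        integrable_singularWeight (hlam k) (h0 k)
    refine (hW.const_mul (C k * 3 ^ n)).mono' hmeas (ae_of_all _ fun y => ?_)
    rw [Real.norm_of_nonneg (mul_nonneg (hpos y) (norm_nonneg _)), ← hsplit y]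
    have hs : 0 ≤ ∏ i, sinWeight (lam i) (y i) := Finset.prod_nonneg fun i _ => sinWeight_nonneg _ _
    calc _ ≤ (∏ i, |y i| ^ (-lam i - 1)) * (C k * ((∏ i, sinWeight (lam i) (y i)) * 3 ^ n)) := by
          refine mul_le_mul_of_nonneg_left ((hC y k 0).trans ?_) (hpos y)
          exact mul_le_mul_of_nonneg_left (mul_le_mul_of_nonneg_left (signedDecay_le y 0) hs) (hC0 k)
      _ = _ := by ring

end

section

/-! ### Signed powers -/

theorem signedPow_neg (t p : ℝ) : signedPow (-t) p = -signedPow t p := by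
  simp [signedPow, Real.sign_neg]

theorem signedPow_of_pos {t : ℝ} (ht : 0 < t) (p : ℝ) : signedPow t p = t ^ p := by
  simp [signedPow, Real.sign_of_pos ht, abs_of_pos ht]

@[simp] theorem signedPow_zero_left (p : ℝ) : signedPow 0 p = 0 := by simp [signedPow]

theorem abs_signedPow_le (t p : ℝ) : |signedPow t p| ≤ |t| ^ p := by
  rw [signedPow, abs_mul, abs_of_nonneg (by positivity : 0 ≤ |t| ^ p)]
  refine mul_le_of_le_one_right (by positivity) ?_
  rcases Real.sign_apply_eq t with h | h | h <;> simp [h]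

theorem measurable_signedPow (p : ℝ) : Measurable fun t => signedPow t p := by
  have : Measurable Real.sign := by
    unfold Real.sign
    exact Measurable.ite measurableSet_Iio measurable_const
      (Measurable.ite measurableSet_Ioi measurable_const measurable_const)
  exact (measurable_norm.pow_const p).mul this

theorem sign_mul_sign (s t : ℝ) : (s * t).sign = s.sign * t.sign := by
  rcases lt_trichotomy s 0 with hs | hs | hs <;> rcases lt_trichotomy t 0 with ht | ht | ht <;>
    simp [Real.sign_of_neg, Real.sign_of_pos, hs, ht, mul_pos_of_neg_of_neg,
      mul_neg_of_neg_of_pos, mul_neg_of_pos_of_neg]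

theorem signedPow_mul (s t p : ℝ) : signedPow (s * t) p = signedPow s p * signedPow t p := by
  simp only [signedPow, abs_mul, Real.mul_rpow (abs_nonneg s) (abs_nonneg t), sign_mul_sign]
  ring

/-! ### Bounds of the sine kernel -/

theorem sinKernel_neg (l t : ℝ) : sinKernel l (-t) = -sinKernel l t := by
  unfold sinKernel; split_ifs <;> simp [Real.sin_neg]; ring

@[simp] theorem sinKernel_zero (l : ℝ) : sinKernel l 0 = 0 := by simp [sinKernel]

theorem abs_sinKernel_le_sinWeight (l t : ℝ) : |sinKernel l t| ≤ 2 * sinWeight l t := by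
  have key : ∀ t : ℝ, 0 ≤ t → |sinKernel l t| ≤ 2 * sinWeight l t := by
    intro t ht
    rcases ht.eq_or_lt with h | h
    · rw [← h]; simp [sinWeight_nonneg]
    · by_cases hl : 1 < l
      · simp only [sinKernel, sinWeight, hl, if_true, abs_of_pos h]
        have h1 := Real.sin_gt_sub_cube h
        have h2 := Real.sin_lt h
        have h3 := Real.neg_one_le_sin t
        rw [abs_sub_comm, abs_of_pos (by linarith)]
        rcases le_or_gt t 1 with ht1 | ht1
        · rw [min_eq_left (by nlinarith)]
          nlinarith [sq_nonneg t, mul_nonneg h.le (sq_nonneg t)]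
        · rw [min_eq_right (by nlinarith)]
          linarith
      · simp only [sinKernel, sinWeight, hl, if_false]
        have h1 : |Real.sin t| ≤ min 1 |t| := le_min (Real.abs_sin_le_one t) Real.abs_sin_le_abs
        have : 0 ≤ min 1 |t| := by positivity
        linarith
  rcases le_total 0 t with h | h
  · exact key t h
  · have := key (-t) (by linarith)
    rwa [sinKernel_neg, abs_neg, ← sinWeight_abs, abs_neg, sinWeight_abs] at this

/-- A power of `t` that bounds `sinWeight l t`. -/
def localWeight (l t : ℝ) : ℝ := if 1 < l then t ^ 2 else |t|

theorem sinWeight_mul_le (l y z : ℝ) : sinWeight l (y * z) ≤ localWeight l y * (1 + z ^ 2) := by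
  unfold sinWeight localWeight
  split_ifs
  · refine (min_le_left _ _).trans ?_
    rw [mul_pow]
    gcongr
    linarith
  · refine (min_le_right _ _).trans ?_
    rw [abs_mul]
    gcongr
    rw [← sq_abs z]
    nlinarith [sq_nonneg (|z| - 1), sq_nonneg |z|]

/-! ### The truncated sine integrals -/

/-- The integral of `t ^ (-l - 1) * sinKernel l t` over `[0, R]`. -/
def sinIntegral (l R : ℝ) : ℝ := ∫ t in (0 : ℝ)..R, t ^ (-l - 1) * sinKernel l t

theorem measurable_rpow_mul_sinKernel (l z : ℝ) :
    Measurable fun t : ℝ => t ^ (-l - 1) * sinKernel l (t * z) :=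
  (measurable_id.pow_const _).mul
    ((continuous_sinKernel l).measurable.comp (measurable_id.mul_const z))

theorem integrableOn_Ioc_rpow_mul_localWeight {l : ℝ} (hl : ValidExp l) (R : ℝ) :
    IntegrableOn (fun t : ℝ => t ^ (-l - 1) * localWeight l t) (Set.Ioc 0 R) := by
  rcases hl with ⟨h1, h2⟩ | ⟨h1, h2⟩
  · refine (integrableOn_Ioc_rpow (a := -l) (by linarith) R).congr_fun (fun t ht => ?_)
      measurableSet_Ioc
    simp only [localWeight, not_lt.2 h2.le, if_false, abs_of_pos ht.1]
    conv_rhs => rw [← Real.rpow_one t, ← Real.rpow_mul ht.1.le, ← Real.rpow_add ht.1]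
    congr 1; ring
  · refine (integrableOn_Ioc_rpow (a := 1 - l) (by linarith) R).congr_fun (fun t ht => ?_)
      measurableSet_Ioc
    simp only [localWeight, h1, if_true, ← Real.rpow_two]
    rw [← Real.rpow_add ht.1]
    congr 1; ring

theorem integrableOn_Ioc_rpow_mul_sinKernel {l : ℝ} (hl : ValidExp l) (R z : ℝ) :
    IntegrableOn (fun t : ℝ => t ^ (-l - 1) * sinKernel l (t * z)) (Set.Ioc 0 R) := by
  refine ((integrableOn_Ioc_rpow_mul_localWeight hl R).mul_const (2 * (1 + z ^ 2))).mono'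
    (measurable_rpow_mul_sinKernel l z).aestronglyMeasurable
    ((ae_restrict_iff' measurableSet_Ioc).2 (ae_of_all _ fun t ht => ?_))
  have hp : 0 ≤ t ^ (-l - 1) := Real.rpow_nonneg ht.1.le _
  rw [norm_mul, Real.norm_of_nonneg hp, Real.norm_eq_abs]
  have h1 := abs_sinKernel_le_sinWeight l (t * z)
  have h2 := sinWeight_mul_le l t z
  calc _ ≤ t ^ (-l - 1) * (2 * (localWeight l t * (1 + z ^ 2))) := by gcongr; linarith
    _ = _ := by ring

theorem intervalIntegrable_sin {l : ℝ} (hl : ValidExp l) {R : ℝ} (hR : 0 ≤ R) :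
    IntervalIntegrable (fun t : ℝ => t ^ (-l - 1) * sinKernel l t) volume 0 R := by
  rw [intervalIntegrable_iff_integrableOn_Ioc_of_le hR]
  simpa using integrableOn_Ioc_rpow_mul_sinKernel hl R 1

/-- For l ≠ 0 the integral converges absolutely. For l = 0 it is the Dirichlet integral, handled by
integrating by parts on [1, R]. -/
theorem exists_tendsto_sinIntegral {l : ℝ} (hl : ValidExp l) :
    ∃ c, Tendsto (sinIntegral l) atTop (𝓝 c) := by
  by_cases h0 : l = 0
  · subst h0
    have hcos : IntegrableOn (fun t : ℝ => (t ^ 2)⁻¹ * Real.cos t) (Set.Ioi 1) := by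
      refine (integrableOn_Ioi_rpow_of_lt (a := -2) (by norm_num) one_pos).mono' ?_ ?_
      · exact (Measurable.mul (by fun_prop) Real.measurable_cos).aestronglyMeasurable
      · refine (ae_restrict_iff' measurableSet_Ioi).2 (ae_of_all _ fun t ht => ?_)
        have : (0 : ℝ) < t := one_pos.trans ht
        rw [norm_mul, norm_inv, norm_pow, Real.norm_of_nonneg this.le, Real.rpow_neg this.le,
          Real.rpow_two]
        exact mul_le_of_le_one_right (by positivity) (Real.abs_cos_le_one t)
    have hlim : Tendsto (fun R : ℝ => ∫ t in (1 : ℝ)..R, (t ^ 2)⁻¹ * Real.cos t) atTop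
        (𝓝 (∫ t in Set.Ioi 1, (t ^ 2)⁻¹ * Real.cos t)) :=
      intervalIntegral_tendsto_integral_Ioi 1 hcos tendsto_id
    have hb : Tendsto (fun R : ℝ => R⁻¹ * -Real.cos R) atTop (𝓝 0) := by
      refine squeeze_zero_norm' ?_ tendsto_inv_atTop_zero
      filter_upwards [eventually_gt_atTop 0] with R hR
      rw [norm_mul, norm_neg, norm_inv, Real.norm_of_nonneg hR.le]
      exact mul_le_of_le_one_right (by positivity) (Real.abs_cos_le_one R)
    refine ⟨_, (((hb.sub_const (1⁻¹ * -Real.cos 1)).sub hlim).const_add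
      (sinIntegral 0 1)).congr' ?_⟩
    filter_upwards [eventually_ge_atTop 1] with R hR
    have hpos : ∀ x ∈ Set.uIcc 1 R, x ≠ 0 := fun x hx => by
      rw [Set.uIcc_of_le hR] at hx; linarith [hx.1]
    have hii : IntervalIntegrable (fun t : ℝ => t ^ (-(0 : ℝ) - 1) * sinKernel 0 t) volume 1 R :=
      ((intervalIntegrable_sin hl zero_le_one).symm).trans
        (intervalIntegrable_sin hl (zero_le_one.trans hR))
    have hsum : sinIntegral 0 R = sinIntegral 0 1 +
        ∫ t in (1 : ℝ)..R, t ^ (-(0 : ℝ) - 1) * sinKernel 0 t :=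
      (intervalIntegral.integral_add_adjacent_intervals
        (intervalIntegrable_sin hl zero_le_one) hii).symm
    have hcu : ContinuousOn (fun x : ℝ => -(x ^ 2)⁻¹) (Set.uIcc 1 R) :=
      (ContinuousOn.inv₀ (by fun_prop) fun x hx => pow_ne_zero 2 (hpos x hx)).neg
    have hparts := intervalIntegral.integral_mul_deriv_eq_deriv_mul (a := 1) (b := R)
      (u := fun x : ℝ => x⁻¹) (v := fun x => -Real.cos x) (u' := fun x : ℝ => -(x ^ 2)⁻¹)
      (v' := Real.sin) (fun x hx => hasDerivAt_inv (hpos x hx))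
      (fun x _ => by have h := (Real.hasDerivAt_cos x).neg; rw [neg_neg] at h; exact h) hcu.intervalIntegrable
      (Real.continuous_sin.intervalIntegrable _ _)
    have e1 : ∫ t in (1 : ℝ)..R, t ^ (-(0 : ℝ) - 1) * sinKernel 0 t =
        ∫ t in (1 : ℝ)..R, t⁻¹ * Real.sin t := by
      congr 1; ext t
      rw [show -(0 : ℝ) - 1 = -1 by norm_num, Real.rpow_neg_one]
      simp [sinKernel, show ¬ (1 : ℝ) < 0 by norm_num]
    rw [hsum, e1, hparts]
    simp only [neg_mul_neg]
  · have hint : IntegrableOn (fun t : ℝ => t ^ (-l - 1) * sinKernel l t) (Set.Ioi 0) := by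
      refine ((integrable_singularWeight hl h0).integrableOn.const_mul 2).mono' ?_ ?_
      · simpa using (measurable_rpow_mul_sinKernel l 1).aestronglyMeasurable
      · refine (ae_restrict_iff' measurableSet_Ioi).2 (ae_of_all _ fun t ht => ?_)
        have ht : (0 : ℝ) < t := ht
        have h1 := abs_sinKernel_le_sinWeight l t
        rw [norm_mul, Real.norm_of_nonneg (by positivity), Real.norm_eq_abs, singularWeight,
          abs_of_pos ht]
        calc _ ≤ t ^ (-l - 1) * (2 * sinWeight l t) := by gcongr
          _ = _ := by ring
    exact ⟨_, intervalIntegral_tendsto_integral_Ioi 0 hint tendsto_id⟩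

/-- The regularized value of the integral of `t ^ (-l - 1) * sin t` over the half line. -/
def sinConst (l : ℝ) : ℝ := limUnder atTop (sinIntegral l)

theorem tendsto_sinIntegral {l : ℝ} (hl : ValidExp l) :
    Tendsto (sinIntegral l) atTop (𝓝 (sinConst l)) :=
  tendsto_nhds_limUnder (exists_tendsto_sinIntegral hl)

theorem continuousOn_sinIntegral {l : ℝ} (hl : ValidExp l) (M : ℝ) (hM : 0 ≤ M) :
    ContinuousOn (sinIntegral l) (Set.Icc 0 M) := by
  have := intervalIntegral.continuousOn_primitive_interval (a := 0) (b := M) (μ := volume)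
    (f := fun t : ℝ => t ^ (-l - 1) * sinKernel l t) (by
      rw [Set.uIcc_of_le hM, integrableOn_Icc_iff_integrableOn_Ioc]
      simpa using integrableOn_Ioc_rpow_mul_sinKernel hl M 1)
  rwa [Set.uIcc_of_le hM] at this

/-- A continuous function with a limit at infinity is bounded. This uniform bound is the majorant
for R → ∞ in cases where the integrand itself has none. -/
theorem exists_abs_sinIntegral_le {l : ℝ} (hl : ValidExp l) :
    ∃ B, 0 ≤ B ∧ ∀ R, 0 ≤ R → |sinIntegral l R| ≤ B := by
  have h1 := (tendsto_sinIntegral hl).abs.eventually (eventually_le_nhds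
    (lt_add_one |sinConst l|))
  obtain ⟨M, hM⟩ := eventually_atTop.1 h1
  obtain ⟨B, hB⟩ := isCompact_Icc.exists_bound_of_continuousOn
    (continuousOn_sinIntegral hl (max M 0) (le_max_right _ _))
  refine ⟨max B (|sinConst l| + 1), le_max_of_le_right (by positivity), fun R hR => ?_⟩
  rcases le_total R (max M 0) with h | h
  · exact (hB R ⟨hR, h⟩).trans (le_max_left _ _)
  · exact (hM R ((le_max_left _ _).trans h)).trans (le_max_right _ _)

/-! ### The kernel on a symmetric interval -/

/-- The integrand `y ^⟨-l-1⟩ * sinKernel l (y * z)`, cut off outside `[-R, R]`. -/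
def boxKernel (l R z y : ℝ) : ℝ :=
  if |y| ≤ R then signedPow y (-l - 1) * sinKernel l (y * z) else 0

/-- An integrable bound for `boxKernel`. -/
def boxWeight (l R y : ℝ) : ℝ := if |y| ≤ R then 2 * (|y| ^ (-l - 1) * localWeight l y) else 0

theorem abs_boxKernel_le (l R z y : ℝ) : |boxKernel l R z y| ≤ boxWeight l R y * (1 + z ^ 2) := by
  unfold boxKernel boxWeight
  split_ifs
  · rw [abs_mul]
    have h1 := (abs_sinKernel_le_sinWeight l (y * z)).trans
      (mul_le_mul_of_nonneg_left (sinWeight_mul_le l y z) two_pos.le)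
    calc _ ≤ |y| ^ (-l - 1) * (2 * (localWeight l y * (1 + z ^ 2))) :=
          mul_le_mul (abs_signedPow_le _ _) h1 (abs_nonneg _) (by positivity)
      _ = _ := by ring
  · simp

theorem localWeight_abs (l t : ℝ) : localWeight l |t| = localWeight l t := by
  simp [localWeight]

theorem integrable_boxWeight {l : ℝ} (hl : ValidExp l) (R : ℝ) : Integrable (boxWeight l R) := by
  have h : Integrable fun y => boxWeight l R |y| := by
    refine integrable_comp_abs ?_
    have h1 := ((integrableOn_Ioc_rpow_mul_localWeight hl R).const_mul 2)
    refine ((integrable_indicator_iff measurableSet_Ioc).2 h1).integrableOn.congr_fun (fun t ht => ?_) measurableSet_Ioi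
    have ht : (0 : ℝ) < t := ht
    simp only [Set.indicator, Set.mem_Ioc, ht, true_and, boxWeight, abs_of_pos ht]
  have e : ∀ y, boxWeight l R |y| = boxWeight l R y := fun y => by
    simp [boxWeight, localWeight_abs]
  simpa only [e] using h

theorem measurable_boxKernel (l R : ℝ) : Measurable fun p : ℝ × ℝ => boxKernel l R p.1 p.2 := by
  refine Measurable.ite (measurableSet_le measurable_snd.norm measurable_const) ?_ measurable_const
  exact ((measurable_signedPow _).comp measurable_snd).mul
    ((continuous_sinKernel l).measurable.comp (measurable_snd.mul measurable_fst))

theorem boxKernel_abs (l R z y : ℝ) : boxKernel l R z |y| = boxKernel l R z y := by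
  rcases abs_choice y with h | h
  · rw [h]
  · rw [h]; simp [boxKernel, signedPow_neg, sinKernel_neg]

/-- The two factors of the kernel are odd in y, so the half line counts twice, and t = y z extracts
z^l. Oddness in z covers the negative values. -/
theorem integral_boxKernel (l : ℝ) {R : ℝ} (hR : 0 ≤ R) (z : ℝ) :
    ∫ y, boxKernel l R z y = 2 * (signedPow z l * sinIntegral l (R * |z|)) := by
  have key : ∀ z, 0 ≤ z → ∫ y, boxKernel l R z y =
      2 * (signedPow z l * sinIntegral l (R * |z|)) := by
    intro z hz
    rcases hz.eq_or_lt with h | h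
    · simp [← h, boxKernel]
    · have h1 : ∫ y, boxKernel l R z |y| = 2 * ∫ y in Set.Ioi 0, boxKernel l R z y :=
        integral_comp_abs
      simp_rw [boxKernel_abs] at h1
      rw [h1]
      congr 1
      have h2 : ∫ y in Set.Ioi 0, boxKernel l R z y =
          ∫ y in (0 : ℝ)..R, z ^ (l + 1) * ((y * z) ^ (-l - 1) * sinKernel l (y * z)) := by
        rw [intervalIntegral.integral_of_le hR, ← integral_indicator measurableSet_Ioi,
          ← integral_indicator measurableSet_Ioc]
        congr 1
        ext y
        by_cases hy : 0 < y
        · simp only [Set.indicator, Set.mem_Ioi, Set.mem_Ioc, hy, true_and, if_true, boxKernel,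
            abs_of_pos hy, signedPow_of_pos hy]
          split_ifs
          · rw [Real.mul_rpow hy.le hz, ← mul_assoc, mul_left_comm, ← Real.rpow_add h]
            rw [show l + 1 + (-l - 1) = 0 by ring, Real.rpow_zero, mul_one]
          · rfl
        · simp [Set.indicator, hy]
      rw [h2, intervalIntegral.integral_const_mul,
        intervalIntegral.integral_comp_mul_right
          (fun t : ℝ => t ^ (-l - 1) * sinKernel l t) h.ne', zero_mul, smul_eq_mul, ← mul_assoc,
        signedPow_of_pos h, abs_of_pos h, sinIntegral, Real.rpow_add h, Real.rpow_one,
        mul_assoc (z ^ l), mul_inv_cancel₀ h.ne', mul_one]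
  rcases le_total 0 z with h | h
  · exact key z h
  · have h1 := key (-z) (by linarith)
    have h2 : ∀ y, boxKernel l R (-z) y = -boxKernel l R z y := fun y => by
      unfold boxKernel; split_ifs <;> simp [sinKernel_neg]
    simp only [h2, integral_neg, signedPow_neg, abs_neg, neg_mul, mul_neg] at h1
    linarith

/-! ### Absolute moments of the Gaussian -/

/-- The absolute moment of order `q` of the standard Gaussian law. -/
def absMoment (q : ℝ) : ℝ := ∫ z, |z| ^ q ∂stdGauss

theorem gaussianPDFReal_std (x : ℝ) :
    ProbabilityTheory.gaussianPDFReal 0 1 x = (√(2 * Real.pi))⁻¹ * Real.exp (-(1 / 2) * x ^ 2) := by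
  rw [ProbabilityTheory.gaussianPDFReal_def]
  simp only [NNReal.coe_one, mul_one, sub_zero]
  congr 2; ring

theorem integrable_stdGauss_iff {f : ℝ → ℝ} :
    Integrable f stdGauss ↔ Integrable fun x => Real.exp (-(1 / 2) * x ^ 2) * f x := by
  rw [stdGauss, ProbabilityTheory.gaussianReal_of_var_ne_zero _ one_ne_zero,
    integrable_withDensity_iff_integrable_smul' (ProbabilityTheory.measurable_gaussianPDF _ _)
      (ae_of_all _ fun _ => ProbabilityTheory.gaussianPDF_lt_top)]
  simp only [ProbabilityTheory.toReal_gaussianPDF, gaussianPDFReal_std, smul_eq_mul, mul_assoc]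
  exact integrable_const_mul_iff (by
    have : (0 : ℝ) < √(2 * Real.pi) := by positivity
    exact (inv_pos.2 this).ne'.isUnit) _

theorem integrable_abs_rpow {q : ℝ} (hq : -1 < q) : Integrable (fun z => |z| ^ q) stdGauss := by
  rw [integrable_stdGauss_iff]
  have := integrable_comp_abs (integrableOn_rpow_mul_exp_neg_mul_sq (b := 1 / 2) (by norm_num) hq)
  simpa only [sq_abs, mul_comm] using this

theorem absMoment_eq {q : ℝ} (hq : -1 < q) :
    absMoment q = 2 ^ (q / 2) * Real.Gamma ((q + 1) / 2) / √Real.pi := by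
  rw [absMoment, stdGauss, ProbabilityTheory.integral_gaussianReal_eq_integral_smul one_ne_zero]
  simp only [gaussianPDFReal_std, smul_eq_mul, mul_assoc]
  rw [integral_const_mul]
  have h := integral_comp_abs (f := fun t : ℝ => t ^ q * Real.exp (-(1 / 2) * t ^ (2 : ℝ)))
  rw [integral_rpow_mul_exp_neg_mul_rpow two_pos hq (by norm_num)] at h
  have e : ∀ a : ℝ, Real.exp (-(1 / 2) * a ^ 2) * |a| ^ q =
      |a| ^ q * Real.exp (-(1 / 2) * |a| ^ (2 : ℝ)) := fun a => by
    rw [Real.rpow_two, sq_abs, mul_comm]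
  simp_rw [e]
  rw [h, Real.sqrt_mul zero_le_two, one_div, Real.inv_rpow zero_le_two, ← Real.rpow_neg zero_le_two,
    show -(-(q + 1) / 2) = q / 2 + 1 / 2 by ring, Real.rpow_add two_pos, ← Real.sqrt_eq_rpow]
  have : (0 : ℝ) < √2 := by positivity
  field_simp

theorem absMoment_pos {q : ℝ} (hq : -1 < q) : 0 < absMoment q := by
  rw [absMoment_eq hq]
  have := Real.Gamma_pos_of_pos (show 0 < (q + 1) / 2 by linarith)
  positivity

end

/-! ### Gamma values of the sine integrals -/

section

theorem gaussFourier_zero (m : ℝ → ℝ) (k : ℕ) :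
    gaussFourier m k 0 = ((∫ z, z ^ k * m z ∂stdGauss : ℝ) : ℂ) := by
  rw [← integral_complex_ofReal]
  unfold gaussFourier
  simp

theorem gaussFourier_one_one (s : ℝ) :
    gaussFourier (fun _ => 1) 1 s = Complex.I * (s * Complex.exp (-(s : ℂ) ^ 2 / 2)) := by
  have h1 := hasDerivAt_gaussFourier hasAllMoments_one 0 s
  rw [show gaussFourier (fun _ => 1) 0 = fun s : ℝ => Complex.exp (-(s : ℂ) ^ 2 / 2) from
    funext gaussFourier_one_zero] at h1
  have h2 : HasDerivAt (fun z : ℂ => Complex.exp (-z ^ 2 / 2))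
      (Complex.exp (-(s : ℂ) ^ 2 / 2) * (-(s : ℂ))) (s : ℂ) := by
    refine HasDerivAt.cexp ((((hasDerivAt_id (s : ℂ)).pow 2).neg).div_const 2 |>.congr_deriv ?_)
    simp
    ring
  have h3 := h1.unique h2.comp_ofReal
  linear_combination (-Complex.I) * h3 + gaussFourier (fun _ => 1) 1 s * Complex.I_sq

theorem gaussFourier_one_two_zero : gaussFourier (fun _ => 1) 2 0 = 1 := by
  have h1 := hasDerivAt_gaussFourier hasAllMoments_one 1 0
  rw [show gaussFourier (fun _ => 1) 1 = fun s : ℝ =>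
    Complex.I * (s * Complex.exp (-(s : ℂ) ^ 2 / 2)) from funext gaussFourier_one_one] at h1
  have h2 : HasDerivAt (fun z : ℂ => Complex.I * (z * Complex.exp (-z ^ 2 / 2))) Complex.I
      ((0 : ℝ) : ℂ) := by
    have h0 : HasDerivAt (fun z : ℂ => -z ^ 2 / 2) 0 ((0 : ℝ) : ℂ) :=
      (((hasDerivAt_id (((0 : ℝ) : ℂ))).pow 2).neg).div_const 2 |>.congr_deriv (by simp)
    refine (((hasDerivAt_id (((0 : ℝ) : ℂ))).mul h0.cexp).const_mul Complex.I).congr_deriv ?_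
    simp
  have h3 := h1.unique h2.comp_ofReal
  have := mul_left_cancel₀ Complex.I_ne_zero (h3.trans (mul_one _).symm)
  exact this

/-- The first term comes from differentiating the Gaussian characteristic function; the subtracted 1
is the second moment of the Gaussian, produced by the linear part. -/
theorem integral_mul_sinKernel (l y : ℝ) :
    ∫ z, z * sinKernel l (y * z) ∂stdGauss =
      y * (Real.exp (-(1 / 2) * y ^ 2) - if 1 < l then 1 else 0) := by
  have h := gaussFourier_mul_sinKernel hasAllMoments_one l y 1 0
  rw [gaussFourier_zero] at h
  simp only [mul_one, pow_one, zero_add, zero_sub] at h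
  rw [gaussFourier_one_one, gaussFourier_one_one, gaussFourier_one_two_zero] at h
  have e : Complex.exp (-(y : ℂ) ^ 2 / 2) = ((Real.exp (-(1 / 2) * y ^ 2) : ℝ) : ℂ) := by
    push_cast; congr 1; ring
  have e2 : Complex.exp (-((-y : ℝ) : ℂ) ^ 2 / 2) = ((Real.exp (-(1 / 2) * y ^ 2) : ℝ) : ℂ) := by
    push_cast; congr 1; ring
  rw [e, e2] at h
  apply Complex.ofReal_injective
  rw [h]
  have := Complex.I_ne_zero
  split_ifs
  · push_cast
    field_simp
    ring
  · push_cast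
    field_simp
    ring

theorem integral_rpow_mul_exp_half {q : ℝ} (hq : -1 < q) :
    ∫ t in Set.Ioi (0 : ℝ), t ^ q * Real.exp (-(1 / 2) * t ^ 2) =
      2 ^ ((q + 1) / 2) * (1 / 2) * Real.Gamma ((q + 1) / 2) := by
  have h := integral_rpow_mul_exp_neg_mul_rpow two_pos hq (b := 1 / 2) (by norm_num)
  simp only [Real.rpow_two] at h
  rw [h, one_div, Real.inv_rpow zero_le_two, ← Real.rpow_neg zero_le_two]
  congr 3
  ring

theorem integrableOn_rpow_mul_exp_sub {l : ℝ} (h1 : 1 < l) (h2 : l < 2) :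
    IntegrableOn (fun t : ℝ => t ^ (-l) * (Real.exp (-(1 / 2) * t ^ 2) - 1)) (Set.Ioi 0) := by
  refine integrableOn_Ioi_of_abs_le_rpow (a := 1 - l) (b := -l) (C := 1)
    (Measurable.aestronglyMeasurable ?_) (by linarith) (by linarith) (fun t h0 ht => ?_)
    fun t ht => ?_
  · exact (measurable_id.pow_const _).mul (by fun_prop)
  · have e1 := Real.add_one_le_exp (-(1 / 2) * t ^ 2)
    have e2 : Real.exp (-(1 / 2) * t ^ 2) ≤ 1 := Real.exp_le_one_iff.2 (by nlinarith [sq_nonneg t])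
    rw [abs_mul, abs_of_nonneg (by positivity), abs_of_nonpos (by linarith), one_mul,
      show 1 - l = -l + 1 by ring, Real.rpow_add h0, Real.rpow_one]
    gcongr
    nlinarith
  · have h0 : 0 < t := one_pos.trans ht
    have e1 := Real.exp_pos (-(1 / 2) * t ^ 2)
    have e2 : Real.exp (-(1 / 2) * t ^ 2) ≤ 1 := Real.exp_le_one_iff.2 (by nlinarith [sq_nonneg t])
    rw [abs_mul, abs_of_nonneg (by positivity), abs_of_nonpos (by linarith), one_mul]
    exact mul_le_of_le_one_right (by positivity) (by linarith)

/-- One integration by parts reduces to the exponent 2 - l, and the functional equation of Γ carries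
the value back to the negative argument (1 - l)/2. Subtracting 1 is thus analytic continuation in l.
-/
theorem integral_rpow_mul_exp_sub_one {l : ℝ} (h1 : 1 < l) (h2 : l < 2) :
    ∫ t in Set.Ioi (0 : ℝ), t ^ (-l) * (Real.exp (-(1 / 2) * t ^ 2) - 1) =
      2 ^ ((1 - l) / 2) * (1 / 2) * Real.Gamma ((1 - l) / 2) := by
  have hl : 1 - l ≠ 0 := by linarith
  have hint := integrableOn_rpow_mul_exp_sub h1 h2
  have hint2 : IntegrableOn (fun t : ℝ => t ^ (2 - l) * Real.exp (-(1 / 2) * t ^ 2)) (Set.Ioi 0) :=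
    integrableOn_rpow_mul_exp_neg_mul_sq (by norm_num) (by linarith)
  have heq : ∀ t : ℝ, 0 < t → t ^ (1 - l) / (1 - l) * (-t * Real.exp (-(1 / 2) * t ^ 2)) =
      -(1 / (1 - l)) * (t ^ (2 - l) * Real.exp (-(1 / 2) * t ^ 2)) := fun t ht => by
    rw [show 2 - l = (1 - l) + 1 by ring, Real.rpow_add ht, Real.rpow_one]
    ring
  have hsm : ∀ t : ℝ, 0 < t → |t ^ (1 - l) * (Real.exp (-(1 / 2) * t ^ 2) - 1)| ≤
      t ^ (3 - l) := fun t h0 => by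
    have e1 := Real.add_one_le_exp (-(1 / 2) * t ^ 2)
    have e2 : Real.exp (-(1 / 2) * t ^ 2) ≤ 1 := Real.exp_le_one_iff.2 (by nlinarith [sq_nonneg t])
    rw [abs_mul, abs_of_nonneg (by positivity), abs_of_nonpos (by linarith),
      show 3 - l = (1 - l) + (2 : ℝ) by ring, Real.rpow_add h0, Real.rpow_two]
    gcongr
    nlinarith
  have hlg : ∀ t : ℝ, 0 < t → |t ^ (1 - l) * (Real.exp (-(1 / 2) * t ^ 2) - 1)| ≤
      t ^ (-(l - 1)) := fun t h0 => by
    have e1 := Real.exp_pos (-(1 / 2) * t ^ 2)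
    have e2 : Real.exp (-(1 / 2) * t ^ 2) ≤ 1 := Real.exp_le_one_iff.2 (by nlinarith [sq_nonneg t])
    rw [abs_mul, abs_of_nonneg (by positivity), abs_of_nonpos (by linarith), neg_sub l 1]
    exact mul_le_of_le_one_right (by positivity) (by linarith)
  have z1 : Tendsto (fun t : ℝ => t ^ (1 - l) * (Real.exp (-(1 / 2) * t ^ 2) - 1)) (𝓝[>] 0)
      (𝓝 0) := by
    refine squeeze_zero_norm' (a := fun t : ℝ => t ^ (3 - l)) ?_ ?_
    · filter_upwards [self_mem_nhdsWithin] with t ht using hsm t ht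
    · have := (Real.continuousAt_rpow_const 0 (3 - l) (Or.inr (by linarith))).tendsto
      rw [Real.zero_rpow (by linarith)] at this
      exact this.mono_left nhdsWithin_le_nhds
  have z2 : Tendsto (fun t : ℝ => t ^ (1 - l) * (Real.exp (-(1 / 2) * t ^ 2) - 1)) atTop
      (𝓝 0) := by
    refine squeeze_zero_norm' (a := fun t : ℝ => t ^ (-(l - 1))) ?_
      (tendsto_rpow_neg_atTop (sub_pos.2 h1))
    filter_upwards [eventually_gt_atTop 0] with t ht using hlg t ht
  have hparts := integral_Ioi_mul_deriv_eq_deriv_mul (a := (0 : ℝ)) (a' := 0) (b' := 0)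
    (u := fun t : ℝ => Real.exp (-(1 / 2) * t ^ 2) - 1)
    (u' := fun t : ℝ => -t * Real.exp (-(1 / 2) * t ^ 2))
    (v := fun t : ℝ => t ^ (1 - l) / (1 - l)) (v' := fun t : ℝ => t ^ (-l))
    (fun t _ => by
      have h := ((((hasDerivAt_id t).pow 2).const_mul (-(1 / 2) : ℝ)).exp).sub_const 1
      refine h.congr_deriv ?_
      simp
      ring)
    (fun t ht => by
      have h := (Real.hasDerivAt_rpow_const (p := 1 - l) (Or.inl (ne_of_gt ht))).div_const (1 - l)
      refine h.congr_deriv ?_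
      rw [show 1 - l - 1 = -l by ring]
      field_simp)
    (hint.congr_fun (fun t _ => by simp only [Pi.mul_apply]; ring) measurableSet_Ioi)
    (IntegrableOn.congr_fun (hint2.const_mul (-(1 / (1 - l)))) (fun t ht => by
      simp only [Pi.mul_apply]; rw [← heq t ht]; ring) measurableSet_Ioi)
    (by
      have := z1.div_const (1 - l)
      rw [zero_div] at this
      refine this.congr fun t => ?_
      simp only [Pi.mul_apply]; ring)
    (by
      have := z2.div_const (1 - l)
      rw [zero_div] at this
      refine this.congr fun t => ?_
      simp only [Pi.mul_apply]; ring)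
  have e1 : ∫ t in Set.Ioi (0 : ℝ), t ^ (-l) * (Real.exp (-(1 / 2) * t ^ 2) - 1) =
      ∫ t in Set.Ioi (0 : ℝ), (Real.exp (-(1 / 2) * t ^ 2) - 1) * t ^ (-l) := by
    congr 1; ext t; ring
  have e2 : ∫ t in Set.Ioi (0 : ℝ), -t * Real.exp (-(1 / 2) * t ^ 2) * (t ^ (1 - l) / (1 - l)) =
      -(1 / (1 - l)) * (2 ^ ((2 - l + 1) / 2) * (1 / 2) * Real.Gamma ((2 - l + 1) / 2)) := by
    rw [← integral_rpow_mul_exp_half (by linarith), ← integral_const_mul]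
    refine setIntegral_congr_fun measurableSet_Ioi fun t ht => ?_
    rw [← heq t ht]; ring
  rw [e1, hparts, e2, show (2 - l + 1) / 2 = (1 - l) / 2 + 1 by ring,
    Real.Gamma_add_one (by intro h; apply hl; linarith), Real.rpow_add two_pos, Real.rpow_one]
  field_simp
  ring

theorem tendsto_integral_rpow_mul_exp {l : ℝ} (hl : ValidExp l) :
    Tendsto (fun R : ℝ => ∫ t in (0 : ℝ)..R,
      t ^ (-l) * (Real.exp (-(1 / 2) * t ^ 2) - if 1 < l then 1 else 0)) atTop
      (𝓝 (2 ^ ((1 - l) / 2) * (1 / 2) * Real.Gamma ((1 - l) / 2))) := by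
  rcases hl with ⟨h1, h2⟩ | ⟨h1, h2⟩
  · simp only [not_lt.2 h2.le, if_false, sub_zero]
    have h := integral_rpow_mul_exp_half (q := -l) (by linarith)
    rw [show -l + 1 = 1 - l by ring] at h
    rw [← h]
    exact intervalIntegral_tendsto_integral_Ioi 0
      (integrableOn_rpow_mul_exp_neg_mul_sq (by norm_num) (by linarith)) tendsto_id
  · simp only [h1, if_true]
    rw [← integral_rpow_mul_exp_sub_one h1 h2]
    exact intervalIntegral_tendsto_integral_Ioi 0 (integrableOn_rpow_mul_exp_sub h1 h2) tendsto_id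

/-- Fubini on [-R, R]: integrating y first gives the truncated sine integral, z first the Gaussian.
The additional factor z makes the integrand even in z; without it the average would vanish. -/
theorem integral_boxKernel_average {l : ℝ} (hl : ValidExp l) {R : ℝ} (hR : 0 ≤ R) :
    ∫ z, z * (2 * (signedPow z l * sinIntegral l (R * |z|))) ∂stdGauss =
      2 * ∫ t in (0 : ℝ)..R,
        t ^ (-l) * (Real.exp (-(1 / 2) * t ^ 2) - if 1 < l then 1 else 0) := by
  have hint : Integrable (fun p : ℝ × ℝ => p.1 * boxKernel l R p.1 p.2)
      (stdGauss.prod volume) := by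
    have h1 : Integrable (fun z : ℝ => |z| * (1 + z ^ 2)) stdGauss := by
      have := (hasAllMoments_one.2 1).add (hasAllMoments_one.2 3)
      refine this.congr (ae_of_all _ fun z => ?_)
      simp only [Pi.add_apply, abs_one, mul_one, pow_one]
      rw [← sq_abs z]; ring
    refine (h1.mul_prod (integrable_boxWeight hl R)).mono'
      (measurable_fst.mul (measurable_boxKernel l R)).aestronglyMeasurable
      (ae_of_all _ fun p => ?_)
    rw [norm_mul, Real.norm_eq_abs, Real.norm_eq_abs]
    calc _ ≤ |p.1| * (boxWeight l R p.2 * (1 + p.1 ^ 2)) :=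
          mul_le_mul_of_nonneg_left (abs_boxKernel_le _ _ _ _) (abs_nonneg _)
      _ = _ := by ring
  have hswap := integral_integral_swap (f := fun z y => z * boxKernel l R z y) hint
  simp_rw [integral_const_mul, integral_boxKernel l hR] at hswap
  rw [hswap]
  set F : ℝ → ℝ := fun t => if t ≤ R then
      t ^ (-l) * (Real.exp (-(1 / 2) * t ^ 2) - if 1 < l then 1 else 0) else 0 with hF
  have hin : ∀ y, y ≠ 0 → ∫ z, z * boxKernel l R z y ∂stdGauss = F |y| := fun y h0 => by
    simp only [boxKernel, hF]
    by_cases hy : |y| ≤ R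
    · have : ∀ z : ℝ, z * (signedPow y (-l - 1) * sinKernel l (y * z)) =
          signedPow y (-l - 1) * (z * sinKernel l (y * z)) := fun z => by ring
      simp only [hy, if_true]
      simp_rw [this]
      rw [integral_const_mul, integral_mul_sinKernel, sq_abs, ← mul_assoc]
      congr 1
      have hy0 : 0 < |y| := abs_pos.2 h0
      rw [signedPow, mul_assoc, show y.sign * y = |y| by
        rcases lt_or_gt_of_ne h0 with h | h
        · rw [Real.sign_of_neg h, abs_of_neg h]; ring
        · rw [Real.sign_of_pos h, abs_of_pos h]; ring]
      conv_lhs => rw [← Real.rpow_one |y|, ← Real.rpow_mul hy0.le, ← Real.rpow_add hy0]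
      congr 1; ring
    · simp [hy]
  have hae : ∀ᵐ y : ℝ, y ≠ 0 := by simp [ae_iff]
  rw [integral_congr_ae (hae.mono fun y hy => hin y hy), integral_comp_abs (f := F),
    intervalIntegral.integral_of_le hR, ← integral_indicator measurableSet_Ioi,
    ← integral_indicator measurableSet_Ioc]
  congr 2
  ext t
  by_cases ht : 0 < t <;> simp [Set.indicator, ht, hF]

/-- The value of the sine integrals. -/
theorem sinConst_eq {l : ℝ} (hl : ValidExp l) :
    2 * sinConst l * (2 ^ l / √Real.pi * Real.Gamma (1 + l / 2)) = Real.Gamma (1 / 2 - l / 2) := by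
  have hl0 : 0 ≤ l := by rcases hl with h | h <;> linarith [h.1]
  obtain ⟨B, hB0, hB⟩ := exists_abs_sinIntegral_le hl
  have hz : ∀ z R : ℝ, z * (2 * (signedPow z l * sinIntegral l (R * |z|))) =
      2 * (|z| ^ (l + 1) * sinIntegral l (R * |z|)) := fun z R => by
    rcases eq_or_ne z 0 with h0 | h0
    · subst h0; simp [Real.zero_rpow (by linarith : l + 1 ≠ 0)]
    · rw [Real.rpow_add (abs_pos.2 h0), Real.rpow_one, signedPow]
      rcases lt_or_gt_of_ne h0 with h | h
      · rw [Real.sign_of_neg h, abs_of_neg h]; ring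
      · rw [Real.sign_of_pos h, abs_of_pos h]; ring
  -- As R → ∞ one order of integration yields an absolute moment of order l + 1 times the sine
  -- constant, the other a Gamma integral. Comparing the two limits determines the constant.
  have hlim : Tendsto (fun R : ℝ => ∫ z, z * (2 * (signedPow z l * sinIntegral l (R * |z|)))
      ∂stdGauss) atTop (𝓝 (∫ z, 2 * (|z| ^ (l + 1) * sinConst l) ∂stdGauss)) := by
    simp_rw [hz]
    refine tendsto_integral_filter_of_dominated_convergence
      (fun z => 2 * (|z| ^ (l + 1) * B)) ?_ ?_ ?_ ?_
    · filter_upwards [eventually_ge_atTop 0] with R hR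
      have hm : ∀ z, z * (2 * (signedPow z l * sinIntegral l (R * |z|))) =
          z * ∫ y, boxKernel l R z y := fun z => by rw [integral_boxKernel l hR]
      simp_rw [← hz, hm]
      exact measurable_id.aestronglyMeasurable.mul
        (measurable_boxKernel l R).stronglyMeasurable.integral_prod_right'.aestronglyMeasurable
    · filter_upwards [eventually_ge_atTop 0] with R hR
      refine ae_of_all _ fun z => ?_
      rw [norm_mul, norm_mul, Real.norm_of_nonneg (by positivity : 0 ≤ |z| ^ (l + 1)),
        Real.norm_ofNat, Real.norm_eq_abs]
      have := hB (R * |z|) (by positivity)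
      gcongr
    · exact ((integrable_abs_rpow (by linarith)).mul_const B).const_mul 2
    · refine ae_of_all _ fun z => ?_
      rcases eq_or_ne z 0 with h0 | h0
      · subst h0; simp [Real.zero_rpow (by linarith : l + 1 ≠ 0)]
      · have : Tendsto (fun R : ℝ => R * |z|) atTop atTop :=
          tendsto_id.atTop_mul_const (abs_pos.2 h0)
        exact (((tendsto_sinIntegral hl).comp this).const_mul _).const_mul _
  have hlim2 := (tendsto_integral_rpow_mul_exp hl).const_mul 2
  have h := tendsto_nhds_unique hlim (hlim2.congr' (by
    filter_upwards [eventually_ge_atTop 0] with R hR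
    rw [integral_boxKernel_average hl hR]))
  rw [integral_const_mul, integral_mul_const] at h
  change 2 * (absMoment (l + 1) * sinConst l) = _ at h
  rw [absMoment_eq (by linarith), show (l + 1) / 2 = l + (1 - l) / 2 by ring,
    Real.rpow_add two_pos, show (l + 1 + 1) / 2 = 1 + l / 2 by ring,
    show (1 - l) / 2 = 1 / 2 - l / 2 by ring] at h
  have h2 : (0 : ℝ) < 2 ^ (1 / 2 - l / 2) := by positivity
  have h3 : (2 : ℝ) ^ (1 / 2 - l / 2) * (2 * sinConst l * (2 ^ l / √Real.pi *
      Real.Gamma (1 + l / 2))) = 2 ^ (1 / 2 - l / 2) * Real.Gamma (1 / 2 - l / 2) := by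
    linear_combination h
  exact mul_left_cancel₀ h2.ne' h3

/-! ### The value of the multiple integral -/

/-- The product of the signed powers with exponents `p i`. -/
def prodSignedPow {n : ℕ} (p y : Fin n → ℝ) : ℝ := ∏ i, signedPow (y i) (p i)

/-- The Gaussian average of `prodSin`. -/
def sinAverage {n : ℕ} (lam y : Fin n → ℝ) (k : ℕ) : ℝ := ∫ z, z ^ k * prodSin lam y z ∂stdGauss

theorem norm_gaussFourier_prodSin_zero {n : ℕ} (lam y : Fin n → ℝ) (k : ℕ) :
    ‖gaussFourier (prodSin lam y) k 0‖ = |sinAverage lam y k| := by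
  rw [gaussFourier_zero, Complex.norm_real]; rfl

theorem measurable_prodSignedPow {n : ℕ} (p : Fin n → ℝ) : Measurable (prodSignedPow p) :=
  Finset.measurable_prod _ fun i _ => (measurable_signedPow _).comp (measurable_pi_apply i)

theorem continuous_prodSin {n : ℕ} (lam : Fin n → ℝ) :
    Continuous fun p : (Fin n → ℝ) × ℝ => prodSin lam p.1 p.2 :=
  continuous_finsetProd _ fun i _ => (continuous_sinKernel _).comp (by fun_prop)

theorem measurable_sinAverage {n : ℕ} (lam : Fin n → ℝ) (k : ℕ) :
    Measurable fun y => sinAverage lam y k := by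
  have h : Continuous fun p : (Fin n → ℝ) × ℝ => p.2 ^ k * prodSin lam p.1 p.2 :=
    (continuous_snd.pow k).mul (continuous_prodSin lam)
  exact (h.stronglyMeasurable.integral_prod_right').measurable

theorem abs_prodSignedPow_le {n : ℕ} (p y : Fin n → ℝ) :
    |prodSignedPow p y| ≤ ∏ i, |y i| ^ p i := by
  rw [prodSignedPow, Finset.abs_prod]
  exact Finset.prod_le_prod (fun i _ => abs_nonneg _) fun i _ => abs_signedPow_le _ _

theorem integrable_prod_rpow_mul_sinAverage {n : ℕ} {lam : Fin n → ℝ}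
    (hlam : ∀ i, ValidExp (lam i)) (k : ℕ) :
    Integrable fun y : Fin n → ℝ => (∏ i, |y i| ^ (-lam i - 1)) * |sinAverage lam y k| := by
  simpa only [norm_gaussFourier_prodSin_zero] using integrable_prod_rpow_mul_gaussFourier hlam k

theorem integrable_prodSignedPow_mul_sinAverage {n : ℕ} {lam : Fin n → ℝ}
    (hlam : ∀ i, ValidExp (lam i)) (k : ℕ) :
    Integrable fun y : Fin n → ℝ =>
      prodSignedPow (fun i => -lam i - 1) y * sinAverage lam y k := by
  refine (integrable_prod_rpow_mul_sinAverage hlam k).mono'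
    ((measurable_prodSignedPow _).mul (measurable_sinAverage lam k)).aestronglyMeasurable
    (ae_of_all _ fun y => ?_)
  rw [norm_mul]
  exact mul_le_mul_of_nonneg_right (abs_prodSignedPow_le _ y) (abs_nonneg _)

theorem prod_boxKernel {n : ℕ} (lam y : Fin n → ℝ) (R z : ℝ) :
    ∏ i, boxKernel (lam i) R z (y i) =
      if ∀ i, |y i| ≤ R then prodSignedPow (fun i => -lam i - 1) y * prodSin lam y z else 0 := by
  split_ifs with h
  · rw [prodSignedPow, prodSin, ← Finset.prod_mul_distrib]
    exact Finset.prod_congr rfl fun i _ => by simp [boxKernel, h i]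
  · push Not at h
    obtain ⟨i, hi⟩ := h
    exact Finset.prod_eq_zero (Finset.mem_univ i) (by simp [boxKernel, not_le.2 hi])

/-- On a bounded box Fubini in (z, y) is legitimate, since each kernel is dominated by an integrable
function of y_i times 1 + z². On the whole space the joint integrand need not be absolutely
integrable. -/
theorem integral_box_eq {n : ℕ} {lam : Fin n → ℝ} (hlam : ∀ i, ValidExp (lam i)) {R : ℝ}
    (hR : 0 ≤ R) :
    ∫ y : Fin n → ℝ, (if ∀ i, |y i| ≤ R then
      prodSignedPow (fun i => -lam i - 1) y * sinAverage lam y 0 else 0) =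
    ∫ z, ∏ i, (2 * (signedPow z (lam i) * sinIntegral (lam i) (R * |z|))) ∂stdGauss := by
  have h1 : Integrable (fun z : ℝ => (1 + z ^ 2) ^ n) stdGauss := by
    have hp : ∀ p : Polynomial ℝ, Integrable (fun z : ℝ => p.eval z) stdGauss := fun p => by
      simp only [Polynomial.eval_eq_sum_range]
      refine integrable_finsetSum _ fun k _ => Integrable.const_mul ?_ _
      refine (hasAllMoments_one.2 k).mono' (by fun_prop) (ae_of_all _ fun z => ?_)
      simp
    refine (hp ((1 + Polynomial.X ^ 2) ^ n)).congr (ae_of_all _ fun z => ?_)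
    simp [Polynomial.eval_pow]
  have hmeas : Measurable fun p : ℝ × (Fin n → ℝ) => ∏ i, boxKernel (lam i) R p.1 (p.2 i) :=
    Finset.measurable_prod _ fun i _ => (measurable_boxKernel (lam i) R).comp
      (measurable_fst.prodMk ((measurable_pi_apply i).comp measurable_snd))
  have hint : Integrable (fun p : ℝ × (Fin n → ℝ) => ∏ i, boxKernel (lam i) R p.1 (p.2 i))
      (stdGauss.prod volume) := by
    have h2 : Integrable fun y : Fin n → ℝ => ∏ i, boxWeight (lam i) R (y i) :=
      Integrable.fintype_prod (f := fun i => boxWeight (lam i) R) fun i =>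
        integrable_boxWeight (hlam i) R
    refine (h1.mul_prod h2).mono' hmeas.aestronglyMeasurable (ae_of_all _ fun p => ?_)
    rw [Real.norm_eq_abs, Finset.abs_prod]
    calc _ ≤ ∏ i, (boxWeight (lam i) R (p.2 i) * (1 + p.1 ^ 2)) :=
          Finset.prod_le_prod (fun i _ => abs_nonneg _) fun i _ => abs_boxKernel_le _ _ _ _
      _ = _ := by
          rw [Finset.prod_mul_distrib, Finset.prod_const, Finset.card_univ, Fintype.card_fin,
            mul_comm]
  have hswap := integral_integral_swap
    (f := fun z (y : Fin n → ℝ) => ∏ i, boxKernel (lam i) R z (y i)) hint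
  have e1 : ∀ z, ∫ y : Fin n → ℝ, ∏ i, boxKernel (lam i) R z (y i) =
      ∏ i, (2 * (signedPow z (lam i) * sinIntegral (lam i) (R * |z|))) := fun z => by
    rw [integral_fintype_prod_volume_eq_prod (fun i => boxKernel (lam i) R z)]
    exact Finset.prod_congr rfl fun i _ => integral_boxKernel _ hR z
  simp_rw [e1] at hswap
  rw [hswap]
  congr 1
  ext y
  simp_rw [prod_boxKernel]
  split_ifs
  · rw [integral_const_mul]
    simp [sinAverage]
  · simp

/-- Let the box grow in `integral_box_eq`: one side converges by absolute integrability after the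
Gaussian average, the other because the truncated sine integrals are uniformly bounded. -/
theorem integral_prodSignedPow_mul_sinAverage {n : ℕ} (hn : Even n) {lam : Fin n → ℝ}
    (hlam : ∀ i, ValidExp (lam i)) :
    ∫ y, prodSignedPow (fun i => -lam i - 1) y * sinAverage lam y 0 =
      absMoment (∑ i, lam i) * ∏ i, (2 * sinConst (lam i)) := by
  have hl0 : ∀ i, 0 ≤ lam i := fun i => by rcases hlam i with h | h <;> linarith [h.1]
  have hs0 : 0 ≤ ∑ i, lam i := Finset.sum_nonneg fun i _ => hl0 i
  have hlim1 : Tendsto (fun R : ℝ => ∫ y : Fin n → ℝ, (if ∀ i, |y i| ≤ R then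
      prodSignedPow (fun i => -lam i - 1) y * sinAverage lam y 0 else 0)) atTop
      (𝓝 (∫ y, prodSignedPow (fun i => -lam i - 1) y * sinAverage lam y 0)) := by
    refine tendsto_integral_filter_of_dominated_convergence
      (fun y => |prodSignedPow (fun i => -lam i - 1) y * sinAverage lam y 0|) ?_ ?_ ?_ ?_
    · refine Eventually.of_forall fun R => Measurable.aestronglyMeasurable ?_
      refine Measurable.ite ?_ ((measurable_prodSignedPow _).mul (measurable_sinAverage lam 0))
        measurable_const
      simp only [Set.ofPred_forall]
      exact MeasurableSet.iInter fun i =>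
        measurableSet_le (measurable_pi_apply i).norm measurable_const
    · refine Eventually.of_forall fun R => ae_of_all _ fun y => ?_
      split_ifs
      · exact le_rfl
      · rw [norm_zero]; exact abs_nonneg _
    · exact (integrable_prodSignedPow_mul_sinAverage hlam 0).abs
    · refine ae_of_all _ fun y => tendsto_const_nhds.congr' ?_
      have : ∀ i, ∀ᶠ R in atTop, |y i| ≤ R := fun i => eventually_ge_atTop _
      filter_upwards [eventually_all.2 this] with R hR
      rw [if_pos hR]
  choose B hB0 hB using fun i => exists_abs_sinIntegral_le (hlam i)
  have hlim2 : Tendsto (fun R : ℝ => ∫ z, ∏ i, (2 * (signedPow z (lam i) *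
      sinIntegral (lam i) (R * |z|))) ∂stdGauss) atTop
      (𝓝 (∫ z, |z| ^ (∑ i, lam i) * ∏ i, (2 * sinConst (lam i)) ∂stdGauss)) := by
    refine tendsto_integral_filter_of_dominated_convergence
      (fun z => |z| ^ (∑ i, lam i) * ∏ i, (2 * B i)) ?_ ?_ ?_ ?_
    · filter_upwards [eventually_ge_atTop 0] with R hR
      refine Measurable.aestronglyMeasurable (Finset.measurable_prod _ fun i _ => ?_)
      simp_rw [← integral_boxKernel _ hR]
      exact (measurable_boxKernel (lam i) R).stronglyMeasurable.integral_prod_right'.measurable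
    · filter_upwards [eventually_ge_atTop 0] with R hR
      refine ae_of_all _ fun z => ?_
      rw [Real.norm_eq_abs, Finset.abs_prod,
        Real.rpow_sum_of_nonneg (abs_nonneg z) (fun i _ => hl0 i), ← Finset.prod_mul_distrib]
      refine Finset.prod_le_prod (fun i _ => abs_nonneg _) fun i _ => ?_
      rw [abs_mul, abs_mul, abs_two]
      have h1 := hB i (R * |z|) (by positivity)
      have h2 := abs_signedPow_le z (lam i)
      calc 2 * (|signedPow z (lam i)| * |sinIntegral (lam i) (R * |z|)|)
          ≤ 2 * (|z| ^ lam i * B i) := by gcongr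
        _ = _ := by ring
    · exact (integrable_abs_rpow (by linarith)).mul_const _
    · have h0 : ∀ᵐ z ∂stdGauss, z ≠ 0 := by
        have : NullSingletonClass stdGauss :=
          ProbabilityTheory.nullSingletonClass_gaussianReal one_ne_zero
        simp [ae_iff]
      filter_upwards [h0] with z hz
      have hz' := abs_pos.2 hz
      have e : |z| ^ (∑ i, lam i) * ∏ i, (2 * sinConst (lam i)) =
          ∏ i, (2 * (signedPow z (lam i) * sinConst (lam i))) := by
        -- Evenness of n enters here: the signs of z cancel and the signed powers combine to a power
        -- of |z|.
        have hsign : ∏ _i : Fin n, z.sign = 1 := by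
          rw [Finset.prod_const, Finset.card_univ, Fintype.card_fin]
          rcases lt_or_gt_of_ne hz with h | h
          · rw [Real.sign_of_neg h, hn.neg_one_pow]
          · rw [Real.sign_of_pos h, one_pow]
        rw [Real.rpow_sum_of_nonneg (abs_nonneg z) (fun i _ => hl0 i),
          ← mul_one (∏ i, |z| ^ lam i), ← hsign, ← Finset.prod_mul_distrib,
          ← Finset.prod_mul_distrib]
        refine Finset.prod_congr rfl fun i _ => ?_
        rw [signedPow]; ring
      rw [e]
      have : Tendsto (fun R : ℝ => R * |z|) atTop atTop := tendsto_id.atTop_mul_const hz'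
      exact tendsto_finsetProd _ fun i _ =>
        (((tendsto_sinIntegral (hlam i)).comp this).const_mul _).const_mul _
  have h := tendsto_nhds_unique hlim1 (hlim2.congr' (by
    filter_upwards [eventually_ge_atTop 0] with R hR
    rw [integral_box_eq hlam hR]))
  rw [h, integral_mul_const]
  rfl

end

section

/-! ### Diagonal substitutions -/

theorem map_diagonal_volume {n : ℕ} {x : Fin n → ℝ} (hx : ∀ i, x i ≠ 0) :
    (volume : Measure (Fin n → ℝ)).map (fun u => u * x) =
      ENNReal.ofReal |(∏ i, x i)⁻¹| • volume := by
  have h := Real.map_matrix_volume_pi_eq_smul_volume_pi (M := Matrix.diagonal x)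
    (by rw [Matrix.det_diagonal]; exact Finset.prod_ne_zero_iff.2 fun i _ => hx i)
  rw [Matrix.det_diagonal] at h
  rw [← h]
  congr 1
  ext u i
  simp [Matrix.mulVec_diagonal, mul_comm]

theorem measurable_mul_right_pi {n : ℕ} (x : Fin n → ℝ) :
    Measurable fun u : Fin n → ℝ => u * x := by fun_prop

theorem integral_comp_diagonal {n : ℕ} {x : Fin n → ℝ} (hx : ∀ i, x i ≠ 0)
    {f : (Fin n → ℝ) → ℝ} (hf : Measurable f) :
    ∫ u, f (u * x) = |(∏ i, x i)⁻¹| * ∫ y, f y := by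
  rw [← integral_map (measurable_mul_right_pi x).aemeasurable hf.aestronglyMeasurable,
    map_diagonal_volume hx, integral_smul_measure, ENNReal.toReal_ofReal (abs_nonneg _),
    smul_eq_mul]

theorem integrable_comp_diagonal {n : ℕ} {x : Fin n → ℝ} (hx : ∀ i, x i ≠ 0)
    {f : (Fin n → ℝ) → ℝ} (hf : Integrable f) : Integrable fun u => f (u * x) := by
  have h : Integrable f ((volume : Measure (Fin n → ℝ)).map (fun u => u * x)) := by
    rw [map_diagonal_volume hx]
    exact hf.smul_measure ENNReal.ofReal_ne_top
  exact h.comp_measurable (measurable_mul_right_pi x)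

theorem signedPow_ne_zero {t : ℝ} (ht : t ≠ 0) (p : ℝ) : signedPow t p ≠ 0 := by
  refine mul_ne_zero (Real.rpow_pos_of_pos (abs_pos.2 ht) _).ne' ?_
  rwa [Ne, Real.sign_eq_zero_iff]

theorem prodSignedPow_mul {n : ℕ} (p x y : Fin n → ℝ) :
    prodSignedPow p (x * y) = prodSignedPow p x * prodSignedPow p y := by
  simp only [prodSignedPow, Pi.mul_apply, signedPow_mul, Finset.prod_mul_distrib]

/-- The exponent count of the substitution: the inverse of a power of degree -l - 1 times the
Jacobian |t|⁻¹ has degree l. -/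
theorem signedPow_inv_mul_inv {t : ℝ} (ht : t ≠ 0) (l : ℝ) :
    (signedPow t (-l - 1))⁻¹ * |t|⁻¹ = signedPow t l := by
  have h0 := abs_pos.2 ht
  rw [inv_mul_eq_iff_eq_mul₀ (signedPow_ne_zero ht _)]
  simp only [signedPow]
  have hs : t.sign * t.sign = 1 := by
    rcases lt_or_gt_of_ne ht with h | h
    · simp [Real.sign_of_neg h]
    · simp [Real.sign_of_pos h]
  have : |t| ^ (-l - 1) * |t| ^ l = |t|⁻¹ := by
    rw [← Real.rpow_add h0, ← Real.rpow_neg_one]; congr 1; ring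
  linear_combination -hs * (|t| ^ (-l - 1) * |t| ^ l) - this

theorem prodSignedPow_inv_mul_inv {n : ℕ} {x : Fin n → ℝ} (hx : ∀ i, x i ≠ 0) (lam : Fin n → ℝ) :
    (prodSignedPow (fun i => -lam i - 1) x)⁻¹ * |(∏ i, x i)⁻¹| = prodSignedPow lam x := by
  rw [abs_inv, Finset.abs_prod, prodSignedPow, prodSignedPow, ← Finset.prod_inv_distrib,
    ← Finset.prod_inv_distrib, ← Finset.prod_mul_distrib]
  exact Finset.prod_congr rfl fun i _ => signedPow_inv_mul_inv (hx i) _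

theorem prodSignedPow_eq_zero {n : ℕ} {x : Fin n → ℝ} (hx : ∃ i, x i = 0) (p : Fin n → ℝ) :
    prodSignedPow p x = 0 := by
  obtain ⟨i, hi⟩ := hx
  exact Finset.prod_eq_zero (Finset.mem_univ i) (by rw [hi, signedPow_zero_left])

/-- The effect of a diagonal substitution on an integral against a product of signed powers. -/
theorem integral_prodSignedPow_mul_comp {n : ℕ} {lam : Fin n → ℝ} {H : (Fin n → ℝ) → ℝ}
    (hH : Measurable H) (hH0 : ∀ y, (∃ i, y i = 0) → H y = 0)
    (hint : Integrable fun y => prodSignedPow (fun i => -lam i - 1) y * H y) (x : Fin n → ℝ) :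
    Integrable (fun u => prodSignedPow (fun i => -lam i - 1) u * H (u * x)) ∧
    ∫ u, prodSignedPow (fun i => -lam i - 1) u * H (u * x) =
      prodSignedPow lam x * ∫ y, prodSignedPow (fun i => -lam i - 1) y * H y ∧
    ∫ u, |prodSignedPow (fun i => -lam i - 1) u * H (u * x)| =
      |prodSignedPow lam x| * ∫ y, |prodSignedPow (fun i => -lam i - 1) y * H y| := by
  by_cases hx : ∃ i, x i = 0
  · have h0 : ∀ u, H (u * x) = 0 := fun u => hH0 _ (by
      obtain ⟨i, hi⟩ := hx; exact ⟨i, by simp [hi]⟩)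
    simp [h0, prodSignedPow_eq_zero hx]
  · push Not at hx
    set c := (prodSignedPow (fun i => -lam i - 1) x)⁻¹ with hc
    have hc0 : prodSignedPow (fun i => -lam i - 1) x ≠ 0 :=
      Finset.prod_ne_zero_iff.2 fun i _ => signedPow_ne_zero (hx i) _
    have e : ∀ u, prodSignedPow (fun i => -lam i - 1) u * H (u * x) =
        c * (fun y => prodSignedPow (fun i => -lam i - 1) y * H y) (u * x) := fun u => by
      simp only [prodSignedPow_mul, hc]
      field_simp
    have hm : Measurable fun y => prodSignedPow (fun i => -lam i - 1) y * H y :=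
      (measurable_prodSignedPow _).mul hH
    refine ⟨?_, ?_, ?_⟩
    · simp_rw [e]
      exact (integrable_comp_diagonal hx hint).const_mul c
    · simp_rw [e]
      rw [integral_const_mul, integral_comp_diagonal hx hm, ← mul_assoc,
        prodSignedPow_inv_mul_inv hx]
    · simp_rw [e, abs_mul c]
      rw [integral_const_mul, integral_comp_diagonal hx (f := fun y =>
        |prodSignedPow (fun i => -lam i - 1) y * H y|) hm.norm, ← mul_assoc,
        ← prodSignedPow_inv_mul_inv hx lam, abs_mul, abs_abs]

/-- By Tonelli with u first, the inner absolute integral is a constant times |ζ ∏ x_i^⟨λ_i⟩|, so a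
finite moment is all that is needed. The weight ζ is 1 for the main formula and a coordinate of ξ
for the linear term of an exponent above 1. -/
theorem integrable_prod_prodSignedPow_mul_comp {n : ℕ} {lam : Fin n → ℝ} {H : (Fin n → ℝ) → ℝ}
    (hH : Measurable H) (hH0 : ∀ y, (∃ i, y i = 0) → H y = 0)
    (hint : Integrable fun y => prodSignedPow (fun i => -lam i - 1) y * H y)
    {X : Type*} [MeasurableSpace X] {μ : Measure X} [SFinite μ] {x : X → Fin n → ℝ}
    (hx : Measurable x) {ζ : X → ℝ} (hζ : Measurable ζ)
    (hζx : Integrable (fun ω => ζ ω * prodSignedPow lam (x ω)) μ) :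
    Integrable (fun p : (Fin n → ℝ) × X =>
      prodSignedPow (fun i => -lam i - 1) p.1 * (ζ p.2 * H (p.1 * x p.2))) (volume.prod μ) := by
  have hm : Measurable fun p : (Fin n → ℝ) × X =>
      prodSignedPow (fun i => -lam i - 1) p.1 * (ζ p.2 * H (p.1 * x p.2)) :=
    ((measurable_prodSignedPow _).comp measurable_fst).mul ((hζ.comp measurable_snd).mul
      (hH.comp (measurable_fst.mul (hx.comp measurable_snd))))
  have e : ∀ u ω, prodSignedPow (fun i => -lam i - 1) u * (ζ ω * H (u * x ω)) =
      ζ ω * (prodSignedPow (fun i => -lam i - 1) u * H (u * x ω)) := fun u ω => by ring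
  rw [integrable_prod_iff' hm.aestronglyMeasurable]
  refine ⟨ae_of_all _ fun ω => ?_, ?_⟩
  · simp only [e]
    exact (integral_prodSignedPow_mul_comp hH hH0 hint (x ω)).1.const_mul _
  · have e2 : ∀ ω, ∫ u, ‖prodSignedPow (fun i => -lam i - 1) u * (ζ ω * H (u * x ω))‖ =
        |ζ ω * prodSignedPow lam (x ω)| *
          ∫ y, |prodSignedPow (fun i => -lam i - 1) y * H y| := fun ω => by
      simp only [e, Real.norm_eq_abs, abs_mul (ζ ω)]
      rw [integral_const_mul, (integral_prodSignedPow_mul_comp hH hH0 hint (x ω)).2.2]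
      ring
    simp only [e2]
    exact hζx.abs.mul_const _

theorem integrable_prodSignedPow_mul_average {n : ℕ} {lam : Fin n → ℝ} {H : (Fin n → ℝ) → ℝ}
    (hH : Measurable H) (hH0 : ∀ y, (∃ i, y i = 0) → H y = 0)
    (hint : Integrable fun y => prodSignedPow (fun i => -lam i - 1) y * H y)
    {X : Type*} [MeasurableSpace X] {μ : Measure X} [SFinite μ] {x : X → Fin n → ℝ}
    (hx : Measurable x) {ζ : X → ℝ} (hζ : Measurable ζ)
    (hζx : Integrable (fun ω => ζ ω * prodSignedPow lam (x ω)) μ) :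
    Integrable fun u => prodSignedPow (fun i => -lam i - 1) u * ∫ ω, ζ ω * H (u * x ω) ∂μ := by
  have h := (integrable_prod_prodSignedPow_mul_comp hH hH0 hint hx hζ hζx).integral_prod_left
  simpa only [integral_const_mul] using h

theorem integral_prodSignedPow_mul_average {n : ℕ} {lam : Fin n → ℝ} {H : (Fin n → ℝ) → ℝ}
    (hH : Measurable H) (hH0 : ∀ y, (∃ i, y i = 0) → H y = 0)
    (hint : Integrable fun y => prodSignedPow (fun i => -lam i - 1) y * H y)
    {X : Type*} [MeasurableSpace X] {μ : Measure X} [SFinite μ] {x : X → Fin n → ℝ}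
    (hx : Measurable x) {ζ : X → ℝ} (hζ : Measurable ζ)
    (hζx : Integrable (fun ω => ζ ω * prodSignedPow lam (x ω)) μ) :
    ∫ u, prodSignedPow (fun i => -lam i - 1) u * ∫ ω, ζ ω * H (u * x ω) ∂μ =
      (∫ ω, ζ ω * prodSignedPow lam (x ω) ∂μ) *
        ∫ y, prodSignedPow (fun i => -lam i - 1) y * H y := by
  have h := integral_integral_swap (f := fun u ω =>
    prodSignedPow (fun i => -lam i - 1) u * (ζ ω * H (u * x ω)))
    (integrable_prod_prodSignedPow_mul_comp hH hH0 hint hx hζ hζx)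
  simp only [integral_const_mul] at h
  rw [h, ← integral_mul_const]
  congr 1
  ext ω
  have e : ∀ u, prodSignedPow (fun i => -lam i - 1) u * (ζ ω * H (u * x ω)) =
      ζ ω * (prodSignedPow (fun i => -lam i - 1) u * H (u * x ω)) := fun u => by ring
  simp only [e]
  rw [integral_const_mul, (integral_prodSignedPow_mul_comp hH hH0 hint (x ω)).2.1]
  ring

theorem prodSin_eq_zero {n : ℕ} (lam : Fin n → ℝ) {y : Fin n → ℝ} (hy : ∃ i, y i = 0) (z : ℝ) :
    prodSin lam y z = 0 := by
  obtain ⟨i, hi⟩ := hy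
  exact Finset.prod_eq_zero (Finset.mem_univ i) (by rw [hi, zero_mul, sinKernel_zero])

theorem sinAverage_eq_zero {n : ℕ} (lam y : Fin n → ℝ) (k : ℕ) (hy : ∃ i, y i = 0) :
    sinAverage lam y k = 0 := by
  simp [sinAverage, prodSin_eq_zero lam hy]

end

/-! ### Stable laws: moments and nondegeneracy -/

section

/-- The law `μ` on Euclidean space has the characteristic function `exp (-N u ^ α)`, where `N` is
continuous, nonnegative, even and homogeneous of degree one. -/
structure IsStableLaw {d : ℕ} (α : ℝ) (μ : Measure (EuclideanSpace ℝ (Fin d)))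
    (N : EuclideanSpace ℝ (Fin d) → ℝ) : Prop where
  pos : 0 < α
  le_two : α ≤ 2
  continuous : Continuous N
  nonneg : ∀ u, 0 ≤ N u
  map_smul : ∀ (t : ℝ) u, N (t • u) = |t| * N u
  charFun_eq : ∀ u, charFun μ u = ((Real.exp (-(N u ^ α)) : ℝ) : ℂ)

variable {d : ℕ} {α : ℝ} {μ : Measure (EuclideanSpace ℝ (Fin d))} [IsProbabilityMeasure μ]
  {N : EuclideanSpace ℝ (Fin d) → ℝ}

theorem IsStableLaw.integral_cos (h : IsStableLaw α μ N) (u : EuclideanSpace ℝ (Fin d)) :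
    ∫ x, Real.cos (inner ℝ x u) ∂μ = Real.exp (-(N u ^ α)) := by
  have h1 := congrArg Complex.re (h.charFun_eq u)
  rw [charFun_apply, Complex.ofReal_re] at h1
  rw [← h1]
  have hint : Integrable (fun x => Complex.exp ((inner ℝ x u : ℝ) * Complex.I)) μ := by
    refine (integrable_const (1 : ℝ)).mono' (by fun_prop) (ae_of_all _ fun x => ?_)
    rw [Complex.norm_exp_ofReal_mul_I]
  have := integral_re (𝕜 := ℂ) hint
  simp only [RCLike.re_eq_complex_re] at this
  rw [← this]
  congr 1
  ext x
  rw [Complex.exp_ofReal_mul_I_re]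

theorem integrable_cos_inner (u : EuclideanSpace ℝ (Fin d)) :
    Integrable (fun x => Real.cos (inner ℝ x u)) μ :=
  (integrable_const (1 : ℝ)).mono' (by fun_prop) (ae_of_all _ fun x => Real.abs_cos_le_one _)

theorem IsStableLaw.integral_one_sub_cos (h : IsStableLaw α μ N)
    (u : EuclideanSpace ℝ (Fin d)) :
    ∫ x, (1 - Real.cos (inner ℝ x u)) ∂μ = 1 - Real.exp (-(N u ^ α)) := by
  rw [integral_sub (integrable_const _) (integrable_cos_inner u), h.integral_cos]
  simp

/-! ### Fractional moments -/

/-- Only r between 1/|s| and 2/|s| is kept. There 1 < |rs| < 2 < π, so 1 - cos(rs) ≥ 1 - cos 1, and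
the power of r is at least its value at the right end. -/
theorem lintegral_rpow_mul_one_sub_cos_ge {l : ℝ} (hl : 0 < l) (s : ℝ) :
    ENNReal.ofReal (2 ^ (-l - 1) * (1 - Real.cos 1) * |s| ^ l) ≤
      ∫⁻ r in Set.Ioi (0 : ℝ), ENNReal.ofReal (r ^ (-l - 1) * (1 - Real.cos (r * s))) := by
  rcases eq_or_ne s 0 with h0 | h0
  · subst h0; simp [Real.zero_rpow hl.ne']
  · have hs := abs_pos.2 h0
    have hc : 0 ≤ 1 - Real.cos 1 := sub_nonneg.2 (Real.cos_le_one 1)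
    have hsub : Set.Ioo (1 / |s|) (2 / |s|) ⊆ Set.Ioi 0 := fun r hr =>
      lt_trans (by positivity) hr.1
    calc ENNReal.ofReal (2 ^ (-l - 1) * (1 - Real.cos 1) * |s| ^ l)
        = ∫⁻ _r in Set.Ioo (1 / |s|) (2 / |s|),
            ENNReal.ofReal ((2 / |s|) ^ (-l - 1) * (1 - Real.cos 1)) := by
          rw [setLIntegral_const, Real.volume_Ioo, ← ENNReal.ofReal_mul (by positivity)]
          congr 1
          rw [Real.div_rpow two_pos.le hs.le, ← sub_div]
          have : |s| ^ (-l - 1) = (|s| ^ l)⁻¹ * |s|⁻¹ := by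
            rw [← Real.rpow_neg hs.le, ← Real.rpow_neg_one, ← Real.rpow_add hs]; rfl
          rw [this]
          have := Real.rpow_pos_of_pos hs l
          field_simp
          norm_num
      _ ≤ ∫⁻ r in Set.Ioo (1 / |s|) (2 / |s|),
            ENNReal.ofReal (r ^ (-l - 1) * (1 - Real.cos (r * s))) := by
          refine setLIntegral_mono' measurableSet_Ioo fun r hr => ENNReal.ofReal_le_ofReal ?_
          have hr0 : 0 < r := hsub hr
          have h1 : 1 < r * |s| := (div_lt_iff₀ hs).1 hr.1
          have h2 : r * |s| < 2 := (lt_div_iff₀ hs).1 hr.2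
          have hcos : Real.cos (r * s) ≤ Real.cos 1 := by
            rw [← Real.cos_abs (r * s), abs_mul, abs_of_pos hr0]
            exact Real.cos_le_cos_of_nonneg_of_le_pi zero_le_one
              (by linarith [Real.pi_gt_three]) h1.le
          refine mul_le_mul ?_ (by linarith) hc (by positivity)
          exact Real.rpow_le_rpow_of_nonpos hr0 hr.2.le (by linarith)
      _ ≤ _ := lintegral_mono_set hsub

/-- The moment is dominated by an integral of 1 - cos over scales r. After Tonelli the law enters
only through 1 - exp(-r^α N(u)^α), which is at most r^α N(u)^α near 0 and at most 1 at infinity; the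
condition l < α is convergence at 0. -/
theorem IsStableLaw.integrable_abs_inner_rpow (h : IsStableLaw α μ N) {l : ℝ} (hl : 0 < l)
    (hlα : l < α) (u : EuclideanSpace ℝ (Fin d)) :
    Integrable (fun x => |inner ℝ x u| ^ l) μ := by
  have hc : 0 < 2 ^ (-l - 1) * (1 - Real.cos 1) := by
    have := Real.cos_one_le
    have : 0 < 1 - Real.cos 1 := by linarith
    positivity
  have hN := h.nonneg u
  have hI : IntegrableOn (fun r : ℝ => r ^ (-l - 1) * (1 - Real.exp (-(N (r • u) ^ α))))
      (Set.Ioi 0) := by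
    have hexp : ∀ r : ℝ, 0 ≤ 1 - Real.exp (-(N (r • u) ^ α)) := fun r =>
      sub_nonneg.2 (Real.exp_le_one_iff.2 (neg_nonpos.2 (Real.rpow_nonneg (h.nonneg _) _)))
    refine integrableOn_Ioi_of_abs_le_rpow (a := α - l - 1) (b := -l - 1) (C := max 1 (N u ^ α))
      (Measurable.aestronglyMeasurable ?_) (by linarith) (by linarith) (fun r h0 _ => ?_)
      fun r hr => ?_
    · have : Continuous fun r : ℝ => N (r • u) := h.continuous.comp (by fun_prop)
      exact (measurable_id.pow_const _).mul (measurable_const.sub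
        (this.measurable.pow_const α).neg.exp)
    · rw [abs_mul, abs_of_nonneg (by positivity : 0 ≤ r ^ (-l - 1)), abs_of_nonneg (hexp r),
        h.map_smul, abs_of_pos h0, Real.mul_rpow h0.le hN]
      have h1 := Real.add_one_le_exp (-(r ^ α * N u ^ α))
      calc _ ≤ r ^ (-l - 1) * (r ^ α * N u ^ α) := by gcongr; linarith
        _ = N u ^ α * r ^ (α - l - 1) := by
            rw [← mul_assoc, ← Real.rpow_add h0, mul_comm]; congr 2; ring
        _ ≤ _ := by gcongr; exact le_max_right _ _
    · have hr0 : 0 < r := one_pos.trans hr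
      rw [abs_mul, abs_of_nonneg (by positivity : 0 ≤ r ^ (-l - 1)), abs_of_nonneg (hexp r),
        mul_comm]
      gcongr
      exact le_max_of_le_left (by linarith [Real.exp_pos (-(N (r • u) ^ α))])
  have hm : AEStronglyMeasurable (fun x : EuclideanSpace ℝ (Fin d) => |inner ℝ x u| ^ l) μ := by
    have : Measurable fun x : EuclideanSpace ℝ (Fin d) => |(inner ℝ x u : ℝ)| :=
      (by fun_prop : Continuous fun x : EuclideanSpace ℝ (Fin d) => |(inner ℝ x u : ℝ)|).measurable
    exact (this.pow_const l).aestronglyMeasurable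
  have key : Integrable (fun x => 2 ^ (-l - 1) * (1 - Real.cos 1) * |inner ℝ x u| ^ l) μ := by
    refine ⟨hm.const_mul _, ?_⟩
    rw [hasFiniteIntegral_iff_ofReal (ae_of_all _ fun x => by positivity)]
    calc _ ≤ ∫⁻ x, (∫⁻ r in Set.Ioi (0 : ℝ),
          ENNReal.ofReal (r ^ (-l - 1) * (1 - Real.cos (r * inner ℝ x u)))) ∂μ :=
          lintegral_mono fun x => lintegral_rpow_mul_one_sub_cos_ge hl _
      _ = ∫⁻ r in Set.Ioi (0 : ℝ), ∫⁻ x,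
          ENNReal.ofReal (r ^ (-l - 1) * (1 - Real.cos (r * inner ℝ x u))) ∂μ := by
          rw [lintegral_lintegral_swap]
          refine (ENNReal.measurable_ofReal.comp ?_).aemeasurable
          refine (measurable_snd.pow_const _).mul (measurable_const.sub
            (Continuous.measurable ?_))
          fun_prop
      _ = ∫⁻ r in Set.Ioi (0 : ℝ),
          ENNReal.ofReal (r ^ (-l - 1) * (1 - Real.exp (-(N (r • u) ^ α)))) := by
          refine setLIntegral_congr_fun measurableSet_Ioi fun r hr => ?_
          have hr : (0 : ℝ) < r := hr
          rw [← h.integral_one_sub_cos, ← integral_const_mul, ofReal_integral_eq_lintegral_ofReal]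
          · simp only [inner_smul_right]
          · exact ((integrable_const _).sub (integrable_cos_inner _)).const_mul _
          · exact ae_of_all _ fun x => mul_nonneg (by positivity)
              (sub_nonneg.2 (Real.cos_le_one _))
      _ < ⊤ := hI.lintegral_lt_top
  exact (integrable_const_mul_iff hc.ne'.isUnit _).1 key

/-- The product is at most the largest |x_i| raised to the total exponent, hence at most the sum of
these powers. -/
theorem IsStableLaw.integrable_prod_abs_rpow (h : IsStableLaw α μ N) {p : Fin d → ℝ}
    (hp : ∀ i, 0 ≤ p i) (hpα : ∑ i, p i < α) :
    Integrable (fun x => ∏ i, |x i| ^ p i) μ := by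
  have hs : 0 ≤ ∑ i, p i := Finset.sum_nonneg fun i _ => hp i
  have hone : ∀ i, Integrable (fun x : EuclideanSpace ℝ (Fin d) => |x i| ^ ∑ i, p i) μ := by
    intro i
    rcases hs.eq_or_lt with h0 | h0
    · rw [← h0]; simp
    · have := h.integrable_abs_inner_rpow h0 hpα (EuclideanSpace.single i 1)
      simpa [EuclideanSpace.inner_single_right] using this
  have hm : AEStronglyMeasurable (fun x : EuclideanSpace ℝ (Fin d) => ∏ i, |x i| ^ p i) μ := by
    refine (Finset.measurable_prod _ fun i _ => ?_).aestronglyMeasurable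
    have : Measurable fun x : EuclideanSpace ℝ (Fin d) => |x i| :=
      (by fun_prop : Continuous fun x : EuclideanSpace ℝ (Fin d) => |x i|).measurable
    exact this.pow_const _
  refine ((integrable_const (1 : ℝ)).add (integrable_finsetSum Finset.univ
    fun i _ => hone i)).mono' hm (ae_of_all _ fun x => ?_)
  have hsum : ∀ i, 0 ≤ |x i| ^ ∑ i, p i := fun i => by positivity
  rw [Real.norm_of_nonneg (Finset.prod_nonneg fun i _ => by positivity)]
  simp only [Pi.add_apply]
  rcases isEmpty_or_nonempty (Fin d) with he | he
  · simp
  · obtain ⟨i, -, hi⟩ := Finset.univ.exists_max_image (fun i => |x i|) Finset.univ_nonempty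
    calc ∏ k, |x k| ^ p k ≤ ∏ k, |x i| ^ p k :=
          Finset.prod_le_prod (fun k _ => by positivity) fun k _ =>
            Real.rpow_le_rpow (abs_nonneg _) (hi k (Finset.mem_univ k)) (hp k)
      _ = |x i| ^ ∑ k, p k := (Real.rpow_sum_of_nonneg (abs_nonneg _) fun k _ => hp k).symm
      _ ≤ ∑ i, |x i| ^ ∑ k, p k :=
          Finset.single_le_sum (f := fun i => |x i| ^ ∑ k, p k) (fun i _ => hsum i)
            (Finset.mem_univ i)
      _ ≤ _ := by linarith

/-! ### A lower bound for the norm -/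

/-- If every truncated second moment vanished, each coordinate would vanish almost surely on every
ball. -/
theorem exists_pos_integral_sq (h0 : ¬ ∀ᵐ x ∂μ, x = 0) :
    ∃ (K : ℝ) (i : Fin d), 0 < K ∧ 0 < ∫ x in Metric.closedBall 0 K, x i ^ 2 ∂μ := by
  by_contra hcon
  push Not at hcon
  apply h0
  have hz : ∀ (n : ℕ) (i : Fin d), ∀ᵐ x ∂μ,
      x ∈ Metric.closedBall (0 : EuclideanSpace ℝ (Fin d)) ((n : ℝ) + 1) → x i = 0 := by
    intro n i
    have hle := hcon ((n : ℝ) + 1) i (by positivity)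
    have hint : IntegrableOn (fun x : EuclideanSpace ℝ (Fin d) => x i ^ 2)
        (Metric.closedBall 0 ((n : ℝ) + 1)) μ :=
      ContinuousOn.integrableOn_compact (isCompact_closedBall _ _) (by fun_prop)
    have hz : ∫ x in Metric.closedBall (0 : EuclideanSpace ℝ (Fin d)) ((n : ℝ) + 1),
        x i ^ 2 ∂μ = 0 := le_antisymm hle (integral_nonneg fun x => sq_nonneg _)
    rw [integral_eq_zero_iff_of_nonneg (fun x => sq_nonneg _) hint] at hz
    have := (ae_restrict_iff' Metric.isClosed_closedBall.measurableSet).1 hz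
    filter_upwards [this] with x hx hmem
    exact pow_eq_zero_iff two_ne_zero |>.1 (hx hmem)
  have hz2 : ∀ᵐ x ∂μ, ∀ (n : ℕ) (i : Fin d),
      x ∈ Metric.closedBall (0 : EuclideanSpace ℝ (Fin d)) ((n : ℝ) + 1) → x i = 0 :=
    ae_all_iff.2 fun n => ae_all_iff.2 fun i => hz n i
  filter_upwards [hz2] with x hx
  obtain ⟨n, hn⟩ := exists_nat_ge ‖x‖
  ext i
  exact hx n i (by rw [mem_closedBall_zero_iff]; linarith)

/-- Near the origin N^α dominates 1 - exp(-N^α), that is E(1 - cos⟨x,u⟩), and hence a truncated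
second moment of ⟨x,u⟩; homogeneity extends the bound to all u. A single linear form is the most one
can ask for when the law is not full-dimensional. -/
theorem IsStableLaw.exists_lower_bound (h : IsStableLaw α μ N) (h0 : ¬ ∀ᵐ x ∂μ, x = 0) :
    ∃ (i : Fin d) (c : Fin d → ℝ) (C : ℝ), c i ≠ 0 ∧ 0 < C ∧
      ∀ u, u ≠ 0 → C * ‖u‖ ^ (α - 2) * (∑ k, c k * u k) ^ 2 ≤ N u ^ α := by
  obtain ⟨K, i, hK, hA⟩ := exists_pos_integral_sq h0
  set B := Metric.closedBall (0 : EuclideanSpace ℝ (Fin d)) K with hB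
  set A := ∫ x in B, x i ^ 2 ∂μ with hAdef
  -- The form ∑ c_k u_k is the truncated covariance of ⟨x,u⟩ with x_i, so its i-th coefficient is
  -- the positive number `A`.
  set c : Fin d → ℝ := fun k => ∫ x in B, x k * x i ∂μ with hc
  have hcont : ∀ f : EuclideanSpace ℝ (Fin d) → ℝ, Continuous f → IntegrableOn f B μ :=
    fun f hf => ContinuousOn.integrableOn_compact (isCompact_closedBall _ _) hf.continuousOn
  have hci : c i = A := by simp only [hc, hAdef, sq]
  have hpi := Real.pi_pos
  have hsmall : ∀ u : EuclideanSpace ℝ (Fin d), ‖u‖ ≤ 1 / K →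
      2 / Real.pi ^ 2 / A * (∑ k, c k * u k) ^ 2 ≤ N u ^ α := by
    intro u hu
    set S := ∑ k, c k * u k with hS
    have hSint : S = ∫ x in B, inner ℝ x u * x i ∂μ := by
      simp only [PiLp.inner_apply, RCLike.inner_apply, conj_trivial, Finset.sum_mul]
      rw [integral_finsetSum _ fun k _ => (hcont _ (by fun_prop))]
      refine Finset.sum_congr rfl fun k _ => ?_
      rw [mul_comm, ← integral_const_mul]
      congr 1; ext x; ring
    -- Cauchy–Schwarz, by expanding a square with the optimal coefficient S / A.
    have hQ : S ^ 2 / A ≤ ∫ x in B, (inner ℝ x u) ^ 2 ∂μ := by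
      have hsq : 0 ≤ ∫ x in B, (inner ℝ x u - S / A * x i) ^ 2 ∂μ :=
        integral_nonneg fun x => sq_nonneg _
      have e : ∫ x in B, (inner ℝ x u - S / A * x i) ^ 2 ∂μ =
          (∫ x in B, (inner ℝ x u) ^ 2 ∂μ) - 2 * (S / A) * S + (S / A) ^ 2 * A := by
        have : ∀ x : EuclideanSpace ℝ (Fin d), (inner ℝ x u - S / A * x i) ^ 2 =
            (inner ℝ x u) ^ 2 - 2 * (S / A) * (inner ℝ x u * x i) + (S / A) ^ 2 * x i ^ 2 :=
          fun x => by ring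
        simp_rw [this]
        rw [integral_add, integral_sub, integral_const_mul, integral_const_mul, ← hSint]
        · exact hcont _ (by fun_prop)
        · exact hcont _ (by fun_prop)
        · exact hcont _ (by fun_prop)
        · exact hcont _ (by fun_prop)
      rw [e] at hsq
      have : (S / A) ^ 2 * A = S ^ 2 / A := by field_simp
      have : 2 * (S / A) * S = 2 * (S ^ 2 / A) := by field_simp
      linarith
    have h1 : 2 / Real.pi ^ 2 * ∫ x in B, (inner ℝ x u) ^ 2 ∂μ ≤
        ∫ x, (1 - Real.cos (inner ℝ x u)) ∂μ := by
      rw [← integral_const_mul]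
      refine le_trans (setIntegral_mono_on (hcont _ (by fun_prop)) (hcont _ (by fun_prop))
        Metric.isClosed_closedBall.measurableSet fun x hx => ?_)
        (setIntegral_le_integral ((integrable_const _).sub (integrable_cos_inner u))
          (ae_of_all _ fun x => sub_nonneg.2 (Real.cos_le_one _)))
      have hx' : ‖x‖ ≤ K := mem_closedBall_zero_iff.1 hx
      have : |inner ℝ x u| ≤ Real.pi := by
        calc _ ≤ ‖x‖ * ‖u‖ := abs_real_inner_le_norm x u
          _ ≤ K * (1 / K) := by gcongr
          _ = 1 := by field_simp
          _ ≤ Real.pi := by linarith [Real.pi_gt_three]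
      have := Real.cos_le_one_sub_mul_cos_sq this
      linarith
    rw [h.integral_one_sub_cos] at h1
    have h2 := Real.add_one_le_exp (-(N u ^ α))
    calc _ = 2 / Real.pi ^ 2 * (S ^ 2 / A) := by ring
      _ ≤ 2 / Real.pi ^ 2 * ∫ x in B, (inner ℝ x u) ^ 2 ∂μ := by gcongr
      _ ≤ _ := by linarith
  refine ⟨i, c, 2 / Real.pi ^ 2 / A * K ^ (α - 2), by rw [hci]; exact hA.ne', by positivity,
    fun u hu => ?_⟩
  have hn : 0 < ‖u‖ := norm_pos_iff.2 hu
  -- The vector r⁻¹u has norm 1/K, the largest for which `hsmall` applies; undoing the scaling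
  -- produces the power ‖u‖^(α-2).
  set r := ‖u‖ * K with hr
  have hr0 : 0 < r := by positivity
  have h1 := hsmall (r⁻¹ • u) (by
    rw [norm_smul, norm_inv, Real.norm_of_nonneg hr0.le, hr]
    apply le_of_eq; field_simp)
  have h2 : ∑ k, c k * (r⁻¹ • u) k = r⁻¹ * ∑ k, c k * u k := by
    rw [Finset.mul_sum]
    refine Finset.sum_congr rfl fun k _ => ?_
    simp only [PiLp.smul_apply, smul_eq_mul]; ring
  rw [h2, h.map_smul, abs_of_pos (inv_pos.2 hr0), Real.mul_rpow (by positivity) (h.nonneg u),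
    Real.inv_rpow hr0.le] at h1
  have h3 : r ^ α * (2 / Real.pi ^ 2 / A * (r⁻¹ * ∑ k, c k * u k) ^ 2) ≤ N u ^ α := by
    calc _ ≤ r ^ α * ((r ^ α)⁻¹ * N u ^ α) := by gcongr
      _ = _ := by
        have := Real.rpow_pos_of_pos hr0 α
        field_simp
  refine le_trans (le_of_eq ?_) h3
  have e : r ^ α = ‖u‖ ^ (α - 2) * K ^ (α - 2) * r ^ 2 := by
    rw [← Real.mul_rpow hn.le hK.le, ← hr, ← Real.rpow_two, ← Real.rpow_add hr0]
    congr 1; ring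
  rw [e]
  field_simp

end

section

/-! ### An integrable majorant of the characteristic function -/

theorem rpow_mul_rpow_le_add {a X Y : ℝ} (ha : 0 < a) (hX : 1 ≤ X) (hY : 1 ≤ Y) :
    X ^ (-(1 / 2) : ℝ) * Y ^ (-(1 / 2 + a)) ≤ X ^ (-(1 + a)) + Y ^ (-(1 + a)) := by
  have hX0 : 0 < X := one_pos.trans_le hX
  have hY0 : 0 < Y := one_pos.trans_le hY
  rcases le_total X Y with h | h
  · calc _ ≤ X ^ (-(1 / 2) : ℝ) * X ^ (-(1 / 2 + a)) := by
          gcongr ?_ * ?_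
          exact Real.rpow_le_rpow_of_nonpos hX0 h (by linarith)
      _ = X ^ (-(1 + a)) := by rw [← Real.rpow_add hX0]; congr 1; ring
      _ ≤ _ := le_add_of_nonneg_right (by positivity)
  · calc _ ≤ Y ^ (-(1 / 2) : ℝ) * Y ^ (-(1 / 2 + a)) := by
          gcongr ?_ * ?_
          exact Real.rpow_le_rpow_of_nonpos hY0 h (by norm_num)
      _ = Y ^ (-(1 + a)) := by rw [← Real.rpow_add hY0]; congr 1; ring
      _ ≤ _ := le_add_of_nonneg_left (by positivity)

/-- An integrable function with the singularity `|s| ^ (-1/2)` at the origin. -/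
def halfSingular (a s : ℝ) : ℝ := if |s| ≤ 1 then |s| ^ (-(1 / 2) : ℝ) else |s| ^ (-(1 + a))

theorem measurable_halfSingular (a : ℝ) : Measurable (halfSingular a) :=
  Measurable.ite (measurableSet_le measurable_norm measurable_const)
    (measurable_norm.pow_const _) (measurable_norm.pow_const _)

theorem halfSingular_nonneg (a s : ℝ) : 0 ≤ halfSingular a s := by
  unfold halfSingular; split_ifs <;> positivity

theorem integrable_halfSingular {a : ℝ} (ha : 0 < a) : Integrable (halfSingular a) := by
  have h : Integrable fun s => halfSingular a |s| := by
    refine integrable_comp_abs (integrableOn_Ioi_of_abs_le_rpow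
      (measurable_halfSingular a).aestronglyMeasurable (a := -(1 / 2)) (b := -(1 + a)) (C := 1)
      (by norm_num) (by linarith) (fun t h0 ht => ?_) fun t ht => ?_)
    · rw [abs_of_nonneg (halfSingular_nonneg _ _), halfSingular, abs_of_pos h0, if_pos ht, one_mul]
    · rw [abs_of_nonneg (halfSingular_nonneg _ _), halfSingular,
        abs_of_pos (one_pos.trans ht), if_neg (not_le.2 ht), one_mul]
  have e : ∀ s, halfSingular a |s| = halfSingular a s := fun s => by simp [halfSingular]
  simpa only [e] using h

/-- Decouples the two variables: a product with exponents 1/2 and 1/2 + a is bounded by a sum of two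
terms, each integrable in its own variable. -/
theorem rpow_mul_rpow_le_halfSingular {a s Y : ℝ} (ha : 0 < a) (hY : 1 ≤ Y) :
    |s| ^ (-(1 / 2) : ℝ) * Y ^ (-(1 / 2 + a)) ≤ halfSingular a s + Y ^ (-(1 + a)) := by
  have hY0 : 0 < Y := one_pos.trans_le hY
  unfold halfSingular
  split_ifs with h
  · calc _ ≤ |s| ^ (-(1 / 2) : ℝ) * 1 := by
          gcongr
          exact Real.rpow_le_one_of_one_le_of_nonpos hY (by linarith)
      _ ≤ _ := by
          rw [mul_one]
          exact le_add_of_nonneg_right (by positivity)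
  · exact rpow_mul_rpow_le_add ha (not_le.1 h).le hY

/-- Of the decay n + 1/2 + a, the part n + a/2 is spent on the coordinates other than i. The rest,
1/2 + a/2, together with |∑ c_k y_k|^(-1/2), is integrable in y_i because c_i ≠ 0 makes the form an
affine coordinate there. -/
theorem integrable_one_add_norm_rpow_mul {n : ℕ} {i : Fin (n + 1)} {c : Fin (n + 1) → ℝ}
    (hc : c i ≠ 0) {a : ℝ} (ha : 0 < a) :
    Integrable fun y : Fin (n + 1) → ℝ =>
      (1 + ‖y‖) ^ (-(n + 1 / 2 + a)) * |∑ k, c k * y k| ^ (-(1 / 2) : ℝ) := by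
  have hmp := volume_preserving_piFinSuccAbove (fun _ : Fin (n + 1) => ℝ) i
  have hW : Integrable fun y : Fin n → ℝ => (1 + ‖y‖) ^ (-(n + a / 2)) :=
    integrable_one_add_norm (by simpa using half_pos ha)
  have hY : Integrable fun t : ℝ => (1 + |t|) ^ (-(1 + a / 2)) := by
    have := integrable_one_add_norm (E := ℝ) (μ := volume) (r := 1 + a / 2)
      (by simpa using half_pos ha)
    simpa using this
  have h1 := integrable_mul_comp_affine hW (measurable_halfSingular (a / 2))
    (integrable_halfSingular (half_pos ha)) (ℓ := fun y => ∑ k, c (i.succAbove k) * y k)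
    (by fun_prop) hc
  have h2 : Integrable fun p : ℝ × (Fin n → ℝ) =>
      (1 + ‖p.2‖) ^ (-(n + a / 2)) * (1 + |p.1|) ^ (-(1 + a / 2)) := by
    rw [Measure.volume_eq_prod]
    exact (hY.mul_prod hW).congr (ae_of_all _ fun p => mul_comm _ _)
  have key := hmp.integrable_comp_of_integrable (h1.add h2)
  refine key.mono' (Measurable.aestronglyMeasurable ?_) (ae_of_all _ fun y => ?_)
  · have m1 : Measurable fun y : Fin (n + 1) → ℝ => 1 + ‖y‖ := by fun_prop
    have m2 : Measurable fun y : Fin (n + 1) → ℝ => |∑ k, c k * y k| :=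
      (by fun_prop : Continuous fun y : Fin (n + 1) → ℝ => |∑ k, c k * y k|).measurable
    exact (m1.pow_const _).mul (m2.pow_const _)
  · rw [Real.norm_of_nonneg (by positivity)]
    simp only [Function.comp_apply, Pi.add_apply, MeasurableEquiv.piFinSuccAbove_apply,
      Fin.insertNthEquiv_symm_apply]
    have hs : ∑ k, c k * y k = c i * y i + ∑ k, c (i.succAbove k) * i.removeNth y k := by
      rw [Fin.sum_univ_succAbove _ i]; rfl
    rw [hs, ← mul_add]
    set s := c i * y i + ∑ k, c (i.succAbove k) * i.removeNth y k
    have n1 : ‖i.removeNth y‖ ≤ ‖y‖ :=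
      (pi_norm_le_iff_of_nonneg (norm_nonneg y)).2 fun k => norm_le_pi_norm y _
    have n2 : |y i| ≤ ‖y‖ := norm_le_pi_norm y i
    have hpos : 0 < 1 + ‖y‖ := by positivity
    have hY1 : 1 ≤ 1 + |y i| := by linarith [abs_nonneg (y i)]
    calc _ = (1 + ‖y‖) ^ (-(n + a / 2)) * ((1 + ‖y‖) ^ (-(1 / 2 + a / 2)) *
          |s| ^ (-(1 / 2) : ℝ)) := by
          rw [← mul_assoc, ← Real.rpow_add hpos]; congr 2; ring
      _ ≤ (1 + ‖i.removeNth y‖) ^ (-(n + a / 2)) * ((1 + |y i|) ^ (-(1 / 2 + a / 2)) *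
          |s| ^ (-(1 / 2) : ℝ)) := by
          gcongr ?_ * (?_ * _)
          · exact Real.rpow_le_rpow_of_nonpos (by positivity) (by linarith)
              (neg_nonpos.2 (by positivity))
          · exact Real.rpow_le_rpow_of_nonpos (by positivity) (by linarith) (by linarith)
      _ ≤ _ := by
          gcongr
          rw [mul_comm]
          exact rpow_mul_rpow_le_halfSingular (half_pos ha) hY1

/-- Applied to a multiple of the square of a linear form, the exponent 1/4 leaves the locally
integrable singularity of order 1/2, and in the Gaussian variable the integrable one of order α/4 ≤
1/2. -/
theorem exp_neg_le_rpow {s : ℝ} (hs : 0 < s) : Real.exp (-s) ≤ s ^ (-(1 / 4) : ℝ) := by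
  rw [Real.exp_neg, Real.rpow_neg hs.le]
  refine inv_anti₀ (by positivity) ?_
  rcases le_total s 1 with h | h
  · calc s ^ (1 / 4 : ℝ) ≤ 1 := Real.rpow_le_one hs.le h (by norm_num)
      _ ≤ Real.exp s := Real.one_le_exp hs.le
  · calc s ^ (1 / 4 : ℝ) ≤ s ^ (1 : ℝ) := Real.rpow_le_rpow_of_exponent_le h (by norm_num)
      _ ≤ Real.exp s := by rw [Real.rpow_one]; linarith [Real.add_one_le_exp s]

variable {d : ℕ} {α : ℝ} {μ : Measure (EuclideanSpace ℝ (Fin d))} [IsProbabilityMeasure μ]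
  {N : EuclideanSpace ℝ (Fin d) → ℝ}

theorem ae_sum_mul_ne_zero {i : Fin d} {c : Fin d → ℝ} (hc : c i ≠ 0) :
    ∀ᵐ u : EuclideanSpace ℝ (Fin d), ∑ k, c k * u k ≠ 0 := by
  set L : EuclideanSpace ℝ (Fin d) →ₗ[ℝ] ℝ :=
    { toFun := fun u => ∑ k, c k * u k
      map_add' := fun u v => by
        simp only [PiLp.add_apply, mul_add, Finset.sum_add_distrib]
      map_smul' := fun t u => by
        simp only [PiLp.smul_apply, smul_eq_mul, RingHom.id_apply, Finset.mul_sum]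
        exact Finset.sum_congr rfl fun k _ => by ring } with hL
  have hne : L.ker ≠ ⊤ := by
    intro htop
    have : EuclideanSpace.single i (1 : ℝ) ∈ L.ker := by rw [htop]; trivial
    rw [LinearMap.mem_ker] at this
    apply hc
    simpa [hL, PiLp.single_apply] using this
  have h0 := Measure.addHaar_submodule (volume : Measure (EuclideanSpace ℝ (Fin d))) L.ker hne
  rw [ae_iff]
  convert h0 using 2
  ext u
  simp [hL]

theorem norm_ofLp_le (u : EuclideanSpace ℝ (Fin d)) : ‖u.ofLp‖ ≤ ‖u‖ :=
  (pi_norm_le_iff_of_nonneg (norm_nonneg u)).2 fun k => PiLp.norm_apply_le u k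

/-- Insert the lower bound for N into `exp_neg_le_rpow`. The result separates z from u, and in u it
has enough decay against a kernel of degree -l - d although it decays in essentially one direction
only. -/
theorem IsStableLaw.exists_majorant (h : IsStableLaw α μ N) (h0 : ¬ ∀ᵐ x ∂μ, x = 0) :
    ∃ b : EuclideanSpace ℝ (Fin d) → ℝ, Measurable b ∧ (∀ u, 0 ≤ b u) ∧
      (∀ᵐ u, ∀ z : ℝ, z ≠ 0 → Real.exp (-(N (z • u) ^ α)) ≤ |z| ^ (-(α / 4)) * b u) ∧
      ∀ η, 0 < η → ∀ l : ℝ, 0 ≤ l →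
        IntegrableOn (fun u => ‖u‖ ^ (-l - d) * b u) {u | η < ‖u‖} := by
  obtain ⟨i, c, C, hci, hC, hlow⟩ := h.exists_lower_bound h0
  have hα := h.pos
  have hα2 := h.le_two
  obtain _ | n := d
  · exact i.elim0
  set S : EuclideanSpace ℝ (Fin (n + 1)) → ℝ := fun u => ∑ k, c k * u k with hS
  have hSc : Continuous S := by fun_prop
  set b : EuclideanSpace ℝ (Fin (n + 1)) → ℝ := fun u =>
    C ^ (-(1 / 4) : ℝ) * (‖u‖ ^ ((2 - α) / 4) * |S u| ^ (-(1 / 2) : ℝ)) with hb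
  have hbm : Measurable b :=
    ((measurable_norm.pow_const _).mul ((hSc.abs.measurable).pow_const _)).const_mul _
  refine ⟨b, hbm, fun u => by positivity, ?_, fun η hη l hl => ?_⟩
  · filter_upwards [ae_sum_mul_ne_zero hci] with u hu z hz
    have hu0 : u ≠ 0 := by rintro rfl; simp at hu
    have hn : 0 < ‖u‖ := norm_pos_iff.2 hu0
    have hz0 := abs_pos.2 hz
    have hS0 : 0 < |S u| := abs_pos.2 hu
    have h1 := hlow u hu0
    have hpos : 0 < C * ‖u‖ ^ (α - 2) * (S u) ^ 2 := by
      have := sq_pos_of_pos hS0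
      rw [sq_abs] at this
      positivity
    have h2 : 0 < N (z • u) ^ α := by
      rw [h.map_smul, Real.mul_rpow hz0.le (h.nonneg u)]
      exact mul_pos (by positivity) (hpos.trans_le h1)
    calc _ ≤ (N (z • u) ^ α) ^ (-(1 / 4) : ℝ) := exp_neg_le_rpow h2
      _ ≤ (|z| ^ α * (C * ‖u‖ ^ (α - 2) * (S u) ^ 2)) ^ (-(1 / 4) : ℝ) := by
          refine Real.rpow_le_rpow_of_nonpos (by positivity) ?_ (by norm_num)
          rw [h.map_smul, Real.mul_rpow hz0.le (h.nonneg u)]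
          gcongr
      _ = _ := by
          rw [Real.mul_rpow (by positivity) hpos.le, Real.mul_rpow (by positivity) (sq_nonneg _),
            Real.mul_rpow hC.le (by positivity), ← Real.rpow_mul hz0.le, ← Real.rpow_mul hn.le,
            ← sq_abs, ← Real.rpow_two, ← Real.rpow_mul hS0.le, hb,
            show α * -(1 / 4) = -(α / 4) by ring, show (α - 2) * -(1 / 4) = (2 - α) / 4 by ring,
            show (2 : ℝ) * -(1 / 4) = -(1 / 2) by norm_num]
          ring
  · have hint := (PiLp.volume_preserving_ofLp (Fin (n + 1))).integrable_comp_of_integrable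
      (integrable_one_add_norm_rpow_mul hci (a := α / 4) (by linarith))
    have hmeas : Measurable fun u : EuclideanSpace ℝ (Fin (n + 1)) =>
        ‖u‖ ^ (-l - ((n + 1 : ℕ) : ℝ)) * b u := (measurable_norm.pow_const _).mul hbm
    have hset : MeasurableSet {u : EuclideanSpace ℝ (Fin (n + 1)) | η < ‖u‖} :=
      measurableSet_lt measurable_const measurable_norm
    -- With d = n + 1 this is d - (2 - α)/4, the decay left after the growth of the majorant.
    set q : ℝ := n + 1 / 2 + α / 4 with hq
    have hq0 : 0 < q := by positivity
    refine (hint.integrableOn.const_mul (η ^ (-l) * C ^ (-(1 / 4) : ℝ) * (1 + 1 / η) ^ q)).mono'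
      hmeas.aestronglyMeasurable ((ae_restrict_iff' hset).2 (ae_of_all _ fun u hu => ?_))
    have hu : η < ‖u‖ := hu
    have hn : 0 < ‖u‖ := hη.trans hu
    have e1 : ‖u‖ ^ (-l - ((n + 1 : ℕ) : ℝ)) * b u =
        C ^ (-(1 / 4) : ℝ) * (‖u‖ ^ (-l) * ‖u‖ ^ (-q) * |S u| ^ (-(1 / 2) : ℝ)) := by
      have : ‖u‖ ^ (-l - ((n + 1 : ℕ) : ℝ)) * ‖u‖ ^ ((2 - α) / 4) = ‖u‖ ^ (-l) * ‖u‖ ^ (-q) := by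
        rw [← Real.rpow_add hn, ← Real.rpow_add hn]
        congr 1
        push_cast
        rw [hq]; ring
      rw [← this, hb]; ring
    have e2 : ‖u‖ ^ (-l) ≤ η ^ (-l) := Real.rpow_le_rpow_of_nonpos hη hu.le (by linarith)
    have e3 : ‖u‖ ^ (-q) ≤ (1 + 1 / η) ^ q * (1 + ‖u.ofLp‖) ^ (-q) := by
      have k1 : (1 + ‖u.ofLp‖) ≤ (1 + 1 / η) * ‖u‖ := by
        have := norm_ofLp_le u
        have : 1 ≤ 1 / η * ‖u‖ := by rw [one_div, inv_mul_eq_div, one_le_div hη]; exact hu.le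
        linarith
      have k2 := Real.rpow_le_rpow_of_nonpos (by positivity) k1 (neg_nonpos.2 hq0.le)
      rw [Real.mul_rpow (by positivity) hn.le] at k2
      calc _ = (1 + 1 / η) ^ q * ((1 + 1 / η) ^ (-q) * ‖u‖ ^ (-q)) := by
            rw [← mul_assoc, ← Real.rpow_add (by positivity)]; simp
        _ ≤ _ := by gcongr
    rw [Real.norm_of_nonneg (by positivity), e1]
    calc _ ≤ C ^ (-(1 / 4) : ℝ) * (η ^ (-l) * ((1 + 1 / η) ^ q * (1 + ‖u.ofLp‖) ^ (-q)) *
          |S u| ^ (-(1 / 2) : ℝ)) := by gcongr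
      _ = _ := by
          simp only [Function.comp_apply, hS, hq]
          ring

end

section

/-! ### Homogeneous kernels whose integrals over annuli vanish -/

/-- A measurable kernel, homogeneous of degree `-l - d`, whose integrals over annuli vanish. -/
structure IsAnnularKernel {d : ℕ} (l : ℝ) (h : EuclideanSpace ℝ (Fin d) → ℝ) : Prop where
  measurable : Measurable h
  nonneg : 0 ≤ l
  map_smul : ∀ r : ℝ, 0 < r → ∀ u, h (r • u) = r ^ (-l - d) * h u
  exists_bound : ∃ K, ∀ u, |h u| ≤ K * ‖u‖ ^ (-l - d)
  integral_annulus : ∀ a b : ℝ, 0 < a → ∫ u in {u | a < ‖u‖ ∧ ‖u‖ ≤ b}, h u = 0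

variable {d : ℕ} {α : ℝ} {μ : Measure (EuclideanSpace ℝ (Fin d))}
  {N : EuclideanSpace ℝ (Fin d) → ℝ} {l : ℝ} {h : EuclideanSpace ℝ (Fin d) → ℝ}

theorem IsStableLaw.measurable_exp (hN : IsStableLaw α μ N) :
    Measurable fun p : ℝ × EuclideanSpace ℝ (Fin d) => Real.exp (-(N (p.1 • p.2) ^ α)) := by
  have : Continuous fun p : ℝ × EuclideanSpace ℝ (Fin d) => N (p.1 • p.2) :=
    hN.continuous.comp (by fun_prop)
  exact (this.measurable.pow_const α).neg.exp

theorem IsStableLaw.measurableSet_le_one (hN : IsStableLaw α μ N) : MeasurableSet {u | N u ≤ 1} :=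
  measurableSet_le hN.continuous.measurable measurable_const

theorem IsStableLaw.integrableOn_gamma (hN : IsStableLaw α μ N) (hl : l < α) :
    IntegrableOn (fun s : ℝ => Real.exp (-s) * s ^ (-(l / α))) (Set.Ioi 0) := by
  have := Real.GammaIntegral_convergent (s := 1 - l / α)
    (by rw [sub_pos, div_lt_one hN.pos]; exact hl)
  simpa using this

variable [IsProbabilityMeasure μ]

theorem measurableSet_lt_norm (η : ℝ) :
    MeasurableSet {u : EuclideanSpace ℝ (Fin d) | η < ‖u‖} :=
  measurableSet_lt measurable_const measurable_norm

theorem ae_stdGauss_ne_zero : ∀ᵐ z ∂stdGauss, z ≠ (0 : ℝ) := by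
  have : NullSingletonClass (ProbabilityTheory.gaussianReal 0 1) :=
    ProbabilityTheory.nullSingletonClass_gaussianReal one_ne_zero
  exact Measure.ae_ne _ 0

theorem IsStableLaw.integrable_prod_mul_exp (hN : IsStableLaw α μ N) (h0 : ¬ ∀ᵐ x ∂μ, x = 0)
    (hh : IsAnnularKernel l h) {η : ℝ} (hη : 0 < η) :
    Integrable (fun p : ℝ × EuclideanSpace ℝ (Fin d) =>
      h p.2 * Real.exp (-(N (p.1 • p.2) ^ α))) (stdGauss.prod (volume.restrict {u | η < ‖u‖})) := by
  obtain ⟨b, hbm, hb0, hb, hbint⟩ := hN.exists_majorant h0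
  obtain ⟨K, hK⟩ := hh.exists_bound
  have i1 : Integrable (fun z : ℝ => |z| ^ (-(α / 4))) stdGauss :=
    integrable_abs_rpow (by linarith [hN.le_two])
  have i2 := ((hbint η hη l hh.nonneg).const_mul K)
  refine (i1.mul_prod i2).mono'
    ((hh.measurable.comp measurable_snd).mul hN.measurable_exp).aestronglyMeasurable ?_
  have a1 := Measure.quasiMeasurePreserving_fst (μ := stdGauss)
    (ν := volume.restrict {u : EuclideanSpace ℝ (Fin d) | η < ‖u‖}) |>.ae ae_stdGauss_ne_zero
  have a2 := Measure.quasiMeasurePreserving_snd (μ := stdGauss)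
    (ν := volume.restrict {u : EuclideanSpace ℝ (Fin d) | η < ‖u‖}) |>.ae (ae_restrict_of_ae hb)
  filter_upwards [a1, a2] with p hp1 hp2
  rw [norm_mul, Real.norm_of_nonneg (Real.exp_pos _).le]
  calc _ ≤ (K * ‖p.2‖ ^ (-l - d)) * (|p.1| ^ (-(α / 4)) * b p.2) :=
        mul_le_mul (hK _) (hp2 _ hp1) (Real.exp_pos _).le ((abs_nonneg _).trans (hK _))
    _ = _ := by ring

theorem IsStableLaw.integrableOn_mul_exp (hN : IsStableLaw α μ N) (h0 : ¬ ∀ᵐ x ∂μ, x = 0)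
    (hh : IsAnnularKernel l h) {η : ℝ} (hη : 0 < η) :
    IntegrableOn (fun u => h u * Real.exp (-(N u ^ α))) {u | η < ‖u‖} := by
  obtain ⟨b, hbm, hb0, hb, hbint⟩ := hN.exists_majorant h0
  obtain ⟨K, hK⟩ := hh.exists_bound
  refine ((hbint η hη l hh.nonneg).const_mul K).mono' (hh.measurable.mul
    (hN.continuous.measurable.pow_const α).neg.exp).aestronglyMeasurable
    (ae_restrict_of_ae ?_)
  filter_upwards [hb] with u hu
  have := hu 1 one_ne_zero
  rw [one_smul, abs_one, Real.one_rpow, one_mul] at this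
  rw [norm_mul, Real.norm_of_nonneg (Real.exp_pos _).le, ← mul_assoc]
  exact mul_le_mul (hK _) this (Real.exp_pos _).le ((abs_nonneg _).trans (hK _))

/-- On the body exp(-N^α) ≥ e⁻¹, so integrability against the characteristic function passes to the
body itself, bounded or not. -/
theorem IsStableLaw.integrableOn_body (hN : IsStableLaw α μ N) (h0 : ¬ ∀ᵐ x ∂μ, x = 0)
    (hh : IsAnnularKernel l h) {η : ℝ} (hη : 0 < η) :
    IntegrableOn h ({u | N u ≤ 1} ∩ {u | η < ‖u‖}) := by
  refine (((hN.integrableOn_mul_exp h0 hh hη).mono_set Set.inter_subset_right).norm.const_mul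
    (Real.exp 1)).mono' hh.measurable.aestronglyMeasurable ((ae_restrict_iff'
      (hN.measurableSet_le_one.inter (measurableSet_lt_norm η))).2 (ae_of_all _ fun u hu => ?_))
  have hu1 : N u ≤ 1 := hu.1
  have : 1 ≤ Real.exp 1 * Real.exp (-(N u ^ α)) := by
    rw [← Real.exp_add]
    exact Real.one_le_exp (by linarith [Real.rpow_le_one (hN.nonneg u) hu1 hN.pos.le])
  rw [norm_mul, Real.norm_of_nonneg (Real.exp_pos _).le]
  calc ‖h u‖ = ‖h u‖ * 1 := (mul_one _).symm
    _ ≤ ‖h u‖ * (Real.exp 1 * Real.exp (-(N u ^ α))) := by gcongr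
    _ = _ := by ring

/-- The integral of `h` over the unit ball of `N` outside of a Euclidean ball. -/
def bodyIntegral (N : EuclideanSpace ℝ (Fin d) → ℝ) (h : EuclideanSpace ℝ (Fin d) → ℝ)
    (η : ℝ) : ℝ := ∫ u in {u | N u ≤ 1} ∩ {u | η < ‖u‖}, h u

/-- The difference of the two domains is an annulus inside the body, and annuli contribute nothing.
-/
theorem IsStableLaw.bodyIntegral_eq (hN : IsStableLaw α μ N) (h0 : ¬ ∀ᵐ x ∂μ, x = 0)
    (hh : IsAnnularKernel l h) {η₀ : ℝ} (hη₀ : ∀ u, ‖u‖ ≤ η₀ → N u ≤ 1) {η : ℝ} (hη : 0 < η)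
    (hle : η ≤ η₀) : bodyIntegral N h η = bodyIntegral N h η₀ := by
  have hset : {u | N u ≤ 1} ∩ {u | η < ‖u‖} =
      ({u | N u ≤ 1} ∩ {u | η₀ < ‖u‖}) ∪ {u | η < ‖u‖ ∧ ‖u‖ ≤ η₀} := by
    ext u
    simp only [Set.mem_inter_iff, Set.mem_ofPred_eq, Set.mem_union]
    constructor
    · rintro ⟨h1, h2⟩
      rcases lt_or_ge η₀ ‖u‖ with h3 | h3
      · exact Or.inl ⟨h1, h3⟩
      · exact Or.inr ⟨h2, h3⟩
    · rintro (⟨h1, h2⟩ | ⟨h1, h2⟩)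
      · exact ⟨h1, hle.trans_lt h2⟩
      · exact ⟨hη₀ u h2, h1⟩
  have hint := hN.integrableOn_body h0 hh hη
  rw [hset] at hint
  rw [bodyIntegral, hset, setIntegral_union ?_ ?_ (hint.mono_set Set.subset_union_left)
    (hint.mono_set Set.subset_union_right), hh.integral_annulus η η₀ hη, add_zero, bodyIntegral]
  · refine Set.disjoint_left.2 fun u hu hu' => ?_
    exact not_lt.2 hu'.2 hu.2
  · exact (measurableSet_lt_norm η).inter (measurableSet_le measurable_norm measurable_const)

/-- Small radii reduce to η₀ by constancy, and larger radii shrink the domain. The bound, uniform in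
η, is the majorant in the limits below. -/
theorem IsStableLaw.abs_bodyIntegral_le (hN : IsStableLaw α μ N) (h0 : ¬ ∀ᵐ x ∂μ, x = 0)
    (hh : IsAnnularKernel l h) {η₀ : ℝ} (hη₀0 : 0 < η₀) (hη₀ : ∀ u, ‖u‖ ≤ η₀ → N u ≤ 1) {η : ℝ}
    (hη : 0 < η) : |bodyIntegral N h η| ≤ bodyIntegral N (fun u => |h u|) η₀ := by
  wlog hle : η₀ ≤ η generalizing η with hw
  · rw [hN.bodyIntegral_eq h0 hh hη₀ hη (le_of_not_ge hle)]
    exact hw hη₀0 le_rfl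
  refine (abs_integral_le_integral_abs).trans ?_
  refine setIntegral_mono_set (hN.integrableOn_body h0 hh hη₀0).norm
    (ae_of_all _ fun u => abs_nonneg _) (Filter.Eventually.of_forall ?_)
  exact Set.inter_subset_inter_right _ fun u (hu : η < ‖u‖) => hle.trans_lt hu

/-- Degree -l - d against the Jacobian r^d leaves the net factor r^(-l). -/
theorem IsAnnularKernel.integral_smul_set (hh : IsAnnularKernel l h) {r : ℝ} (hr : 0 < r)
    {f : EuclideanSpace ℝ (Fin d) → ℝ} (S S' : Set (EuclideanSpace ℝ (Fin d)))
    (hS : MeasurableSet S) (hS' : MeasurableSet S')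
    (hSS' : ∀ u, r • u ∈ S' ↔ u ∈ S) :
    ∫ u in S', h u * f u = r ^ (-l) * ∫ u in S, h u * f (r • u) := by
  rw [← integral_indicator hS', ← integral_indicator hS]
  have h1 := Measure.integral_comp_smul_of_nonneg
    (volume : Measure (EuclideanSpace ℝ (Fin d))) (S'.indicator fun u => h u * f u) r
    (hR := hr.le)
  have h2 : (fun u => S'.indicator (fun u => h u * f u) (r • u)) =
      fun u => r ^ (-l - d) * S.indicator (fun u => h u * f (r • u)) u := by
    ext u
    by_cases hu : u ∈ S
    · rw [Set.indicator_of_mem hu, Set.indicator_of_mem ((hSS' u).2 hu), hh.map_smul r hr, mul_assoc]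
    · rw [Set.indicator_of_notMem hu, Set.indicator_of_notMem (mt (hSS' u).1 hu), mul_zero]
  rw [h2, integral_const_mul, finrank_euclideanSpace_fin, smul_eq_mul, ← Real.rpow_natCast,
    ← Real.rpow_neg hr.le] at h1
  have hp := Real.rpow_pos_of_pos hr (-(d : ℝ))
  rw [Real.rpow_sub hr, div_eq_mul_inv, ← Real.rpow_neg hr.le] at h1
  refine mul_left_cancel₀ hp.ne' ?_
  rw [← h1]; ring

theorem integral_exp_neg_indicator {a : ℝ} (ha : 0 ≤ a) :
    ∫ s in Set.Ioi (0 : ℝ), (Set.Ici a).indicator (fun s => Real.exp (-s)) s = Real.exp (-a) := by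
  rw [setIntegral_indicator measurableSet_Ici, ← integral_exp_neg_Ioi a]
  refine setIntegral_congr_set ?_
  have h1 := ae_eq_set_inter (ae_eq_refl (μ := (volume : Measure ℝ)) (Set.Ioi (0 : ℝ)))
    (Ioi_ae_eq_Ici (a := a) (μ := (volume : Measure ℝ))).symm
  rwa [Set.Ioi_inter_Ioi, sup_eq_right.2 ha] at h1

/-- The integral of `h exp (-N ^ α)` outside of a Euclidean ball. -/
def expIntegral (α : ℝ) (N : EuclideanSpace ℝ (Fin d) → ℝ) (h : EuclideanSpace ℝ (Fin d) → ℝ)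
    (η : ℝ) : ℝ := ∫ u in {u | η < ‖u‖}, h u * Real.exp (-(N u ^ α))

theorem IsStableLaw.expIntegral_eq (hN : IsStableLaw α μ N) (h0 : ¬ ∀ᵐ x ∂μ, x = 0)
    (hh : IsAnnularKernel l h) {η : ℝ} (hη : 0 < η) :
    IntegrableOn (fun s : ℝ => Real.exp (-s) * s ^ (-(l / α)) *
      bodyIntegral N h (η * s ^ (-(1 / α)))) (Set.Ioi 0) ∧
    expIntegral α N h η = ∫ s in Set.Ioi (0 : ℝ), Real.exp (-s) * s ^ (-(l / α)) *
      bodyIntegral N h (η * s ^ (-(1 / α))) := by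
  have hα := hN.pos
  -- Layer cake: exp(-N^α) is the integral of e^(-s) over s ≥ N^α. Exchanging integrals, each s
  -- contributes the dilate of the body by s^(1/α), and rescaling it yields s^(-l/α), the Gamma
  -- integrand.
  set G : EuclideanSpace ℝ (Fin d) × ℝ → ℝ := fun p =>
    h p.1 * (Set.Ici (N p.1 ^ α)).indicator (fun s => Real.exp (-s)) p.2 with hG
  have hGm : Measurable G := by
    refine (hh.measurable.comp measurable_fst).mul ?_
    have : MeasurableSet {p : EuclideanSpace ℝ (Fin d) × ℝ | N p.1 ^ α ≤ p.2} :=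
      measurableSet_le ((hN.continuous.measurable.comp measurable_fst).pow_const α) measurable_snd
    exact (measurable_snd.neg.exp).indicator this
  have hcong : ∀ s ∈ Set.Ioi (0 : ℝ), ∫ u in {u | η < ‖u‖}, G (u, s) =
      Real.exp (-s) * s ^ (-(l / α)) * bodyIntegral N h (η * s ^ (-(1 / α))) := by
    intro s hs
    have hs : 0 < s := hs
    have hr : 0 < s ^ (1 / α) := by positivity
    have e1 : ∀ u, G (u, s) = Real.exp (-s) * {u | N u ≤ s ^ (1 / α)}.indicator h u := by
      intro u
      have hiff : N u ≤ s ^ (1 / α) ↔ N u ^ α ≤ s := by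
        rw [one_div, Real.le_rpow_inv_iff_of_pos (hN.nonneg u) hs.le hα]
      by_cases hu : N u ≤ s ^ (1 / α)
      · simp only [hG]
        rw [Set.indicator_of_mem (Set.mem_Ici.2 (hiff.1 hu)), Set.indicator_of_mem (by exact hu), mul_comm]
      · simp only [hG]
        rw [Set.indicator_of_notMem (fun h => hu (hiff.2 (Set.mem_Ici.1 h))), Set.indicator_of_notMem (by exact hu)]
        simp
    simp_rw [e1]
    have hmN : MeasurableSet {u | N u ≤ s ^ (1 / α)} :=
      measurableSet_le hN.continuous.measurable measurable_const
    rw [integral_const_mul, setIntegral_indicator hmN, mul_assoc, bodyIntegral]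
    congr 1
    have := hh.integral_smul_set hr (f := fun _ => 1)
      ({u | N u ≤ 1} ∩ {u | η * s ^ (-(1 / α)) < ‖u‖}) ({u | η < ‖u‖} ∩ {u | N u ≤ s ^ (1 / α)})
      (hN.measurableSet_le_one.inter (measurableSet_lt_norm _))
      ((measurableSet_lt_norm _).inter hmN) (fun u => by
        simp only [Set.mem_inter_iff, Set.mem_ofPred_eq, norm_smul, hN.map_smul,
          Real.norm_of_nonneg hr.le, abs_of_pos hr, Real.rpow_neg hs.le, ← div_eq_mul_inv,
          div_lt_iff₀ hr]
        rw [and_comm, mul_comm ‖u‖, mul_le_iff_le_one_right hr])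
    simp only [mul_one] at this
    rw [this, ← Real.rpow_mul hs.le]
    congr 2
    ring
  have hGi : Integrable G ((volume.restrict {u | η < ‖u‖}).prod (volume.restrict (Set.Ioi 0))) := by
    rw [integrable_prod_iff hGm.aestronglyMeasurable]
    have hexp : IntegrableOn (fun s : ℝ => Real.exp (-s)) (Set.Ioi 0) := integrableOn_exp_neg_Ioi 0
    refine ⟨ae_of_all _ fun u => (Integrable.indicator hexp (measurableSet_Ici (a := N u ^ α))).const_mul (h u), ?_⟩
    have : ∀ u, ∫ s in Set.Ioi (0 : ℝ), ‖G (u, s)‖ = ‖h u * Real.exp (-(N u ^ α))‖ := by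
      intro u
      simp only [hG, norm_mul]
      rw [integral_const_mul, Real.norm_of_nonneg (Real.exp_pos _).le,
        ← integral_exp_neg_indicator (Real.rpow_nonneg (hN.nonneg u) α)]
      congr 2
      ext s
      exact Real.norm_of_nonneg (Set.indicator_nonneg (fun _ _ => (Real.exp_pos _).le) _)
    simp_rw [this]
    exact (hN.integrableOn_mul_exp h0 hh hη).norm
  constructor
  · exact (hGi.integral_prod_right).congr
      ((ae_restrict_iff' measurableSet_Ioi).2 (ae_of_all _ hcong))
  · rw [← setIntegral_congr_fun measurableSet_Ioi hcong]
    rw [← integral_integral_swap (f := fun u s => G (u, s)) hGi, expIntegral]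
    congr 1
    ext u
    simp only [hG]
    rw [integral_const_mul, integral_exp_neg_indicator (Real.rpow_nonneg (hN.nonneg u) α)]

theorem IsStableLaw.abs_expIntegral_le (hN : IsStableLaw α μ N) (h0 : ¬ ∀ᵐ x ∂μ, x = 0)
    (hh : IsAnnularKernel l h) (hl : l < α) {η₀ : ℝ} (hη₀0 : 0 < η₀)
    (hη₀ : ∀ u, ‖u‖ ≤ η₀ → N u ≤ 1) :
    ∃ C, ∀ η, 0 < η → |expIntegral α N h η| ≤ C := by
  refine ⟨∫ s in Set.Ioi (0 : ℝ), Real.exp (-s) * s ^ (-(l / α)) *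
    bodyIntegral N (fun u => |h u|) η₀, fun η hη => ?_⟩
  rw [(hN.expIntegral_eq h0 hh hη).2]
  refine abs_integral_le_integral_abs.trans (setIntegral_mono_on
    (hN.expIntegral_eq h0 hh hη).1.norm ((hN.integrableOn_gamma hl).mul_const _)
    measurableSet_Ioi fun s hs => ?_)
  have hs : 0 < s := hs
  rw [abs_mul, abs_of_nonneg (by positivity : 0 ≤ Real.exp (-s) * s ^ (-(l / α)))]
  gcongr
  exact hN.abs_bodyIntegral_le h0 hh hη₀0 hη₀ (by positivity)

/-- For each s the body integral in the layer-cake formula is eventually constant as η → 0, so only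
the Gamma integral remains. -/
theorem IsStableLaw.tendsto_expIntegral (hN : IsStableLaw α μ N) (h0 : ¬ ∀ᵐ x ∂μ, x = 0)
    (hh : IsAnnularKernel l h) (hl : l < α) {η₀ : ℝ} (hη₀0 : 0 < η₀)
    (hη₀ : ∀ u, ‖u‖ ≤ η₀ → N u ≤ 1) :
    Tendsto (expIntegral α N h) (𝓝[>] 0)
      (𝓝 (Real.Gamma (1 - l / α) * bodyIntegral N h η₀)) := by
  have hlim : Real.Gamma (1 - l / α) * bodyIntegral N h η₀ =
      ∫ s in Set.Ioi (0 : ℝ), Real.exp (-s) * s ^ (-(l / α)) * bodyIntegral N h η₀ := by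
    rw [integral_mul_const, Real.Gamma_eq_integral
      (by rw [sub_pos, div_lt_one hN.pos]; exact hl)]
    simp
  rw [hlim]
  have heq : ∀ᶠ η in 𝓝[>] (0 : ℝ), ∫ s in Set.Ioi (0 : ℝ), Real.exp (-s) * s ^ (-(l / α)) *
      bodyIntegral N h (η * s ^ (-(1 / α))) = expIntegral α N h η := by
    filter_upwards [self_mem_nhdsWithin] with η hη
    exact (hN.expIntegral_eq h0 hh hη).2.symm
  refine Tendsto.congr' heq (tendsto_integral_filter_of_dominated_convergence
    (fun s => Real.exp (-s) * s ^ (-(l / α)) * bodyIntegral N (fun u => |h u|) η₀) ?_ ?_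
    ((hN.integrableOn_gamma hl).mul_const _) ?_)
  · filter_upwards [self_mem_nhdsWithin] with η hη
    exact (hN.expIntegral_eq h0 hh hη).1.aestronglyMeasurable
  · filter_upwards [self_mem_nhdsWithin] with η hη
    have hη : 0 < η := hη
    refine (ae_restrict_iff' measurableSet_Ioi).2 (ae_of_all _ fun s hs => ?_)
    have hs : 0 < s := hs
    rw [norm_mul, Real.norm_of_nonneg (by positivity)]
    gcongr
    exact hN.abs_bodyIntegral_le h0 hh hη₀0 hη₀ (by positivity)
  · refine (ae_restrict_iff' measurableSet_Ioi).2 (ae_of_all _ fun s hs => ?_)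
    have hs : 0 < s := hs
    refine Tendsto.congr' ?_ tendsto_const_nhds
    have hlt : (0 : ℝ) < η₀ / s ^ (-(1 / α)) := by positivity
    filter_upwards [Ioo_mem_nhdsGT hlt] with η hη
    rw [hN.bodyIntegral_eq h0 hh hη₀ (mul_pos hη.1 (by positivity))]
    exact ((lt_div_iff₀ (by positivity)).1 hη.2).le

/-- For fixed z ≠ 0 the dilation by |z| reduces to `expIntegral` at radius η|z| with a factor |z|^l,
whose average is the absolute moment. -/
theorem IsStableLaw.tendsto_integral_mul_average (hN : IsStableLaw α μ N)
    (h0 : ¬ ∀ᵐ x ∂μ, x = 0) (hh : IsAnnularKernel l h) (hl : l < α) {η₀ : ℝ} (hη₀0 : 0 < η₀)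
    (hη₀ : ∀ u, ‖u‖ ≤ η₀ → N u ≤ 1) :
    Tendsto (fun η => ∫ u in {u | η < ‖u‖}, h u * ∫ z, Real.exp (-(N (z • u) ^ α)) ∂stdGauss)
      (𝓝[>] 0) (𝓝 (absMoment l * (Real.Gamma (1 - l / α) * bodyIntegral N h η₀))) := by
  have hcong : ∀ η : ℝ, ∀ z : ℝ, z ≠ 0 →
      ∫ u in {u | η < ‖u‖}, h u * Real.exp (-(N (z • u) ^ α)) =
        |z| ^ l * expIntegral α N h (η * |z|) := by
    intro η z hz
    have hr := abs_pos.2 hz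
    have h1 := hh.integral_smul_set hr (f := fun u => Real.exp (-(N u ^ α)))
      {u | η < ‖u‖} {u | η * |z| < ‖u‖} (measurableSet_lt_norm _) (measurableSet_lt_norm _)
      (fun u => by
        simp only [Set.mem_ofPred_eq, norm_smul, Real.norm_eq_abs, abs_abs]
        rw [mul_comm |z|, mul_lt_mul_iff_left₀ hr])
    rw [expIntegral, h1, ← mul_assoc, ← Real.rpow_add hr, add_neg_cancel, Real.rpow_zero, one_mul]
    simp only [hN.map_smul, abs_abs]
  have heq : ∀ᶠ η in 𝓝[>] (0 : ℝ), ∫ z, |z| ^ l * expIntegral α N h (η * |z|) ∂stdGauss =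
      ∫ u in {u | η < ‖u‖}, h u * ∫ z, Real.exp (-(N (z • u) ^ α)) ∂stdGauss := by
    filter_upwards [self_mem_nhdsWithin] with η hη
    simp_rw [← integral_const_mul]
    rw [← integral_integral_swap (hN.integrable_prod_mul_exp h0 hh hη)]
    refine integral_congr_ae ?_
    filter_upwards [ae_stdGauss_ne_zero] with z hz
    exact (hcong η z hz).symm
  obtain ⟨C, hC⟩ := hN.abs_expIntegral_le h0 hh hl hη₀0 hη₀
  have hlim : absMoment l * (Real.Gamma (1 - l / α) * bodyIntegral N h η₀) =
      ∫ z, |z| ^ l * (Real.Gamma (1 - l / α) * bodyIntegral N h η₀) ∂stdGauss := by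
    rw [integral_mul_const]; rfl
  rw [hlim]
  refine Tendsto.congr' heq (tendsto_integral_filter_of_dominated_convergence
    (fun z => |z| ^ l * C) ?_ ?_
    ((integrable_abs_rpow (by linarith [hh.nonneg])).mul_const _) ?_)
  · filter_upwards [self_mem_nhdsWithin] with η hη
    have := (hN.integrable_prod_mul_exp h0 hh hη).integral_prod_left.aestronglyMeasurable
    refine this.congr ?_
    filter_upwards [ae_stdGauss_ne_zero] with z hz
    exact hcong η z hz
  · filter_upwards [self_mem_nhdsWithin] with η hη
    have hη : 0 < η := hη
    filter_upwards [ae_stdGauss_ne_zero] with z hz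
    have := abs_pos.2 hz
    rw [norm_mul, Real.norm_of_nonneg (by positivity)]
    gcongr
    exact hC _ (by positivity)
  · filter_upwards [ae_stdGauss_ne_zero] with z hz
    have hz := abs_pos.2 hz
    refine Tendsto.const_mul _ ((hN.tendsto_expIntegral h0 hh hl hη₀0 hη₀).comp ?_)
    refine tendsto_nhdsWithin_iff.2 ⟨?_, ?_⟩
    · have : Tendsto (fun η : ℝ => η * |z|) (𝓝 0) (𝓝 (0 * |z|)) := tendsto_id.mul_const _
      rw [zero_mul] at this
      exact this.mono_left nhdsWithin_le_nhds
    · filter_upwards [self_mem_nhdsWithin] with η hη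
      exact mul_pos hη hz

end

section

/-! ### Symmetrization over sign changes of the coordinates -/

variable {d : ℕ}

/-- The sign encoded by a truth value. -/
def boolSign (b : Bool) : ℝ := if b then 1 else -1

/-- The isometry changing the signs of some coordinates. -/
def signFlip (σ : Fin d → Bool) : EuclideanSpace ℝ (Fin d) ≃ₗᵢ[ℝ] EuclideanSpace ℝ (Fin d) :=
  LinearIsometryEquiv.piLpCongrRight 2 fun i =>
    if σ i then LinearIsometryEquiv.refl ℝ ℝ else LinearIsometryEquiv.neg ℝ

theorem signFlip_apply (σ : Fin d → Bool) (u : EuclideanSpace ℝ (Fin d)) (i : Fin d) :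
    signFlip σ u i = boolSign (σ i) * u i := by
  rw [signFlip, LinearIsometryEquiv.piLpCongrRight_apply]
  cases h : σ i <;> simp [boolSign, h]

theorem abs_boolSign (b : Bool) : |boolSign b| = 1 := by cases b <;> simp [boolSign]

theorem setIntegral_comp_signFlip (σ : Fin d → Bool) {A : Set (EuclideanSpace ℝ (Fin d))}
    (hA : ∀ u, signFlip σ u ∈ A ↔ u ∈ A) (f : EuclideanSpace ℝ (Fin d) → ℝ) :
    ∫ u in A, f (signFlip σ u) = ∫ u in A, f u := by
  have hpre : signFlip σ ⁻¹' A = A := Set.ext hA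
  have := (signFlip σ).measurePreserving.setIntegral_preimage_emb
    (signFlip σ).toHomeomorph.measurableEmbedding f A
  rwa [hpre] at this

theorem integrableOn_comp_signFlip (σ : Fin d → Bool) {A : Set (EuclideanSpace ℝ (Fin d))}
    (hA : ∀ u, signFlip σ u ∈ A ↔ u ∈ A) {f : EuclideanSpace ℝ (Fin d) → ℝ}
    (hf : IntegrableOn f A) : IntegrableOn (fun u => f (signFlip σ u)) A := by
  have hpre : signFlip σ ⁻¹' A = A := Set.ext hA
  have := ((signFlip σ).measurePreserving.integrableOn_comp_preimage
    (signFlip σ).toHomeomorph.measurableEmbedding (f := f) (s := A)).2 hf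
  rwa [hpre] at this

/-- The complement of conical neighbourhoods of the coordinate hyperplanes. -/
def coneRegion (d : ℕ) (δ : ℝ) : Set (EuclideanSpace ℝ (Fin d)) := {u | ∀ i, δ * ‖u‖ < |u i|}

theorem measurableSet_coneRegion (δ : ℝ) : MeasurableSet (coneRegion d δ) := by
  have : coneRegion d δ = ⋂ i, {u | δ * ‖u‖ < |u i|} := by ext; simp [coneRegion]
  rw [this]
  refine MeasurableSet.iInter fun i => measurableSet_lt (by fun_prop) ?_
  exact (by fun_prop : Continuous fun u : EuclideanSpace ℝ (Fin d) => |u i|).measurable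

theorem smul_mem_coneRegion {δ r : ℝ} (hr : 0 < r) (u : EuclideanSpace ℝ (Fin d)) :
    r • u ∈ coneRegion d δ ↔ u ∈ coneRegion d δ := by
  simp only [coneRegion, Set.mem_ofPred_eq, norm_smul, Real.norm_of_nonneg hr.le, PiLp.smul_apply,
    smul_eq_mul, abs_mul, abs_of_pos hr]
  refine forall_congr' fun i => ?_
  rw [mul_left_comm, mul_lt_mul_iff_right₀ hr]

theorem signFlip_mem_coneRegion (σ : Fin d → Bool) (δ : ℝ) (u : EuclideanSpace ℝ (Fin d)) :
    signFlip σ u ∈ coneRegion d δ ↔ u ∈ coneRegion d δ := by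
  simp only [coneRegion, Set.mem_ofPred_eq, LinearIsometryEquiv.norm_map, signFlip_apply, abs_mul,
    abs_boolSign, one_mul]

/-- The product of signed powers, cut off near the coordinate hyperplanes. -/
def truncatedKernel (lam : Fin d → ℝ) (δ : ℝ) (u : EuclideanSpace ℝ (Fin d)) : ℝ :=
  (coneRegion d δ).indicator (fun u => prodSignedPow (fun i => -lam i - 1) u.ofLp) u

theorem measurable_truncatedKernel (lam : Fin d → ℝ) (δ : ℝ) :
    Measurable (truncatedKernel lam δ) :=
  ((measurable_prodSignedPow _).comp (by fun_prop)).indicator (measurableSet_coneRegion δ)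

theorem signedPow_boolSign_mul (b : Bool) (t p : ℝ) :
    signedPow (boolSign b * t) p = boolSign b * signedPow t p := by
  cases b <;> simp [boolSign, signedPow_neg]

theorem truncatedKernel_signFlip (lam : Fin d → ℝ) (δ : ℝ) (σ : Fin d → Bool)
    (u : EuclideanSpace ℝ (Fin d)) :
    truncatedKernel lam δ (signFlip σ u) = (∏ i, boolSign (σ i)) * truncatedKernel lam δ u := by
  by_cases hu : u ∈ coneRegion d δ
  · rw [truncatedKernel, truncatedKernel, Set.indicator_of_mem hu,
      Set.indicator_of_mem ((signFlip_mem_coneRegion σ δ u).2 hu)]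
    simp only [prodSignedPow, signFlip_apply, signedPow_boolSign_mul, Finset.prod_mul_distrib]
  · rw [truncatedKernel, truncatedKernel, Set.indicator_of_notMem hu,
      Set.indicator_of_notMem (mt (signFlip_mem_coneRegion σ δ u).1 hu), mul_zero]

/-- Off the cones each |u_i| exceeds δ‖u‖, which bounds the kernel by its homogeneity. It is odd
under reflection of one coordinate, and annuli are invariant, so the annular integrals vanish. -/
theorem isAnnularKernel_truncatedKernel (hd : 0 < d) {lam : Fin d → ℝ} (hlam : ∀ i, 0 ≤ lam i)
    {δ : ℝ} (hδ : 0 < δ) : IsAnnularKernel (∑ i, lam i) (truncatedKernel lam δ) where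
  measurable := measurable_truncatedKernel lam δ
  nonneg := Finset.sum_nonneg fun i _ => hlam i
  map_smul r hr u := by
    by_cases hu : u ∈ coneRegion d δ
    · rw [truncatedKernel, truncatedKernel, Set.indicator_of_mem hu,
        Set.indicator_of_mem ((smul_mem_coneRegion hr u).2 hu)]
      simp only [prodSignedPow, PiLp.smul_apply, smul_eq_mul, signedPow_mul,
        Finset.prod_mul_distrib, signedPow_of_pos hr]
      rw [← Real.rpow_sum_of_pos hr]
      congr 2
      simp [Finset.sum_sub_distrib]
    · rw [truncatedKernel, truncatedKernel, Set.indicator_of_notMem hu,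
        Set.indicator_of_notMem (mt (smul_mem_coneRegion hr u).1 hu), mul_zero]
  exists_bound := by
    refine ⟨δ ^ (-(∑ i, lam i) - d), fun u => ?_⟩
    by_cases hu : u ∈ coneRegion d δ
    · rw [truncatedKernel, Set.indicator_of_mem hu]
      have hn : 0 < ‖u‖ := by
        rw [norm_pos_iff]
        rintro rfl
        have := hu ⟨0, hd⟩
        simp at this
      have hp : 0 < δ * ‖u‖ := by positivity
      rw [← Real.mul_rpow hδ.le hn.le]
      calc _ ≤ ∏ i, |u i| ^ (-lam i - 1) := abs_prodSignedPow_le _ _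
        _ ≤ ∏ i, (δ * ‖u‖) ^ (-lam i - 1) :=
            Finset.prod_le_prod (fun i _ => by positivity) fun i _ =>
              Real.rpow_le_rpow_of_nonpos hp (hu i).le (by linarith [hlam i])
        _ = _ := by
            rw [← Real.rpow_sum_of_pos hp]
            congr 1
            simp [Finset.sum_sub_distrib]
    · rw [truncatedKernel, Set.indicator_of_notMem hu, abs_zero]
      positivity
  integral_annulus a b _ := by
    -- Only the first coordinate is reflected, as `false` encodes the sign -1.
    set σ : Fin d → Bool := fun i => decide (i ≠ ⟨0, hd⟩)
    have hσ : ∏ i, boolSign (σ i) = -1 := by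
      rw [Finset.prod_eq_single_of_mem ⟨0, hd⟩ (Finset.mem_univ _)]
      · simp [σ, boolSign]
      · intro i _ hi
        simp [σ, boolSign, hi]
    have := setIntegral_comp_signFlip σ (A := {u | a < ‖u‖ ∧ ‖u‖ ≤ b})
      (fun u => by simp) (truncatedKernel lam δ)
    simp only [truncatedKernel_signFlip, hσ, integral_const_mul] at this
    linarith

/-- The signed sum factorizes into the differences exp(i a_j) - exp(-i a_j). -/
theorem sum_prod_boolSign_mul_exp (a : Fin d → ℝ) :
    ∑ σ : Fin d → Bool, ((∏ i, boolSign (σ i) : ℝ) : ℂ) *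
      Complex.exp (((∑ i, boolSign (σ i) * a i : ℝ) : ℂ) * Complex.I) =
    2 ^ d * Complex.I ^ d * ((∏ i, Real.sin (a i) : ℝ) : ℂ) := by
  have h1 : ∀ i, ∑ b : Bool, (boolSign b : ℂ) * Complex.exp ((boolSign b * a i : ℝ) * Complex.I) =
      2 * Complex.I * (Real.sin (a i) : ℂ) := by
    intro i
    rw [Fintype.sum_bool]
    simp only [boolSign, if_true, Bool.false_eq_true, if_false, Complex.ofReal_sin, Complex.sin]
    push_cast
    simp only [one_mul, neg_mul]
    linear_combination (Complex.exp ((a i : ℂ) * Complex.I) -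
      Complex.exp (-((a i : ℂ) * Complex.I))) * Complex.I_mul_I
  have h2 := Finset.prod_univ_sum (fun _ : Fin d => (Finset.univ : Finset Bool))
    fun i b => (boolSign b : ℂ) * Complex.exp ((boolSign b * a i : ℝ) * Complex.I)
  simp only [h1, Fintype.piFinset_univ] at h2
  calc _ = ∑ σ : Fin d → Bool, ∏ i, (boolSign (σ i) : ℂ) *
        Complex.exp ((boolSign (σ i) * a i : ℝ) * Complex.I) := by
        refine Finset.sum_congr rfl fun σ _ => ?_
        rw [Finset.prod_mul_distrib, ← Complex.exp_sum, ← Finset.sum_mul]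
        push_cast
        rfl
    _ = _ := by
        rw [← h2, Finset.prod_mul_distrib, Finset.prod_const, Finset.card_univ, Fintype.card_fin,
          mul_pow]
        push_cast
        rfl

variable {α : ℝ} {μ : Measure (EuclideanSpace ℝ (Fin d))} {N : EuclideanSpace ℝ (Fin d) → ℝ}

theorem IsStableLaw.integrable_exp_smul (hN : IsStableLaw α μ N) (u : EuclideanSpace ℝ (Fin d)) :
    Integrable (fun z : ℝ => Real.exp (-(N (z • u) ^ α))) stdGauss := by
  refine (integrable_const (1 : ℝ)).mono'
    (hN.measurable_exp.comp (measurable_id.prodMk measurable_const)).aestronglyMeasurable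
    (ae_of_all _ fun z => ?_)
  rw [Real.norm_of_nonneg (Real.exp_pos _).le, Real.exp_le_one_iff]
  exact neg_nonpos.2 (Real.rpow_nonneg (hN.nonneg _) _)

variable [IsProbabilityMeasure μ]

theorem IsStableLaw.sum_prod_boolSign_mul_exp (hN : IsStableLaw α μ N) {c : ℝ}
    (hc : (c : ℂ) = Complex.I ^ d) (u : EuclideanSpace ℝ (Fin d)) (z : ℝ) :
    ∑ σ : Fin d → Bool, (∏ i, boolSign (σ i)) * Real.exp (-(N (z • signFlip σ u) ^ α)) =
      2 ^ d * c * ∫ x, prodSin 0 (u.ofLp * x.ofLp) z ∂μ := by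
  have h1 : ∀ σ : Fin d → Bool, ((Real.exp (-(N (z • signFlip σ u) ^ α)) : ℝ) : ℂ) =
      ∫ x, Complex.exp (((∑ i, boolSign (σ i) * (u i * x i * z) : ℝ) : ℂ) * Complex.I) ∂μ := by
    intro σ
    rw [← hN.charFun_eq, charFun_apply]
    congr 1
    ext x
    congr 3
    simp only [PiLp.inner_apply, RCLike.inner_apply, conj_trivial, PiLp.smul_apply, smul_eq_mul,
      signFlip_apply]
    exact Finset.sum_congr rfl fun i _ => by ring
  have h2 : ∀ σ : Fin d → Bool, Integrable (fun x : EuclideanSpace ℝ (Fin d) =>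
      Complex.exp (((∑ i, boolSign (σ i) * (u i * x i * z) : ℝ) : ℂ) * Complex.I)) μ := by
    intro σ
    refine (integrable_const (1 : ℝ)).mono' (Continuous.aestronglyMeasurable (by fun_prop))
      (ae_of_all _ fun x => ?_)
    rw [Complex.norm_exp_ofReal_mul_I]
  have h3 : ((∑ σ : Fin d → Bool, (∏ i, boolSign (σ i)) *
      Real.exp (-(N (z • signFlip σ u) ^ α)) : ℝ) : ℂ) =
      ((2 ^ d * c * ∫ x, prodSin 0 (u.ofLp * x.ofLp) z ∂μ : ℝ) : ℂ) := by
    rw [Complex.ofReal_sum]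
    simp_rw [Complex.ofReal_mul, h1, ← integral_const_mul]
    rw [← integral_finsetSum _ fun σ _ => (h2 σ).const_mul _]
    simp_rw [StableMoment.sum_prod_boolSign_mul_exp]
    rw [integral_const_mul, integral_complex_ofReal, hc]
    simp only [prodSin, sinKernel, Pi.zero_apply, not_lt.2 zero_le_one, if_false, Pi.mul_apply]
    push_cast
    rfl
  exact_mod_cast h3

/-- The average of `sinAverage 0` over the law `μ`. -/
def meanSinAverage (μ : Measure (EuclideanSpace ℝ (Fin d))) (u : EuclideanSpace ℝ (Fin d)) : ℝ :=
  ∫ x, sinAverage 0 (u.ofLp * x.ofLp) 0 ∂μ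

theorem abs_prodSin_zero_le (y : Fin d → ℝ) (z : ℝ) : |prodSin 0 y z| ≤ 1 := by
  simp only [prodSin, sinKernel, Pi.zero_apply, not_lt.2 zero_le_one, if_false, Finset.abs_prod]
  exact Finset.prod_le_one (fun _ _ => abs_nonneg _) fun _ _ => Real.abs_sin_le_one _

theorem IsStableLaw.sum_prod_boolSign_mul_average (hN : IsStableLaw α μ N) {c : ℝ}
    (hc : (c : ℂ) = Complex.I ^ d) (u : EuclideanSpace ℝ (Fin d)) :
    ∑ σ : Fin d → Bool, (∏ i, boolSign (σ i)) *
      ∫ z, Real.exp (-(N (z • signFlip σ u) ^ α)) ∂stdGauss = 2 ^ d * c * meanSinAverage μ u := by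
  simp_rw [← integral_const_mul]
  rw [← integral_finsetSum _ fun σ _ => (hN.integrable_exp_smul _).const_mul _]
  simp_rw [hN.sum_prod_boolSign_mul_exp hc]
  rw [integral_const_mul, integral_integral_swap]
  · simp only [meanSinAverage, sinAverage, pow_zero, one_mul]
  · refine (integrable_const (1 : ℝ)).mono' (Continuous.aestronglyMeasurable ?_)
      (ae_of_all _ fun p => abs_prodSin_zero_le _ _)
    exact (continuous_prodSin (0 : Fin d → ℝ)).comp
      (f := fun p : ℝ × EuclideanSpace ℝ (Fin d) => (u.ofLp * p.2.ofLp, p.1)) (by fun_prop)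

/-- The domain is invariant under all 2^d reflections and the kernel picks up exactly the sign with
which the characteristic function is to be summed. Averaging over reflections therefore replaces
that function by its sine part without changing the integral. -/
theorem IsStableLaw.integral_mul_average_eq (hN : IsStableLaw α μ N) (h0 : ¬ ∀ᵐ x ∂μ, x = 0)
    (hd : 0 < d) {lam : Fin d → ℝ} (hlam : ∀ i, 0 ≤ lam i) {δ : ℝ} (hδ : 0 < δ) {c : ℝ}
    (hc : (c : ℂ) = Complex.I ^ d) {η : ℝ} (hη : 0 < η) :
    ∫ u in {u | η < ‖u‖}, truncatedKernel lam δ u *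
      ∫ z, Real.exp (-(N (z • u) ^ α)) ∂stdGauss =
    c * ∫ u in {u | η < ‖u‖}, truncatedKernel lam δ u * meanSinAverage μ u := by
  have hh := isAnnularKernel_truncatedKernel hd hlam hδ
  set f : EuclideanSpace ℝ (Fin d) → ℝ := fun u => truncatedKernel lam δ u *
    ∫ z, Real.exp (-(N (z • u) ^ α)) ∂stdGauss with hf
  have hint : IntegrableOn f {u | η < ‖u‖} := by
    have := (hN.integrable_prod_mul_exp h0 hh hη).integral_prod_right
    simp only [integral_const_mul] at this
    exact this
  have hA : ∀ (σ : Fin d → Bool) (u : EuclideanSpace ℝ (Fin d)),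
      signFlip σ u ∈ {u : EuclideanSpace ℝ (Fin d) | η < ‖u‖} ↔ u ∈ {u | η < ‖u‖} := by simp
  have h1 : ∑ σ : Fin d → Bool, ∫ u in {u | η < ‖u‖}, f (signFlip σ u) =
      2 ^ d * ∫ u in {u | η < ‖u‖}, f u := by
    simp only [setIntegral_comp_signFlip _ (hA _), Finset.sum_const, Finset.card_univ,
      Fintype.card_fun, Fintype.card_bool, Fintype.card_fin, nsmul_eq_mul]
    push_cast
    rfl
  rw [← integral_finsetSum _ fun σ _ => integrableOn_comp_signFlip σ (hA σ) hint] at h1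
  have h2 : ∀ u, ∑ σ : Fin d → Bool, f (signFlip σ u) =
      2 ^ d * c * (truncatedKernel lam δ u * meanSinAverage μ u) := by
    intro u
    calc _ = truncatedKernel lam δ u * ∑ σ : Fin d → Bool, (∏ i, boolSign (σ i)) *
          ∫ z, Real.exp (-(N (z • signFlip σ u) ^ α)) ∂stdGauss := by
          rw [Finset.mul_sum]
          refine Finset.sum_congr rfl fun σ _ => ?_
          simp only [hf, truncatedKernel_signFlip]
          ring
      _ = _ := by rw [hN.sum_prod_boolSign_mul_average hc]; ring
  simp_rw [h2] at h1
  rw [integral_const_mul, mul_assoc] at h1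
  exact (mul_left_cancel₀ (by positivity) h1).symm

/-- The identity linking the body to the law for fixed δ: let η → 0 in the symmetrized identity,
once on the exponential side and once on the sine side, where dominated convergence is available. -/
theorem IsStableLaw.gamma_mul_bodyIntegral (hN : IsStableLaw α μ N) (h0 : ¬ ∀ᵐ x ∂μ, x = 0)
    (hd : 0 < d) {lam : Fin d → ℝ} (hlam : ∀ i, 0 ≤ lam i) (hl : ∑ i, lam i < α) {δ : ℝ}
    (hδ : 0 < δ) {c : ℝ} (hc : (c : ℂ) = Complex.I ^ d) {η₀ : ℝ} (hη₀0 : 0 < η₀)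
    (hη₀ : ∀ u, ‖u‖ ≤ η₀ → N u ≤ 1)
    (hint : Integrable fun u => truncatedKernel lam δ u * meanSinAverage μ u) :
    absMoment (∑ i, lam i) * (Real.Gamma (1 - (∑ i, lam i) / α) *
      bodyIntegral N (truncatedKernel lam δ) η₀) =
    c * ∫ u, truncatedKernel lam δ u * meanSinAverage μ u := by
  have hh := isAnnularKernel_truncatedKernel hd hlam hδ
  refine tendsto_nhds_unique (hN.tendsto_integral_mul_average h0 hh hl hη₀0 hη₀) ?_
  have heq : ∀ᶠ η in 𝓝[>] (0 : ℝ),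
      c * ∫ u, {u : EuclideanSpace ℝ (Fin d) | η < ‖u‖}.indicator
        (fun u => truncatedKernel lam δ u * meanSinAverage μ u) u =
      ∫ u in {u | η < ‖u‖}, truncatedKernel lam δ u *
        ∫ z, Real.exp (-(N (z • u) ^ α)) ∂stdGauss := by
    filter_upwards [self_mem_nhdsWithin] with η hη
    rw [hN.integral_mul_average_eq h0 hd hlam hδ hc hη,
      integral_indicator (measurableSet_lt_norm η)]
  refine Tendsto.congr' heq (Tendsto.const_mul _ (tendsto_integral_filter_of_dominated_convergence
    (fun u => ‖truncatedKernel lam δ u * meanSinAverage μ u‖) ?_ ?_ hint.norm ?_))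
  · exact Eventually.of_forall fun η =>
      (hint.indicator (measurableSet_lt_norm η)).aestronglyMeasurable
  · exact Eventually.of_forall fun η => ae_of_all _ fun u => norm_indicator_le_norm_self _ _
  · refine ae_of_all _ fun u => ?_
    rcases eq_or_ne u 0 with rfl | hu
    · have : truncatedKernel lam δ 0 = 0 := by
        refine Set.indicator_of_notMem (fun h => ?_) _
        have := h ⟨0, hd⟩
        simp at this
      simp only [Set.indicator, this, zero_mul, ite_self]
      exact tendsto_const_nhds
    · refine Tendsto.congr' (f₁ := fun _ => truncatedKernel lam δ u * meanSinAverage μ u) ?_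
        tendsto_const_nhds
      filter_upwards [Ioo_mem_nhdsGT (norm_pos_iff.2 hu)] with η hη
      have hmem : u ∈ {u : EuclideanSpace ℝ (Fin d) | η < ‖u‖} := hη.2
      rw [Set.indicator_of_mem hmem]

end

section

/-! ### Integrals outside of conical neighbourhoods -/

/-- The removed cones shrink to the coordinate hyperplanes, a null set. -/
theorem tendsto_integral_indicator_coneRegion {d : ℕ} {G : EuclideanSpace ℝ (Fin d) → ℝ}
    (hG : Integrable G) :
    Tendsto (fun δ => ∫ u, (coneRegion d δ).indicator G u) (𝓝[>] 0) (𝓝 (∫ u, G u)) := by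
  refine tendsto_integral_filter_of_dominated_convergence (fun u => ‖G u‖)
    (Eventually.of_forall fun δ =>
      (hG.indicator (measurableSet_coneRegion δ)).aestronglyMeasurable)
    (Eventually.of_forall fun δ => ae_of_all _ fun u => norm_indicator_le_norm_self _ _)
    hG.norm ?_
  have hne : ∀ᵐ u : EuclideanSpace ℝ (Fin d), ∀ i, u i ≠ 0 := by
    refine ae_all_iff.2 fun i => ?_
    have := ae_sum_mul_ne_zero (i := i) (c := Pi.single i 1) (by simp)
    filter_upwards [this] with u hu
    simpa [Pi.single_apply] using hu
  filter_upwards [hne] with u hu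
  refine Tendsto.congr' (f₁ := fun _ => G u) ?_ tendsto_const_nhds
  have hev : ∀ᶠ δ in 𝓝[>] (0 : ℝ), ∀ i, δ * ‖u‖ < |u i| := by
    refine eventually_all.2 fun i => ?_
    have : Tendsto (fun δ : ℝ => δ * ‖u‖) (𝓝 0) (𝓝 (0 * ‖u‖)) := tendsto_id.mul_const _
    rw [zero_mul] at this
    exact (this.mono_left nhdsWithin_le_nhds).eventually_lt_const (abs_pos.2 (hu i))
  filter_upwards [hev] with δ hδ
  have hmem : u ∈ coneRegion d δ := hδ
  rw [Set.indicator_of_mem hmem]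

/-- The function `|t| ^ (-1 - p)` outside of the interval `[-a, a]`. -/
def rpowTail (p a t : ℝ) : ℝ := if a < |t| then |t| ^ (-1 - p) else 0

theorem rpowTail_nonneg (p a t : ℝ) : 0 ≤ rpowTail p a t := by
  unfold rpowTail; split_ifs <;> positivity

theorem measurable_rpowTail (p : ℝ) : Measurable fun q : ℝ × ℝ => rpowTail p q.1 q.2 :=
  Measurable.ite (measurableSet_lt measurable_fst measurable_snd.norm)
    (measurable_snd.norm.pow_const _) measurable_const

theorem integrable_rpowTail {p a : ℝ} (hp : 0 < p) (ha : 0 < a) :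
    Integrable (rpowTail p a) ∧ ∫ t, rpowTail p a t = 2 / p * a ^ (-p) := by
  set f : ℝ → ℝ := (Set.Ioi a).indicator fun t => t ^ (-1 - p) with hf
  have e : rpowTail p a = fun t => f |t| := by
    ext t
    by_cases h : a < |t|
    · rw [rpowTail, if_pos h, hf, Set.indicator_of_mem (Set.mem_Ioi.2 h)]
    · rw [rpowTail, if_neg h, hf, Set.indicator_of_notMem (mt Set.mem_Ioi.1 h)]
  have hi : IntegrableOn (fun t : ℝ => t ^ (-1 - p)) (Set.Ioi a) :=
    integrableOn_Ioi_rpow_of_lt (by linarith) ha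
  rw [e]
  constructor
  · exact integrable_comp_abs ((integrable_indicator_iff measurableSet_Ioi).2 hi).integrableOn
  · rw [integral_comp_abs, hf, setIntegral_indicator measurableSet_Ioi, Set.Ioi_inter_Ioi,
      sup_eq_right.2 ha.le, integral_Ioi_rpow_of_lt (by linarith) ha]
    rw [show -1 - p + 1 = -p by ring]
    field_simp

theorem integrable_mul_rpowTail {n : ℕ} {p : ℝ} (hp : 0 < p) {f a : (Fin n → ℝ) → ℝ}
    (hf : Measurable f) (ha : Measurable a) (hpos : ∀ᵐ w, 0 < a w)
    (hint : Integrable fun w => f w * a w ^ (-p)) :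
    Integrable (fun q : ℝ × (Fin n → ℝ) => f q.2 * rpowTail p (a q.2) q.1) ∧
    ∫ q : ℝ × (Fin n → ℝ), f q.2 * rpowTail p (a q.2) q.1 =
      2 / p * ∫ w, f w * a w ^ (-p) := by
  have hm : Measurable fun q : ℝ × (Fin n → ℝ) => f q.2 * rpowTail p (a q.2) q.1 :=
    (hf.comp measurable_snd).mul
      ((measurable_rpowTail p).comp ((ha.comp measurable_snd).prodMk measurable_fst))
  have hi : Integrable (fun q : ℝ × (Fin n → ℝ) => f q.2 * rpowTail p (a q.2) q.1)
      (volume.prod volume) := by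
    rw [integrable_prod_iff' hm.aestronglyMeasurable]
    constructor
    · filter_upwards [hpos] with w hw
      exact (integrable_rpowTail hp hw).1.const_mul _
    · refine (hint.norm.const_mul (2 / p)).congr ?_
      filter_upwards [hpos] with w hw
      simp only [norm_mul]
      rw [integral_const_mul]
      simp only [Real.norm_of_nonneg (rpowTail_nonneg _ _ _), (integrable_rpowTail hp hw).2]
      rw [Real.norm_of_nonneg (by positivity : 0 ≤ a w ^ (-p))]
      ring
  refine ⟨by rwa [Measure.volume_eq_prod], ?_⟩
  rw [Measure.volume_eq_prod, integral_prod_symm _ hi, ← integral_const_mul]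
  refine integral_congr_ae ?_
  filter_upwards [hpos] with w hw
  rw [integral_const_mul, (integrable_rpowTail hp hw).2]
  ring

/-- The Euclidean norm on a coordinate space. -/
def euclNorm {n : ℕ} (w : Fin n → ℝ) : ℝ := √(∑ k, w k ^ 2)

theorem continuous_euclNorm {n : ℕ} : Continuous (euclNorm (n := n)) := by
  unfold euclNorm; fun_prop

theorem euclNorm_nonneg {n : ℕ} (w : Fin n → ℝ) : 0 ≤ euclNorm w := Real.sqrt_nonneg _

theorem abs_le_euclNorm {n : ℕ} (w : Fin n → ℝ) (k : Fin n) : |w k| ≤ euclNorm w := by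
  rw [← Real.sqrt_sq_eq_abs]
  exact Real.sqrt_le_sqrt (Finset.single_le_sum (f := fun k => w k ^ 2)
    (fun _ _ => sq_nonneg _) (Finset.mem_univ k))

/-- The Euclidean norm on the product of a line and a coordinate space. -/
def prodNorm {n : ℕ} (q : ℝ × (Fin n → ℝ)) : ℝ := √(q.1 ^ 2 + euclNorm q.2 ^ 2)

theorem continuous_prodNorm {n : ℕ} : Continuous (prodNorm (n := n)) := by
  have := continuous_euclNorm (n := n)
  unfold prodNorm; fun_prop

theorem lt_abs_iff_of_prodNorm {n : ℕ} {δ : ℝ} (h0 : 0 < δ) (h1 : δ < 1)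
    (q : ℝ × (Fin n → ℝ)) :
    δ * prodNorm q < |q.1| ↔ δ / √(1 - δ ^ 2) * euclNorm q.2 < |q.1| := by
  have hs : 0 < 1 - δ ^ 2 := by nlinarith
  have hs' := Real.sqrt_pos.2 hs
  have he := euclNorm_nonneg q.2
  have hq : 0 ≤ δ * prodNorm q := mul_nonneg h0.le (Real.sqrt_nonneg _)
  have hq' : 0 ≤ δ / √(1 - δ ^ 2) * euclNorm q.2 := by positivity
  rw [← sq_lt_sq₀ hq (abs_nonneg _), ← sq_lt_sq₀ hq' (abs_nonneg _), mul_pow, mul_pow, div_pow, prodNorm,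
    Real.sq_sqrt (by positivity), Real.sq_sqrt hs.le, sq_abs, div_mul_eq_mul_div, div_lt_iff₀ hs]
  constructor <;> intro h <;> nlinarith

/-- The image of `coneRegion` in the product of a line and a coordinate space. -/
def prodConeRegion (n : ℕ) (δ : ℝ) : Set (ℝ × (Fin n → ℝ)) :=
  {q | δ * prodNorm q < |q.1| ∧ ∀ k, δ * prodNorm q < |q.2 k|}

theorem measurableSet_prodConeRegion (n : ℕ) (δ : ℝ) : MeasurableSet (prodConeRegion n δ) := by
  have hc := continuous_prodNorm (n := n)
  have : prodConeRegion n δ = {q | δ * prodNorm q < |q.1|} ∩ ⋂ k, {q | δ * prodNorm q < |q.2 k|} := by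
    ext; simp [prodConeRegion]
  rw [this]
  exact (measurableSet_lt (by fun_prop) (Continuous.measurable (by fun_prop))).inter
    (MeasurableSet.iInter fun k => measurableSet_lt (by fun_prop)
      (Continuous.measurable (by fun_prop)))

/-- The relative error of replacing δ/√(1-δ²) by δ is at most δ², and δ^(2-p) ≤ δ; so the divergent
term may be stated as a pure power of δ. -/
theorem rpow_sub_rpow_le {p δ : ℝ} (hp0 : 0 < p) (hp : p < 1) (h0 : 0 < δ) (h1 : δ < 1) :
    |(δ / √(1 - δ ^ 2)) ^ (-p) - δ ^ (-p)| ≤ δ := by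
  have hs : 0 < 1 - δ ^ 2 := by nlinarith
  have hs1 : 1 - δ ^ 2 ≤ 1 := by nlinarith
  have e : (δ / √(1 - δ ^ 2)) ^ (-p) = δ ^ (-p) * (1 - δ ^ 2) ^ (p / 2) := by
    rw [Real.div_rpow h0.le (Real.sqrt_nonneg _), Real.sqrt_eq_rpow, ← Real.rpow_mul hs.le,
      div_eq_mul_inv, ← Real.rpow_neg hs.le]
    congr 2; ring
  have l1 : (1 - δ ^ 2) ^ (p / 2) ≤ 1 := Real.rpow_le_one hs.le hs1 (by linarith)
  have l2 : 1 - δ ^ 2 ≤ (1 - δ ^ 2) ^ (p / 2) := by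
    calc 1 - δ ^ 2 = (1 - δ ^ 2) ^ (1 : ℝ) := (Real.rpow_one _).symm
      _ ≤ _ := Real.rpow_le_rpow_of_exponent_ge hs hs1 (by linarith)
  have hd := Real.rpow_pos_of_pos h0 (-p)
  rw [e, abs_sub_comm, abs_of_nonneg (by nlinarith)]
  calc δ ^ (-p) - δ ^ (-p) * (1 - δ ^ 2) ^ (p / 2) ≤ δ ^ (-p) * δ ^ (2 : ℝ) := by
        rw [Real.rpow_two]; nlinarith
    _ = δ ^ (2 - p) := by rw [← Real.rpow_add h0]; congr 1; ring
    _ ≤ δ ^ (1 : ℝ) := Real.rpow_le_rpow_of_exponent_ge h0 h1.le (by linarith)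
    _ = δ := Real.rpow_one δ

theorem tendsto_rpow_sub_rpow {p : ℝ} (hp0 : 0 < p) (hp : p < 1) :
    Tendsto (fun δ : ℝ => (δ / √(1 - δ ^ 2)) ^ (-p) - δ ^ (-p)) (𝓝[>] 0) (𝓝 0) := by
  refine squeeze_zero_norm' ?_ (tendsto_nhdsWithin_of_tendsto_nhds tendsto_id)
  filter_upwards [Ioo_mem_nhdsGT one_pos] with δ hδ
  exact rpow_sub_rpow_le hp0 hp hδ.1 hδ.2

theorem ae_pi_ne_zero {n : ℕ} : ∀ᵐ w : Fin n → ℝ, ∀ k, w k ≠ 0 := by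
  refine ae_all_iff.2 fun k => ?_
  exact (Measure.quasiMeasurePreserving_eval (fun _ : Fin n => (volume : Measure ℝ)) k).ae
    (Measure.ae_ne volume 0)

/-- The finite part of an integral with the singularity `|t| ^ (-1 - p)`. -/
theorem tendsto_integral_prodConeRegion {n : ℕ} (hn : 0 < n) {p : ℝ} (hp0 : 0 < p) (hp : p < 1)
    {f : (Fin n → ℝ) → ℝ} (hf : Measurable f)
    (hint : ∀ k, Integrable fun w => f w * |w k| ^ (-p)) :
    (∀ δ, 0 < δ → δ < 1 → Integrable fun q : ℝ × (Fin n → ℝ) =>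
      (prodConeRegion n δ).indicator (fun q => f q.2 * |q.1| ^ (-1 - p)) q) ∧
    ∃ c, Tendsto (fun δ => (∫ q : ℝ × (Fin n → ℝ),
      (prodConeRegion n δ).indicator (fun q => f q.2 * |q.1| ^ (-1 - p)) q) - c * δ ^ (-p))
      (𝓝[>] 0) (𝓝 0) := by
  set F : ℝ → ℝ × (Fin n → ℝ) → ℝ := fun δ =>
    (prodConeRegion n δ).indicator (fun q => f q.2 * |q.1| ^ (-1 - p)) with hF
  have hFm : ∀ δ, Measurable (F δ) := fun δ => ((hf.comp measurable_snd).mul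
    (measurable_fst.norm.pow_const _)).indicator (measurableSet_prodConeRegion n δ)
  have hem : Measurable (euclNorm (n := n)) := continuous_euclNorm.measurable
  have hepos : ∀ᵐ w : Fin n → ℝ, 0 < euclNorm w := by
    filter_upwards [ae_pi_ne_zero (n := n)] with w hw
    exact (abs_pos.2 (hw ⟨0, hn⟩)).trans_le (abs_le_euclNorm w _)
  have he : Integrable fun w => f w * euclNorm w ^ (-p) := by
    refine (hint ⟨0, hn⟩).mono (hf.mul (hem.pow_const _)).aestronglyMeasurable ?_
    filter_upwards [ae_pi_ne_zero (n := n)] with w hw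
    rw [norm_mul, norm_mul, Real.norm_of_nonneg (by positivity : 0 ≤ |w ⟨0, hn⟩| ^ (-p)),
      Real.norm_of_nonneg (Real.rpow_nonneg (euclNorm_nonneg w) _)]
    gcongr ?_ * ?_
    exact Real.rpow_le_rpow_of_nonpos (abs_pos.2 (hw _)) (abs_le_euclNorm w _) (by linarith)
  -- `D` keeps only the cut-off in the first variable, which then has a threshold proportional to
  -- the norm of the others, so that its integral is explicit.
  set D : ℝ → ℝ × (Fin n → ℝ) → ℝ := fun δ q =>
    f q.2 * rpowTail p (δ / √(1 - δ ^ 2) * euclNorm q.2) q.1 with hD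
  have hδ' : ∀ δ : ℝ, 0 < δ → δ < 1 → 0 < δ / √(1 - δ ^ 2) := fun δ h0 h1 =>
    div_pos h0 (Real.sqrt_pos.2 (by nlinarith))
  have hDi : ∀ δ, 0 < δ → δ < 1 → Integrable (D δ) ∧
      ∫ q, D δ q = 2 / p * ((δ / √(1 - δ ^ 2)) ^ (-p) * ∫ w, f w * euclNorm w ^ (-p)) := by
    intro δ h0 h1
    have hs := hδ' δ h0 h1
    have e : ∀ w : Fin n → ℝ, f w * (δ / √(1 - δ ^ 2) * euclNorm w) ^ (-p) =
        (δ / √(1 - δ ^ 2)) ^ (-p) * (f w * euclNorm w ^ (-p)) := fun w => by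
      rw [Real.mul_rpow hs.le (euclNorm_nonneg w)]; ring
    have := integrable_mul_rpowTail hp0 hf (hem.const_mul (δ / √(1 - δ ^ 2)))
      (hepos.mono fun w hw => mul_pos hs hw) (by simp_rw [e]; exact he.const_mul _)
    simp_rw [e, integral_const_mul] at this
    exact this
  -- Where `D` and `F` differ, some |w_k| ≤ δ‖q‖ < |t|, so `R` dominates the difference for all δ at
  -- once; it is integrable by `hint`. The difference tends to 0 almost everywhere, hence in the
  -- mean.
  set R : ℝ × (Fin n → ℝ) → ℝ := fun q => ∑ k, |f q.2| * rpowTail p |q.2 k| q.1 with hR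
  have hRi : Integrable R := integrable_finsetSum _ fun k _ => by
    refine (integrable_mul_rpowTail hp0 (a := fun w => |w k|) hf.norm
      (measurable_pi_apply k).norm ?_ ?_).1
    · filter_upwards [ae_pi_ne_zero (n := n)] with w hw
      exact abs_pos.2 (hw k)
    · refine (hint k).norm.congr (ae_of_all _ fun w => ?_)
      simp only [norm_mul]
      rw [Real.norm_of_nonneg (by positivity : 0 ≤ |w k| ^ (-p))]
  have hDF : ∀ δ, 0 < δ → δ < 1 → ∀ q, q ∈ prodConeRegion n δ → D δ q - F δ q = 0 := by
    intro δ h0 h1 q hq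
    have hq1 := hq.1
    rw [lt_abs_iff_of_prodNorm h0 h1] at hq1
    simp only [hD, hF]
    rw [Set.indicator_of_mem hq, rpowTail, if_pos hq1, sub_self]
  have hDF' : ∀ δ, 0 < δ → δ < 1 → ∀ q, |D δ q - F δ q| ≤ R q := by
    intro δ h0 h1 q
    have hRk : ∀ k, 0 ≤ |f q.2| * rpowTail p |q.2 k| q.1 := fun k =>
      mul_nonneg (abs_nonneg _) (rpowTail_nonneg _ _ _)
    have hR0 : 0 ≤ R q := Finset.sum_nonneg fun k _ => hRk k
    by_cases hq : q ∈ prodConeRegion n δ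
    · rwa [hDF δ h0 h1 q hq, abs_zero]
    · simp only [hF]
      rw [Set.indicator_of_notMem hq, sub_zero]
      simp only [hD]
      by_cases h2 : δ * prodNorm q < |q.1|
      · have : ∃ k, |q.2 k| ≤ δ * prodNorm q := by
          by_contra hcon
          push Not at hcon
          exact hq ⟨h2, hcon⟩
        obtain ⟨k, hk⟩ := this
        calc _ = |f q.2| * rpowTail p |q.2 k| q.1 := by
              rw [abs_mul, abs_of_nonneg (rpowTail_nonneg _ _ _), rpowTail, rpowTail,
                if_pos ((lt_abs_iff_of_prodNorm h0 h1 q).1 h2), if_pos (hk.trans_lt h2)]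
          _ ≤ R q := Finset.single_le_sum (f := fun k => |f q.2| * rpowTail p |q.2 k| q.1)
              (fun k _ => hRk k) (Finset.mem_univ k)
      · rw [rpowTail, if_neg (mt (lt_abs_iff_of_prodNorm h0 h1 q).2 h2), mul_zero, abs_zero]
        exact hR0
  have hDFi : ∀ δ, 0 < δ → δ < 1 → Integrable fun q => D δ q - F δ q := fun δ h0 h1 =>
    hRi.mono' ((hDi δ h0 h1).1.aestronglyMeasurable.sub (hFm δ).aestronglyMeasurable)
      (ae_of_all _ (hDF' δ h0 h1))
  have hFi : ∀ δ, 0 < δ → δ < 1 → Integrable (F δ) := fun δ h0 h1 => by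
    have := (hDi δ h0 h1).1.sub (hDFi δ h0 h1)
    refine this.congr (ae_of_all _ fun q => ?_)
    simp
  have hlim : Tendsto (fun δ => ∫ q, (D δ q - F δ q)) (𝓝[>] 0) (𝓝 0) := by
    rw [show (0 : ℝ) = ∫ _q : ℝ × (Fin n → ℝ), (0 : ℝ) by simp]
    refine tendsto_integral_filter_of_dominated_convergence R ?_ ?_ hRi ?_
    · rw [integral_zero]
      filter_upwards [Ioo_mem_nhdsGT one_pos] with δ hδ
      exact (hDFi δ hδ.1 hδ.2).aestronglyMeasurable
    · rw [integral_zero]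
      filter_upwards [Ioo_mem_nhdsGT one_pos] with δ hδ
      exact ae_of_all _ (hDF' δ hδ.1 hδ.2)
    · have hne : ∀ᵐ q : ℝ × (Fin n → ℝ), q.1 ≠ 0 ∧ ∀ k, q.2 k ≠ 0 := by
        rw [Measure.volume_eq_prod]
        exact (Measure.quasiMeasurePreserving_fst.ae (Measure.ae_ne volume 0)).and
          (Measure.quasiMeasurePreserving_snd.ae ae_pi_ne_zero)
      filter_upwards [hne] with q hq
      refine Tendsto.congr' (f₁ := fun _ => (0 : ℝ)) ?_ tendsto_const_nhds
      rw [integral_zero]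
      have hev : ∀ b : ℝ, 0 < b → ∀ᶠ δ in 𝓝[>] (0 : ℝ), δ * prodNorm q < b := by
        intro b hb
        have : Tendsto (fun δ : ℝ => δ * prodNorm q) (𝓝 0) (𝓝 (0 * prodNorm q)) :=
          tendsto_id.mul_const _
        rw [zero_mul] at this
        exact (this.mono_left nhdsWithin_le_nhds).eventually_lt_const hb
      filter_upwards [Ioo_mem_nhdsGT one_pos, hev _ (abs_pos.2 hq.1),
        eventually_all.2 fun k => hev _ (abs_pos.2 (hq.2 k))] with δ hδ h1 h2
      exact (hDF δ hδ.1 hδ.2 q ⟨h1, h2⟩).symm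
  refine ⟨hFi, 2 / p * ∫ w, f w * euclNorm w ^ (-p), ?_⟩
  have hfin := ((tendsto_rpow_sub_rpow hp0 hp).const_mul
    (2 / p * ∫ w, f w * euclNorm w ^ (-p))).sub hlim
  rw [mul_zero, sub_zero] at hfin
  refine hfin.congr' ?_
  filter_upwards [Ioo_mem_nhdsGT one_pos] with δ hδ
  rw [integral_sub (hDi δ hδ.1 hδ.2).1 (hFi δ hδ.1 hδ.2), (hDi δ hδ.1 hδ.2).2]
  ring

end

section

/-! ### The finite part of the integral of the symmetrized characteristic function -/

theorem prodSin_congr {n : ℕ} {lam lam' : Fin n → ℝ} (h : ∀ i, 1 < lam i ↔ 1 < lam' i)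
    (y : Fin n → ℝ) (z : ℝ) : prodSin lam y z = prodSin lam' y z := by
  refine Finset.prod_congr rfl fun i _ => ?_
  by_cases hi : 1 < lam i
  · rw [sinKernel, sinKernel, if_pos hi, if_pos ((h i).1 hi)]
  · rw [sinKernel, sinKernel, if_neg hi, if_neg (mt (h i).2 hi)]

theorem sinAverage_congr {n : ℕ} {lam lam' : Fin n → ℝ} (h : ∀ i, 1 < lam i ↔ 1 < lam' i)
    (y : Fin n → ℝ) (k : ℕ) : sinAverage lam y k = sinAverage lam' y k := by
  simp only [sinAverage, prodSin_congr h]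

/-- In coordinate j, sin t = (sin t - t) + t. The linear term releases y_j z, so the product over
the other coordinates is averaged against z. -/
theorem sinAverage_zero_eq_add {n : ℕ} {lam : Fin (n + 1) → ℝ} {j : Fin (n + 1)}
    (hj : 1 < lam j) (hlam : ∀ i, i ≠ j → lam i < 1) (y : Fin (n + 1) → ℝ) :
    sinAverage 0 y 0 = sinAverage lam y 0 +
      y j * sinAverage (j.removeNth lam) (j.removeNth y) 1 := by
  have key : ∀ z, prodSin 0 y z = prodSin lam y z +
      y j * (z ^ 1 * prodSin (j.removeNth lam) (j.removeNth y) z) := by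
    intro z
    have e : ∀ i, sinKernel 0 (y (j.succAbove i) * z) =
        sinKernel (lam (j.succAbove i)) (y (j.succAbove i) * z) := fun i => by
      rw [sinKernel, sinKernel, if_neg (by norm_num),
        if_neg (not_lt.2 (hlam _ (Fin.succAbove_ne j i)).le)]
    simp only [prodSin, Fin.prod_univ_succAbove _ j, Pi.zero_apply, Fin.removeNth_apply, e]
    rw [sinKernel, sinKernel, if_neg (by norm_num), if_pos hj]
    ring
  have i1 : Integrable (fun z => prodSin lam y z) stdGauss :=
    ((hasAllMoments_prodSin lam y).2 0).mono' (hasAllMoments_prodSin lam y).1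
      (ae_of_all _ fun z => by simp)
  have i2 : Integrable (fun z => z ^ 1 * prodSin (j.removeNth lam) (j.removeNth y) z) stdGauss :=
    ((hasAllMoments_prodSin (j.removeNth lam) (j.removeNth y)).2 1).mono'
      ((measurable_id.pow_const 1).aestronglyMeasurable.mul (hasAllMoments_prodSin _ _).1)
      (ae_of_all _ fun z => by simp)
  simp only [sinAverage, pow_zero, one_mul]
  rw [← integral_const_mul, ← integral_add i1 (i2.const_mul _)]
  simp_rw [key]

theorem abs_sinAverage_le {n : ℕ} {lam : Fin n → ℝ} (hlam : ∀ i, lam i ≤ 1) (y : Fin n → ℝ)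
    (k : ℕ) : |sinAverage lam y k| ≤ absMoment k := by
  have h0 : ∀ z, prodSin lam y z = prodSin 0 y z := prodSin_congr (fun i => by
    simp only [Pi.zero_apply]; constructor <;> intro h <;> linarith [hlam i]) y
  refine abs_integral_le_integral_abs.trans (integral_mono_of_nonneg
    (ae_of_all _ fun z => abs_nonneg _) (integrable_abs_rpow (by linarith [k.cast_nonneg (α := ℝ)]))
    (ae_of_all _ fun z => ?_))
  simp only [abs_mul, abs_pow, h0, Real.rpow_natCast]
  exact mul_le_of_le_one_right (by positivity) (abs_prodSin_zero_le y z)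

variable {d : ℕ} {α : ℝ} {μ : Measure (EuclideanSpace ℝ (Fin d))} [IsProbabilityMeasure μ]
  {N : EuclideanSpace ℝ (Fin d) → ℝ}

theorem IsStableLaw.integrable_prodSignedPow (hN : IsStableLaw α μ N) {lam : Fin d → ℝ}
    (hlam : ∀ i, 0 ≤ lam i) (hl : ∑ i, lam i < α) :
    Integrable (fun x : EuclideanSpace ℝ (Fin d) => prodSignedPow lam x.ofLp) μ :=
  (hN.integrable_prod_abs_rpow hlam hl).mono'
    ((measurable_prodSignedPow _).comp (by fun_prop)).aestronglyMeasurable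
    (ae_of_all _ fun _ => abs_prodSignedPow_le _ _)

/-- The average of `sinAverage lam` over the law `μ`. -/
def lawAverage (μ : Measure (EuclideanSpace ℝ (Fin d))) (lam u : Fin d → ℝ) : ℝ :=
  ∫ x, sinAverage lam (u * x.ofLp) 0 ∂μ

theorem IsStableLaw.integral_lawAverage (hN : IsStableLaw α μ N) (hd : Even d) {lam : Fin d → ℝ}
    (hlam : ∀ i, 0 ≤ lam i) (hv : ∀ i, ValidExp (lam i)) (hl : ∑ i, lam i < α) :
    Integrable (fun u : EuclideanSpace ℝ (Fin d) =>
      prodSignedPow (fun i => -lam i - 1) u.ofLp * lawAverage μ lam u.ofLp) ∧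
    ∫ u : EuclideanSpace ℝ (Fin d),
        prodSignedPow (fun i => -lam i - 1) u.ofLp * lawAverage μ lam u.ofLp =
      (∫ x, prodSignedPow lam x.ofLp ∂μ) *
        (absMoment (∑ i, lam i) * ∏ i, (2 * sinConst (lam i))) := by
  have hmp := PiLp.volume_preserving_ofLp (Fin d)
  have hz : Integrable (fun x : EuclideanSpace ℝ (Fin d) => 1 * prodSignedPow lam x.ofLp) μ := by
    simpa using hN.integrable_prodSignedPow hlam hl
  have hx : Measurable fun x : EuclideanSpace ℝ (Fin d) => x.ofLp := by fun_prop
  have h1 := integrable_prodSignedPow_mul_average (measurable_sinAverage lam 0)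
    (fun y hy => sinAverage_eq_zero lam y 0 hy) (integrable_prodSignedPow_mul_sinAverage hv 0)
    hx measurable_const hz
  have h2 := integral_prodSignedPow_mul_average (measurable_sinAverage lam 0)
    (fun y hy => sinAverage_eq_zero lam y 0 hy) (integrable_prodSignedPow_mul_sinAverage hv 0)
    hx measurable_const hz
  rw [integral_prodSignedPow_mul_sinAverage hd hv] at h2
  simp only [one_mul] at h1 h2
  refine ⟨hmp.integrable_comp_of_integrable h1, ?_⟩
  rw [← h2]
  exact hmp.integral_comp (MeasurableEquiv.toLp 2 (Fin d → ℝ)).symm.measurableEmbedding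
    (fun u => prodSignedPow (fun i => -lam i - 1) u * ∫ x, sinAverage lam (u * x.ofLp) 0 ∂μ)

/-- Below 1 the regularized kernel is the sine itself, so the integrand is absolutely integrable on
the whole space and the cones may simply be removed. -/
theorem IsStableLaw.tendsto_integral_of_lt_one (hN : IsStableLaw α μ N) (hd : Even d)
    {lam : Fin d → ℝ} (hlam : ∀ i, 0 ≤ lam i) (hlam1 : ∀ i, lam i < 1) (hl : ∑ i, lam i < α) :
    (∀ δ, Integrable fun u => truncatedKernel lam δ u * meanSinAverage μ u) ∧
    Tendsto (fun δ => ∫ u, truncatedKernel lam δ u * meanSinAverage μ u) (𝓝[>] 0)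
      (𝓝 ((∫ x, prodSignedPow lam x.ofLp ∂μ) *
        (absMoment (∑ i, lam i) * ∏ i, (2 * sinConst (lam i))))) := by
  obtain ⟨h1, h2⟩ := hN.integral_lawAverage hd hlam (fun i => Or.inl ⟨hlam i, hlam1 i⟩) hl
  have e : ∀ δ, (fun u => truncatedKernel lam δ u * meanSinAverage μ u) =
      (coneRegion d δ).indicator fun u =>
        prodSignedPow (fun i => -lam i - 1) u.ofLp * lawAverage μ lam u.ofLp := by
    intro δ
    ext u
    have : meanSinAverage μ u = lawAverage μ lam u.ofLp := by
      simp only [meanSinAverage, lawAverage]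
      congr 1
      ext x
      exact sinAverage_congr (fun i => by
        simp only [Pi.zero_apply]; constructor <;> intro h <;> linarith [hlam1 i]) _ _
    rw [this, truncatedKernel]
    by_cases hu : u ∈ coneRegion d δ
    · simp only [Set.indicator_of_mem hu]
    · simp only [Set.indicator_of_notMem hu, zero_mul]
  simp_rw [e]
  refine ⟨fun δ => h1.indicator (measurableSet_coneRegion δ), ?_⟩
  rw [← h2]
  exact tendsto_integral_indicator_coneRegion h1

/-- A point of Euclidean space, split into one coordinate and the others. -/
def splitCoord {n : ℕ} (j : Fin (n + 1)) (u : EuclideanSpace ℝ (Fin (n + 1))) :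
    ℝ × (Fin n → ℝ) := (u j, j.removeNth u.ofLp)

theorem measurePreserving_splitCoord {n : ℕ} (j : Fin (n + 1)) :
    MeasurePreserving (splitCoord j) :=
  (volume_preserving_piFinSuccAbove (fun _ : Fin (n + 1) => ℝ) j).comp
    (PiLp.volume_preserving_ofLp (Fin (n + 1)))

theorem measurableEmbedding_splitCoord {n : ℕ} (j : Fin (n + 1)) :
    MeasurableEmbedding (splitCoord j) :=
  (MeasurableEquiv.piFinSuccAbove (fun _ : Fin (n + 1) => ℝ) j).measurableEmbedding.comp
    (MeasurableEquiv.toLp 2 (Fin (n + 1) → ℝ)).symm.measurableEmbedding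

theorem prodNorm_splitCoord {n : ℕ} (j : Fin (n + 1)) (u : EuclideanSpace ℝ (Fin (n + 1))) :
    prodNorm (splitCoord j u) = ‖u‖ := by
  rw [prodNorm, euclNorm, Real.sq_sqrt (Finset.sum_nonneg fun _ _ => sq_nonneg _),
    EuclideanSpace.norm_eq, Fin.sum_univ_succAbove _ j]
  simp [splitCoord, Fin.removeNth_apply]

theorem splitCoord_mem_prodConeRegion {n : ℕ} (j : Fin (n + 1)) (δ : ℝ)
    (u : EuclideanSpace ℝ (Fin (n + 1))) :
    splitCoord j u ∈ prodConeRegion n δ ↔ u ∈ coneRegion (n + 1) δ := by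
  simp only [prodConeRegion, coneRegion, Set.mem_ofPred_eq, prodNorm_splitCoord]
  rw [Fin.forall_iff_succAbove j]
  rfl

theorem signedPow_mul_self (t : ℝ) {l : ℝ} (hl : l ≠ 0) :
    signedPow t (-l - 1) * t = |t| ^ (-1 - (l - 1)) := by
  rw [show -1 - (l - 1) = -l by ring]
  rcases eq_or_ne t 0 with rfl | ht
  · simp [Real.zero_rpow (neg_ne_zero.2 hl)]
  · have hs : t.sign * t = |t| := by
      rcases lt_or_gt_of_ne ht with h | h
      · rw [Real.sign_of_neg h, abs_of_neg h, neg_one_mul]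
      · rw [Real.sign_of_pos h, abs_of_pos h, one_mul]
    rw [signedPow, mul_assoc, hs, ← Real.rpow_add_one (abs_pos.2 ht).ne']
    congr 1; ring

theorem signedPow_mul_rpow {t : ℝ} (l p : ℝ) :
    signedPow t (-l - 1) * |t| ^ (-p) = signedPow t (-(l + p) - 1) := by
  rcases eq_or_ne t 0 with rfl | ht
  · simp
  · rw [signedPow, signedPow, mul_right_comm, ← Real.rpow_add (abs_pos.2 ht)]
    congr 2; ring

/-- The regularized part converges as in the case of small exponents. The linear part is a function
f of the other coordinates times |u_j|^(-1-p) with p = λ_j - 1, and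
`tendsto_integral_prodConeRegion` shows that it amounts to the divergent term alone. -/
theorem IsStableLaw.exists_tendsto_of_one_lt {n : ℕ}
    {μ : Measure (EuclideanSpace ℝ (Fin (n + 1)))} [IsProbabilityMeasure μ]
    {N : EuclideanSpace ℝ (Fin (n + 1)) → ℝ} (hN : IsStableLaw α μ N) (hd : Even (n + 1))
    {lam : Fin (n + 1) → ℝ} (hlam : ∀ i, 0 ≤ lam i) {j : Fin (n + 1)} (hj : 1 < lam j)
    (hl : ∑ i, lam i < α) :
    (∀ δ, 0 < δ → δ < 1 → Integrable fun u => truncatedKernel lam δ u * meanSinAverage μ u) ∧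
    ∃ c : ℝ, Tendsto (fun δ => (∫ u, truncatedKernel lam δ u * meanSinAverage μ u) -
        c * δ ^ (1 - lam j)) (𝓝[>] 0)
      (𝓝 ((∫ x, prodSignedPow lam x.ofLp ∂μ) *
        (absMoment (∑ i, lam i) * ∏ i, (2 * sinConst (lam i))))) := by
  have hn : 0 < n := by
    rcases Nat.eq_zero_or_pos n with rfl | h
    · exact absurd hd (by decide)
    · exact h
  have hα2 := hN.le_two
  have hsplit : ∑ i, lam i = lam j + ∑ k, lam (j.succAbove k) := Fin.sum_univ_succAbove _ j
  -- Since the total is below α ≤ 2, all other exponents are below 1, and they stay below 1 when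
  -- increased by p.
  have hpair : ∀ k, lam j + lam (j.succAbove k) ≤ ∑ i, lam i := fun k => by
    rw [hsplit]
    gcongr
    exact Finset.single_le_sum (f := fun k => lam (j.succAbove k)) (fun k _ => hlam _)
      (Finset.mem_univ k)
  have hlam1 : ∀ k, lam (j.succAbove k) < 1 := fun k => by linarith [hpair k]
  have hlam1' : ∀ i, i ≠ j → lam i < 1 := fun i hi => by
    obtain ⟨k, rfl⟩ := Fin.exists_succAbove_eq hi
    exact hlam1 k
  have hrest : 0 ≤ ∑ k, lam (j.succAbove k) := Finset.sum_nonneg fun k _ => hlam _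
  set p := lam j - 1 with hp
  have hp0 : 0 < p := by linarith
  have hp1 : p < 1 := by linarith
  have hv : ∀ i, ValidExp (lam i) := fun i => by
    rcases eq_or_ne i j with rfl | hi
    · exact Or.inr ⟨hj, by linarith⟩
    · exact Or.inl ⟨hlam i, hlam1' i hi⟩
  set lam' : Fin n → ℝ := j.removeNth lam with hlam'
  set W : (Fin n → ℝ) → ℝ := fun w =>
    ∫ x : EuclideanSpace ℝ (Fin (n + 1)), x j * sinAverage lam' (w * j.removeNth x.ofLp) 1 ∂μ
    with hW
  have hxm : Measurable fun x : EuclideanSpace ℝ (Fin (n + 1)) => j.removeNth x.ofLp :=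
    measurable_snd.comp (measurePreserving_splitCoord j).measurable
  have hxj : Measurable fun x : EuclideanSpace ℝ (Fin (n + 1)) => x j := by fun_prop
  have hWm : Measurable W := by
    have : Measurable fun q : (Fin n → ℝ) × EuclideanSpace ℝ (Fin (n + 1)) =>
        q.2 j * sinAverage lam' (q.1 * j.removeNth q.2.ofLp) 1 :=
      (hxj.comp measurable_snd).mul ((measurable_sinAverage lam' 1).comp
        (measurable_fst.mul (hxm.comp measurable_snd)))
    exact (this.stronglyMeasurable.integral_prod_right' (ν := μ)).measurable
  set f : (Fin n → ℝ) → ℝ := fun w => prodSignedPow (fun k => -lam' k - 1) w * W w with hf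
  have hfm : Measurable f := (measurable_prodSignedPow _).mul hWm
  have habs1 : Integrable (fun x : EuclideanSpace ℝ (Fin (n + 1)) => x j) μ := by
    have := hN.integrable_prod_abs_rpow (p := Pi.single j 1)
      (fun i => by by_cases h : i = j <;> simp [h])
      (by simp; linarith)
    refine this.mono' hxj.aestronglyMeasurable (ae_of_all _ fun x => ?_)
    rw [Finset.prod_eq_single_of_mem j (Finset.mem_univ _) fun i _ hi => by
      simp [hi]]
    simp
  have hdec : ∀ u : EuclideanSpace ℝ (Fin (n + 1)), meanSinAverage μ u =
      lawAverage μ lam u.ofLp + u j * W (j.removeNth u.ofLp) := by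
    intro u
    have i0 : Integrable (fun x : EuclideanSpace ℝ (Fin (n + 1)) =>
        sinAverage 0 (u.ofLp * x.ofLp) 0) μ :=
      (integrable_const (absMoment (0 : ℕ))).mono'
        ((measurable_sinAverage 0 0).comp (by fun_prop)).aestronglyMeasurable
        (ae_of_all _ fun x => abs_sinAverage_le (fun _ => zero_le_one) _ _)
    have i1 : Integrable (fun x : EuclideanSpace ℝ (Fin (n + 1)) => u j * (x j *
        sinAverage lam' (j.removeNth u.ofLp * j.removeNth x.ofLp) 1)) μ := by
      refine Integrable.const_mul ((habs1.norm.mul_const (absMoment (1 : ℕ))).mono'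
        (hxj.mul ((measurable_sinAverage lam' 1).comp
          (measurable_const.mul hxm))).aestronglyMeasurable (ae_of_all _ fun x => ?_)) _
      refine (norm_mul _ _).trans_le ?_
      gcongr
      exact abs_sinAverage_le (fun k => (hlam1 k).le) _ _
    have e : ∀ x : EuclideanSpace ℝ (Fin (n + 1)), sinAverage lam (u.ofLp * x.ofLp) 0 =
        sinAverage 0 (u.ofLp * x.ofLp) 0 - u j * (x j *
          sinAverage lam' (j.removeNth u.ofLp * j.removeNth x.ofLp) 1) := by
      intro x
      rw [sinAverage_zero_eq_add hj hlam1' (u.ofLp * x.ofLp), Pi.mul_apply, mul_assoc]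
      exact (add_sub_cancel_right _ _).symm
    simp only [lawAverage, e, hW]
    rw [integral_sub i0 i1, integral_const_mul]
    simp [meanSinAverage]
  have hfint : ∀ k, Integrable fun w => f w * |w k| ^ (-p) := by
    intro k
    -- The factor |w_k|^(-p) is absorbed by raising the k-th exponent by p. With the extra factor
    -- x_j the moment needed has total order 1 + p plus the other exponents, which is again λ, hence
    -- finite.
    set lam'' : Fin n → ℝ := lam' + Pi.single k p with hlam''
    have hk1 : ∀ i, 0 ≤ lam'' i ∧ lam'' i < 1 := by
      intro i
      rcases eq_or_ne i k with rfl | hi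
      · simp only [hlam'', Pi.add_apply, Pi.single_eq_same]
        exact ⟨add_nonneg (hlam _) hp0.le, by
          have := hpair i
          simp only [hlam', Fin.removeNth_apply]; linarith⟩
      · simp only [hlam'', Pi.add_apply, Pi.single_eq_of_ne hi, add_zero]
        exact ⟨hlam _, hlam1 i⟩
    have hcongr : ∀ y, sinAverage lam'' y 1 = sinAverage lam' y 1 := fun y =>
      sinAverage_congr (fun i => ⟨fun h => absurd h (not_lt.2 (hk1 i).2.le),
        fun h => absurd h (not_lt.2 (hlam1 i).le)⟩) y 1
    have hz : Integrable (fun x : EuclideanSpace ℝ (Fin (n + 1)) =>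
        x j * prodSignedPow lam'' (j.removeNth x.ofLp)) μ := by
      have := hN.integrable_prod_abs_rpow (p := j.insertNth 1 lam'') ((Fin.forall_iff_succAbove j).2 ⟨by simp, fun k => by simpa using (hk1 k).1⟩) (by
          rw [Fin.sum_univ_succAbove _ j]
          simp only [Fin.insertNth_apply_same, Fin.insertNth_apply_succAbove, hlam'',
            Pi.add_apply, Finset.sum_add_distrib, Finset.sum_pi_single', Finset.mem_univ, if_true]
          simp only [hlam', Fin.removeNth_apply]
          linarith)
      refine this.mono' (hxj.mul ((measurable_prodSignedPow _).comp hxm)).aestronglyMeasurable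
        (ae_of_all _ fun x => ?_)
      rw [Fin.prod_univ_succAbove _ j, norm_mul]
      simp only [Fin.insertNth_apply_same, Fin.insertNth_apply_succAbove, Real.rpow_one]
      exact mul_le_mul_of_nonneg_left (abs_prodSignedPow_le _ _) (abs_nonneg _)
    have h1 := integrable_prodSignedPow_mul_average (measurable_sinAverage lam'' 1)
      (fun y hy => sinAverage_eq_zero lam'' y 1 hy)
      (integrable_prodSignedPow_mul_sinAverage (fun i => Or.inl (hk1 i)) 1) hxm hxj hz
    simp only [hcongr] at h1
    refine h1.congr (ae_of_all _ fun w => ?_)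
    simp only [hf]
    rw [mul_right_comm]
    congr 1
    simp only [prodSignedPow]
    rw [← Finset.mul_prod_erase _ _ (Finset.mem_univ k),
      ← Finset.mul_prod_erase _ (fun i => signedPow (w i) (-lam' i - 1)) (Finset.mem_univ k),
      mul_right_comm, signedPow_mul_rpow]
    congr 1
    · simp [hlam'']
    · refine Finset.prod_congr rfl fun i hi => ?_
      simp [hlam'', Pi.single_eq_of_ne (Finset.ne_of_mem_erase hi)]
  obtain ⟨hA1, hA2⟩ := hN.integral_lawAverage hd hlam hv hl
  obtain ⟨hB1, c, hB2⟩ := tendsto_integral_prodConeRegion hn hp0 hp1 hfm hfint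
  have hkey : ∀ δ u, truncatedKernel lam δ u * meanSinAverage μ u =
      (coneRegion (n + 1) δ).indicator (fun u =>
        prodSignedPow (fun i => -lam i - 1) u.ofLp * lawAverage μ lam u.ofLp) u +
      (prodConeRegion n δ).indicator (fun q => f q.2 * |q.1| ^ (-1 - p)) (splitCoord j u) := by
    intro δ u
    by_cases hu : u ∈ coneRegion (n + 1) δ
    · rw [truncatedKernel, Set.indicator_of_mem hu, Set.indicator_of_mem hu,
        Set.indicator_of_mem ((splitCoord_mem_prodConeRegion j δ u).2 hu), hdec, mul_add]
      congr 1
      simp only [splitCoord, hf, hp, prodSignedPow]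
      rw [← signedPow_mul_self _ (zero_lt_one.trans hj).ne', Fin.prod_univ_succAbove _ j]
      simp only [hlam', Fin.removeNth_apply]
      ring
    · rw [truncatedKernel, Set.indicator_of_notMem hu, Set.indicator_of_notMem hu,
        Set.indicator_of_notMem (mt (splitCoord_mem_prodConeRegion j δ u).1 hu)]
      simp
  have hBi : ∀ δ, 0 < δ → δ < 1 → Integrable fun u : EuclideanSpace ℝ (Fin (n + 1)) =>
      (prodConeRegion n δ).indicator (fun q => f q.2 * |q.1| ^ (-1 - p)) (splitCoord j u) :=
    fun δ h0 h1 => (measurePreserving_splitCoord j).integrable_comp_of_integrable (hB1 δ h0 h1)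
  simp_rw [hkey]
  refine ⟨fun δ h0 h1 => (hA1.indicator (measurableSet_coneRegion δ)).add (hBi δ h0 h1), c, ?_⟩
  have hlim := (tendsto_integral_indicator_coneRegion hA1).add hB2
  rw [hA2, add_zero] at hlim
  refine hlim.congr' ?_
  filter_upwards [Ioo_mem_nhdsGT one_pos] with δ hδ
  rw [integral_add (hA1.indicator (measurableSet_coneRegion δ)) (hBi δ hδ.1 hδ.2),
    (measurePreserving_splitCoord j).integral_comp (measurableEmbedding_splitCoord j)
      fun q => (prodConeRegion n δ).indicator (fun q => f q.2 * |q.1| ^ (-1 - p)) q,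
    show 1 - lam j = -p by rw [hp]; ring]
  ring

theorem IsStableLaw.exists_tendsto (hN : IsStableLaw α μ N) (hd : Even d) {lam : Fin d → ℝ}
    (hlam : ∀ i, 0 ≤ lam i) (hlam1 : ∀ i, lam i ≠ 1) (hl : ∑ i, lam i < α) :
    (∀ᶠ δ in 𝓝[>] (0 : ℝ), Integrable fun u => truncatedKernel lam δ u * meanSinAverage μ u) ∧
    ∃ c : Fin d → ℝ, Tendsto (fun δ => (∫ u, truncatedKernel lam δ u * meanSinAverage μ u) -
        ∑ i with 1 < lam i, c i * δ ^ (1 - lam i)) (𝓝[>] 0)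
      (𝓝 ((∫ x, prodSignedPow lam x.ofLp ∂μ) *
        (absMoment (∑ i, lam i) * ∏ i, (2 * sinConst (lam i))))) := by
  by_cases h : ∃ j, 1 < lam j
  · obtain ⟨j, hj⟩ := h
    obtain _ | n := d
    · exact j.elim0
    obtain ⟨h1, c, h2⟩ := hN.exists_tendsto_of_one_lt hd hlam hj hl
    refine ⟨?_, fun _ => c, ?_⟩
    · filter_upwards [Ioo_mem_nhdsGT one_pos] with δ hδ
      exact h1 δ hδ.1 hδ.2
    · have : (Finset.univ.filter fun i => 1 < lam i) = {j} := by
        ext i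
        simp only [Finset.mem_filter, Finset.mem_univ, true_and, Finset.mem_singleton]
        refine ⟨fun hi => ?_, fun hi => hi ▸ hj⟩
        by_contra hne
        -- Two exponents above 1 would exceed α ≤ 2.
        have : lam i + lam j ≤ ∑ i, lam i := by
          rw [← Finset.sum_pair hne]
          exact Finset.sum_le_sum_of_subset_of_nonneg (Finset.subset_univ _) fun k _ _ => hlam k
        linarith [hN.le_two]
      simpa only [this, Finset.sum_singleton] using h2
  · push Not at h
    obtain ⟨h1, h2⟩ := hN.tendsto_integral_of_lt_one hd hlam
      (fun i => lt_of_le_of_ne (h i) (hlam1 i)) hl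
    refine ⟨Eventually.of_forall h1, 0, ?_⟩
    simpa using h2

end

section

/-! ### Star bodies -/

variable {d : ℕ}

theorem gauge_smul_eq_abs_mul {F : Set (EuclideanSpace ℝ (Fin d))} (hF : IsCentredStarBody F)
    (t : ℝ) (u : EuclideanSpace ℝ (Fin d)) : gauge F (t • u) = |t| * gauge F u := by
  rcases le_total 0 t with h | h
  · rw [gauge_smul_of_nonneg h, abs_of_nonneg h, smul_eq_mul]
  · rw [← gauge_neg hF.neg_mem, ← neg_smul, gauge_smul_of_nonneg (neg_nonneg.2 h),
      abs_of_nonpos h, smul_eq_mul]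

theorem mem_nhds_zero {F : Set (EuclideanSpace ℝ (Fin d))} (hF : IsCentredStarBody F) :
    F ∈ 𝓝 (0 : EuclideanSpace ℝ (Fin d)) := mem_interior_iff_mem_nhds.1 hF.zero_mem_interior

/-- Points of gauge below 1 lie in F because it is star-shaped; a point of gauge 1 is the limit of
its multiples t u as t ↑ 1, and F is closed. -/
theorem mem_iff_gauge_le_one {F : Set (EuclideanSpace ℝ (Fin d))} (hF : IsCentredStarBody F)
    (u : EuclideanSpace ℝ (Fin d)) : u ∈ F ↔ gauge F u ≤ 1 := by
  refine ⟨gauge_le_one_of_mem, fun h => ?_⟩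
  have hlt : ∀ v, gauge F v < 1 → v ∈ F := by
    intro v hv
    obtain ⟨r, hr0, hr1, w, hw, rfl⟩ := exists_lt_of_gauge_lt
      (absorbent_nhds_zero (mem_nhds_zero hF)) hv
    exact interior_subset (hF.smul_mem_interior w hw r hr0.le hr1)
  have ht : Tendsto (fun t : ℝ => t • u) (𝓝[<] 1) (𝓝 u) := by
    have : Tendsto (fun t : ℝ => t • u) (𝓝 1) (𝓝 ((1 : ℝ) • u)) := tendsto_id.smul_const u
    rw [one_smul] at this
    exact this.mono_left nhdsWithin_le_nhds
  refine hF.isClosed.mem_of_tendsto ht ?_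
  filter_upwards [Ioo_mem_nhdsLT one_pos] with t ht
  refine hlt _ ?_
  rw [gauge_smul_eq_abs_mul hF, abs_of_pos ht.1]
  calc t * gauge F u ≤ t * 1 := by gcongr; exact ht.1.le
    _ < 1 := by linarith [ht.2]

theorem isStableLaw_of_isAssociatedStarBody {Ω : Type*} [MeasurableSpace Ω] {P : Measure Ω}
    {α : ℝ} (hα₀ : 0 < α) (hα₂ : α ≤ 2) {ξ : Ω → EuclideanSpace ℝ (Fin d)}
    {F : Set (EuclideanSpace ℝ (Fin d))} (hF : IsAssociatedStarBody α ξ P F) :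
    IsStableLaw α (P.map ξ) (gauge F) where
  pos := hα₀
  le_two := hα₂
  continuous := hF.isCentredStarBody.continuous_gauge
  nonneg := gauge_nonneg
  map_smul := gauge_smul_eq_abs_mul hF.isCentredStarBody
  charFun_eq := hF.charFun_eq

/-! ### The moment formula -/

variable {α : ℝ} {μ : Measure (EuclideanSpace ℝ (Fin d))}
  {N : EuclideanSpace ℝ (Fin d) → ℝ} {F : Set (EuclideanSpace ℝ (Fin d))}

theorem integral_prodSignedPow_eq_zero (hμ : μ.map (fun x => -x) = μ) (hd : Odd d)
    (lam : Fin d → ℝ) : ∫ x : EuclideanSpace ℝ (Fin d), prodSignedPow lam x.ofLp ∂μ = 0 := by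
  have hm : Measurable fun x : EuclideanSpace ℝ (Fin d) => prodSignedPow lam x.ofLp :=
    (measurable_prodSignedPow _).comp (by fun_prop)
  have h1 := integral_map (μ := μ) (φ := fun x : EuclideanSpace ℝ (Fin d) => -x)
    measurable_neg.aemeasurable hm.aestronglyMeasurable
  have h2 : ∀ x : EuclideanSpace ℝ (Fin d),
      prodSignedPow lam (-x).ofLp = -prodSignedPow lam x.ofLp := fun x => by
    simp [prodSignedPow, signedPow_neg, Finset.prod_neg, hd.neg_one_pow]
  rw [hμ] at h1
  simp_rw [h2, integral_neg] at h1
  linarith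

variable [IsProbabilityMeasure μ]

theorem truncatedBody_eq (hFN : ∀ u, u ∈ F ↔ N u ≤ 1) (ε δ : ℝ) :
    truncatedBody F ε δ = ({u | N u ≤ 1} ∩ {u | ε < ‖u‖}) ∩ coneRegion d δ := by
  ext u
  simp only [truncatedBody, coneRegion, Set.mem_inter_iff, Set.mem_ofPred_eq, hFN,
    mem_closedBall_zero_iff, not_le, and_assoc]

theorem IsStableLaw.integrableOn_truncatedBody (hN : IsStableLaw α μ N)
    (h0 : ¬ ∀ᵐ x ∂μ, x = 0) (hd : 0 < d) (hFN : ∀ u, u ∈ F ↔ N u ≤ 1) {lam : Fin d → ℝ}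
    (hlam : ∀ i, 0 ≤ lam i) {ε δ : ℝ} (hε : 0 < ε) (hδ : 0 < δ) :
    IntegrableOn (fun u : EuclideanSpace ℝ (Fin d) => prodSignedPow (fun i => -lam i - 1) u.ofLp)
      (truncatedBody F ε δ) := by
  have h1 := hN.integrableOn_body h0 (isAnnularKernel_truncatedKernel hd hlam hδ) hε
  rw [truncatedBody_eq hFN, Set.inter_comm _ (coneRegion d δ), IntegrableOn,
    ← Measure.restrict_restrict (measurableSet_coneRegion δ)]
  exact (integrable_indicator_iff (measurableSet_coneRegion δ)).1 h1

theorem setIntegral_truncatedBody (hFN : ∀ u, u ∈ F ↔ N u ≤ 1) (lam : Fin d → ℝ) (ε δ : ℝ) :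
    ∫ u in truncatedBody F ε δ, prodSignedPow (fun i => -lam i - 1) u.ofLp =
      bodyIntegral N (truncatedKernel lam δ) ε := by
  rw [truncatedBody_eq hFN, bodyIntegral]
  exact (setIntegral_indicator (measurableSet_coneRegion δ)).symm

/-- For fixed δ the truncated integral is an explicit multiple of the sine-side integral, whose
expansion as δ → 0 is known. The absolute moment of the Gaussian occurs on both sides and cancels.
-/
theorem IsStableLaw.hasRegularizedIntegral (hN : IsStableLaw α μ N) (h0 : ¬ ∀ᵐ x ∂μ, x = 0)
    (hd : 0 < d) (hde : Even d) (hFN : ∀ u, u ∈ F ↔ N u ≤ 1)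
    (hF0 : F ∈ 𝓝 (0 : EuclideanSpace ℝ (Fin d))) {lam : Fin d → ℝ} (hlam : ∀ i, 0 ≤ lam i)
    (hlam1 : ∀ i, lam i ≠ 1) (hl : ∑ i, lam i < α) {c : ℝ} (hc : (c : ℂ) = Complex.I ^ d) :
    HasRegularizedIntegral F lam (c / Real.Gamma (1 - (∑ i, lam i) / α) *
      ((∫ x, prodSignedPow lam x.ofLp ∂μ) * ∏ i, (2 * sinConst (lam i)))) := by
  refine ⟨fun ε δ hε hδ => hN.integrableOn_truncatedBody h0 hd hFN hlam hε hδ, ?_⟩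
  obtain ⟨η₀, hη₀, hball⟩ := Metric.nhds_basis_closedBall.mem_iff.1 hF0
  have hball' : ∀ u, ‖u‖ ≤ η₀ → N u ≤ 1 := fun u hu =>
    (hFN u).1 (hball (mem_closedBall_zero_iff.2 hu))
  obtain ⟨hint, b, hlim⟩ := hN.exists_tendsto hde hlam hlam1 hl
  have hm : absMoment (∑ i, lam i) ≠ 0 := (absMoment_pos
    (by linarith [Finset.sum_nonneg fun i (_ : i ∈ Finset.univ) => hlam i])).ne'
  have hG : Real.Gamma (1 - (∑ i, lam i) / α) ≠ 0 :=
    (Real.Gamma_pos_of_pos (by rw [sub_pos, div_lt_one hN.pos]; exact hl)).ne'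
  set K := absMoment (∑ i, lam i) * Real.Gamma (1 - (∑ i, lam i) / α) with hK
  have hK0 : K ≠ 0 := mul_ne_zero hm hG
  -- Below the inradius η₀ nothing depends on ε, so the inner limit is constant and the limit in ε
  -- is trivial.
  refine ⟨fun _ => _, fun _ i => c / K * b i, ?_, tendsto_const_nhds⟩
  filter_upwards [Ioo_mem_nhdsGT hη₀] with ε hε
  have hlim' := hlim.const_mul (c / K)
  have hval : c / K * ((∫ x, prodSignedPow lam x.ofLp ∂μ) *
      (absMoment (∑ i, lam i) * ∏ i, (2 * sinConst (lam i)))) =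
      c / Real.Gamma (1 - (∑ i, lam i) / α) *
        ((∫ x, prodSignedPow lam x.ofLp ∂μ) * ∏ i, (2 * sinConst (lam i))) := by
    rw [hK]; field_simp
  rw [hval] at hlim'
  refine hlim'.congr' ?_
  filter_upwards [hint, self_mem_nhdsWithin] with δ hδi hδ
  have hδ : 0 < δ := hδ
  have h1 := hN.gamma_mul_bodyIntegral h0 hd hlam hl hδ hc hη₀ hball' hδi
  have h2 := setIntegral_truncatedBody hFN lam ε δ
  rw [hN.bodyIntegral_eq h0 (isAnnularKernel_truncatedKernel hd hlam hδ) hball' hε.1 hε.2.le] at h2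
  have h3 : ∫ u in truncatedBody F ε δ, ∏ i, signedPow (u i) (-lam i - 1) =
      c / K * ∫ u, truncatedKernel lam δ u * meanSinAverage μ u := by
    rw [div_mul_eq_mul_div, eq_div_iff hK0, ← h1, hK]
    refine (congrArg (· * _) h2).trans ?_
    ring
  rw [h3, mul_sub, Finset.mul_sum]
  simp only [mul_assoc]

theorem hasPrincipalValue_of_lt_one {lam : Fin d → ℝ} {L : ℝ}
    (h : HasRegularizedIntegral F lam L) (hlam : ∀ i, lam i < 1) :
    HasPrincipalValue F (fun u => ∏ i, signedPow (u i) (-lam i - 1)) L := by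
  obtain ⟨h1, J, c, h2, h3⟩ := h
  refine ⟨h1, J, ?_, h3⟩
  have : (Finset.univ.filter fun i => 1 < lam i) = ∅ :=
    Finset.filter_eq_empty_iff.2 fun i _ => not_lt.2 (hlam i).le
  simpa only [this, Finset.sum_empty, sub_zero] using h2

theorem prod_gamma_mul_prod_sinConst {lam : Fin d → ℝ} (hlam : ∀ i, 0 ≤ lam i)
    (hlam1 : ∀ i, lam i ≠ 1) (hlam2 : ∀ i, lam i < 2) :
    (2 : ℝ) ^ (∑ i, lam i) / Real.pi ^ ((d : ℝ) / 2) *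
      (∏ i, Real.Gamma (1 + lam i / 2) / Real.Gamma (1 / 2 - lam i / 2)) *
      ∏ i, (2 * sinConst (lam i)) = 1 := by
  have hpi : Real.pi ^ ((d : ℝ) / 2) = ∏ _i : Fin d, √Real.pi := by
    rw [Finset.prod_const, Finset.card_univ, Fintype.card_fin, Real.sqrt_eq_rpow,
      ← Real.rpow_mul_natCast Real.pi_pos.le]
    congr 1; ring
  rw [hpi, Real.rpow_sum_of_pos two_pos, ← Finset.prod_div_distrib, ← Finset.prod_mul_distrib,
    ← Finset.prod_mul_distrib]
  refine Finset.prod_eq_one fun i _ => ?_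
  -- `Real.Gamma` takes the value 0 at its poles, which correspond to exponents 1, 3, 5, …; these
  -- are excluded.
  have hG : Real.Gamma (1 / 2 - lam i / 2) ≠ 0 := by
    refine Real.Gamma_ne_zero fun m hm => ?_
    rcases m with _ | m
    · exact hlam1 i (by push_cast at hm; linarith)
    · push_cast at hm
      have : (0 : ℝ) ≤ m := m.cast_nonneg
      linarith [hlam2 i]
  have hv : ValidExp (lam i) := (lt_or_gt_of_ne (hlam1 i)).imp (fun h => ⟨hlam i, h⟩)
    fun h => ⟨h, hlam2 i⟩
  calc _ = 2 * sinConst (lam i) * (2 ^ lam i / √Real.pi * Real.Gamma (1 + lam i / 2)) /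
        Real.Gamma (1 / 2 - lam i / 2) := by ring
    _ = 1 := by rw [sinConst_eq hv, div_self hG]

theorem exists_ofReal_eq_I_pow (hd : Even d) :
    ∃ c : ℝ, (c : ℂ) = Complex.I ^ d ∧ c * c = 1 := by
  obtain ⟨k, rfl⟩ := hd
  refine ⟨(-1) ^ k, ?_, ?_⟩
  · rw [← two_mul, pow_mul, Complex.I_sq]; push_cast; rfl
  · rw [← mul_pow]; simp

theorem sign_prod (x : Fin d → ℝ) : Real.sign (∏ i, x i) = ∏ i, Real.sign (x i) := by
  induction d with
  | zero => simp
  | succ n ih =>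
    rw [Fin.prod_univ_succ, Fin.prod_univ_succ, ← ih fun i => x i.succ, sign_mul_sign]

theorem signedPow_zero_right (t : ℝ) : signedPow t 0 = Real.sign t := by simp [signedPow]

theorem signedPow_neg_one (t : ℝ) : signedPow t (-0 - 1) = 1 / t := by
  rw [neg_zero, zero_sub, signedPow, Real.rpow_neg_one]
  rcases lt_trichotomy t 0 with h | rfl | h
  · rw [Real.sign_of_neg h, abs_of_neg h, inv_neg, one_div]; ring
  · simp
  · rw [Real.sign_of_pos h, abs_of_pos h, one_div, mul_one]

theorem IsStableLaw.integral_eq (hN : IsStableLaw α μ N) (h0 : ¬ ∀ᵐ x ∂μ, x = 0)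
    (hd : 0 < d) (hde : Even d) (hFN : ∀ u, u ∈ F ↔ N u ≤ 1)
    (hF0 : F ∈ 𝓝 (0 : EuclideanSpace ℝ (Fin d))) {lam : Fin d → ℝ} (hlam : ∀ i, 0 ≤ lam i)
    (hlam1 : ∀ i, lam i ≠ 1) (hl : ∑ i, lam i < α) :
    ∃ L : ℝ, HasRegularizedIntegral F lam L ∧
      ((∫ x : EuclideanSpace ℝ (Fin d), prodSignedPow lam x.ofLp ∂μ : ℝ) : ℂ) =
        (((2 : ℝ) ^ (∑ i, lam i) : ℝ) : ℂ) * Complex.I ^ d /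
            ((Real.pi ^ ((d : ℝ) / 2) : ℝ) : ℂ) *
          ((Real.Gamma (1 - (∑ i, lam i) / α) : ℝ) : ℂ) *
          ((∏ i, Real.Gamma (1 + lam i / 2) / Real.Gamma (1 / 2 - lam i / 2) : ℝ) : ℂ) *
          (L : ℂ) := by
  obtain ⟨c, hc, hcc⟩ := exists_ofReal_eq_I_pow hde
  refine ⟨_, hN.hasRegularizedIntegral h0 hd hde hFN hF0 hlam hlam1 hl hc, ?_⟩
  have hG : Real.Gamma (1 - (∑ i, lam i) / α) ≠ 0 :=
    (Real.Gamma_pos_of_pos (by rw [sub_pos, div_lt_one hN.pos]; exact hl)).ne'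
  have hlam2 : ∀ i, lam i < 2 := fun i => by
    linarith [hN.le_two, Finset.single_le_sum (fun k _ => hlam k) (Finset.mem_univ i)]
  have hK := prod_gamma_mul_prod_sinConst hlam hlam1 hlam2
  rw [← hc]
  norm_cast
  set E := ∫ x : EuclideanSpace ℝ (Fin d), prodSignedPow lam x.ofLp ∂μ
  set G := Real.Gamma (1 - (∑ i, lam i) / α)
  set A := ∏ i, Real.Gamma (1 + lam i / 2) / Real.Gamma (1 / 2 - lam i / 2)
  set S := ∏ i, (2 * sinConst (lam i))
  -- One factor c is the i^d of the formula, the other is contained in L; since c = ±1 they cancel,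
  -- as do G and the constants.
  calc E = (2 ^ (∑ i, lam i) / Real.pi ^ ((d : ℝ) / 2) * A * S) * (c * c) * (G / G) * E := by
        rw [hK, hcc, div_self hG]; ring
    _ = _ := by ring

end

end StableMoment

end

/-! ### The theorem, transferred from the law of ξ -/

theorem mainTheorem5 {Ω : Type*} [MeasurableSpace Ω] (P : Measure Ω) [IsProbabilityMeasure P]
    {d : ℕ} (hd : 0 < d) {α : ℝ} (hα₀ : 0 < α) (hα₂ : α ≤ 2)
    (ξ : Ω → EuclideanSpace ℝ (Fin d)) (hξm : AEMeasurable ξ P)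
    (hξ : IsSymmetricStable α ξ P) (hξ₀ : ¬ ∀ᵐ ω ∂P, ξ ω = 0)
    (F : Set (EuclideanSpace ℝ (Fin d))) (hF : IsAssociatedStarBody α ξ P F) :
    (∀ lam : Fin d → ℝ, (∀ i, 0 ≤ lam i) → (∀ i, lam i ≠ 1) → ∑ i, lam i < α →
      Integrable (fun ω => ∏ i, signedPow (ξ ω i) (lam i)) P ∧
      (Even d → ∃ L : ℝ,
        HasRegularizedIntegral F lam L ∧
        ((∀ i, lam i < 1) →
          HasPrincipalValue F (fun u => ∏ i, signedPow (u i) (-lam i - 1)) L) ∧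
        ((∫ ω, ∏ i, signedPow (ξ ω i) (lam i) ∂P : ℝ) : ℂ) =
          (((2 : ℝ) ^ (∑ i, lam i) : ℝ) : ℂ) * Complex.I ^ d /
              ((Real.pi ^ ((d : ℝ) / 2) : ℝ) : ℂ) *
            ((Real.Gamma (1 - (∑ i, lam i) / α) : ℝ) : ℂ) *
            ((∏ i, Real.Gamma (1 + lam i / 2) / Real.Gamma (1 / 2 - lam i / 2) : ℝ) : ℂ) *
            (L : ℂ)) ∧
      (Odd d → ∫ ω, ∏ i, signedPow (ξ ω i) (lam i) ∂P = 0)) ∧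
    (Even d → ∃ L : ℝ,
      HasPrincipalValue F (fun u => 1 / ∏ i, u i) L ∧
      ((∫ ω, Real.sign (∏ i, ξ ω i) ∂P : ℝ) : ℂ) =
        Complex.I ^ d / (Real.pi : ℂ) ^ d * (L : ℂ)) := by
  have hC := hF.isCentredStarBody
  have hprob : IsProbabilityMeasure (P.map ξ) := Measure.isProbabilityMeasure_map hξm
  have hN := StableMoment.isStableLaw_of_isAssociatedStarBody hα₀ hα₂ hF
  have h0 : ¬ ∀ᵐ x ∂(P.map ξ), x = 0 := by
    rwa [ae_map_iff hξm (p := fun x => x = 0) (measurableSet_singleton _)]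
  have hmeas : ∀ lam : Fin d → ℝ, Measurable fun x : EuclideanSpace ℝ (Fin d) =>
      StableMoment.prodSignedPow lam x.ofLp := fun lam =>
    (StableMoment.measurable_prodSignedPow lam).comp (by fun_prop)
  have hmap : ∀ lam : Fin d → ℝ, ∫ ω, ∏ i, signedPow (ξ ω i) (lam i) ∂P =
      ∫ x, StableMoment.prodSignedPow lam x.ofLp ∂(P.map ξ) := fun lam =>
    (integral_map hξm (hmeas lam).aestronglyMeasurable).symm
  have main : ∀ lam : Fin d → ℝ, (∀ i, 0 ≤ lam i) → (∀ i, lam i ≠ 1) → ∑ i, lam i < α →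
      Even d → _ := fun lam h1 h2 h3 he =>
    hN.integral_eq h0 hd he (StableMoment.mem_iff_gauge_le_one hC)
      (StableMoment.mem_nhds_zero hC) h1 h2 h3
  refine ⟨fun lam h1 h2 h3 => ⟨?_, fun he => ?_, fun ho => ?_⟩, fun he => ?_⟩
  · exact (hN.integrable_prodSignedPow h1 h3).comp_aemeasurable hξm
  · obtain ⟨L, hL, hE⟩ := main lam h1 h2 h3 he
    refine ⟨L, hL, StableMoment.hasPrincipalValue_of_lt_one hL, ?_⟩
    rw [hmap, hE]
  · rw [hmap, StableMoment.integral_prodSignedPow_eq_zero hξ.1 ho]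
  -- The sign moment is the case of zero exponents: each Γ(1/2) = √π in a denominator turns the
  -- power π^(d/2) into π^d.
  · obtain ⟨L, hL, hE⟩ := main 0 (fun _ => le_rfl) (fun _ => zero_ne_one) (by simpa using hα₀) he
    refine ⟨L, ?_, ?_⟩
    · have := StableMoment.hasPrincipalValue_of_lt_one hL fun _ => zero_lt_one
      simpa only [Pi.zero_apply, StableMoment.signedPow_neg_one, one_div,
        Finset.prod_inv_distrib] using this
    · rw [← hmap] at hE
      simp only [StableMoment.sign_prod]
      simp only [Pi.zero_apply, StableMoment.signedPow_zero_right] at hE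
      rw [hE]
      have hpi : Real.pi ^ ((d : ℝ) / 2) * √Real.pi ^ d = Real.pi ^ d := by
        rw [Real.sqrt_eq_rpow, ← Real.rpow_mul_natCast Real.pi_pos.le, ← Real.rpow_add Real.pi_pos,
          ← Real.rpow_natCast]
        congr 1; ring
      have hpi' : (Real.pi : ℂ) ^ d = ((Real.pi ^ ((d : ℝ) / 2) * √Real.pi ^ d : ℝ) : ℂ) := by
        rw [hpi]; push_cast; rfl
      have hΓ : Real.Gamma (1 / 2 - 0 / 2) = √Real.pi := by
        rw [zero_div, sub_zero, Real.Gamma_one_half_eq]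
      rw [hpi', hΓ]
      simp
      exact Or.inl (by ring)
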